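/- **Lemma 4.3 (crystalline Poincaré lemma).** Let $X$ be a smooth, separated, quasi-compact scheme over $\mathbb C$ (a smooth algebraic variety). *Notation.* $\mathcal P^m_X=(\mathcal O_X\otimes_{\mathbb C}\mathcal O_X)/\mathcal I^{m+1}$, with $\mathcal I$ the kernel of the multiplication, is the sheaf of principal parts of order $m$; $f\mapsto f\otimes 1$ gives its left and $f\mapsto 1\otimes f$ its right $\mathcal O_X$-module structure. Tensor products $\mathcal P^m_X\otimes_{\mathcal O_X}-$ are formed with the right structure and regarded as $\mathcal O_X$-modules through the left one. Let $\nu(\mathcal O_X)$ be the category of pro-objects of coherent $\mathcal O_X$-modules, that is, of systems indexed by small cofiltered categories, with $\mathrm{Hom}(\{F_i\},\{G_j\})=\varprojlim_j\varinjlim_i\mathrm{Hom}(F_i,G_j)$. A *stratified pro-module* is an object $F$ of $\nu(\mathcal O_X)$ with an $\mathcal O_X$-linear coaction $F\to\{\mathcal P^m_X\}_m\otimes F$ which is counital with respect to the diagonal $\mathcal P^0_X=\mathcal O_X$ and coassociative with respect to the maps $\delta:\mathcal P^{m+n}_X\to\mathcal P^m_X\otimes_{\mathcal O_X}\mathcal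 P^n_X$, $f\otimes g\mapsto (f\otimes 1)\otimes(1\otimes g)$. The morphisms of stratified pro-modules are the morphisms of pro-objects compatible with the coactions; they form the category $\nu(\mathcal P_X)$. The sheaf $\mathcal O_X$ with the coaction $f\mapsto f\otimes 1$, and $\{\mathcal P^m_X\otimes\Omega^p_X\}_m$ with the coaction given by $\delta$, are objects of $\nu(\mathcal P_X)$. The linearized de Rham complex is the complex in $\nu(\mathcal P_X)$ with terms $\{\mathcal P^m_X\}\otimes\Omega^p_X$, $p\ge 0$ (where $\Omega^0_X=\mathcal O_X$), and differentials $\overline\nabla^p$ given on levels by $$\mathcal P^{m+1}_X\otimes\Omega^p_X\to\mathcal P^m_X\otimes\Omega^{p+1}_X,\qquad (f\otimes g)\otimes\omega\mapsto (f\otimes 1)\otimes d(g\omega).$$ Let $d^0:\mathcal O_X\to\{\mathcal P^m_X\}$ be the map $f\mapsto f\otimes1$. *Statement.* The linearized de Rham complex is bounded: if the local relative dimensions of $X$ over $\mathbb C$ are all at most $d$, its terms vanish in degrees $p>d$ (and it vanishes in large degrees in any case). It is a resolution of $\mathcal O_X$ through $d^0$: the augmented complex $$0\to\mathcal O_X\xrightarrow{d^0}\{\mathcal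 P^m_X\}\xrightarrow{\overline\nabla^0}\{\mathcal P^m_X\}\otimes\Omega^1_X\xrightarrow{\overline\nabla^1}\cdots\xrightarrow{\overline\nabla^{d-1}}\{\mathcal P^m_X\}\otimes\Omega^d_X\to 0$$ is exact in $\nu(\mathcal P_X)$, and also as a complex in $\nu(\mathcal O_X)$. All the modules $\mathcal P^m_X\otimes\Omega^p_X$ are coherent and locally free, and the augmented complex is locally homotopic to zero: every point of $X$ has an open neighbourhood $U$ over which the identity of the underlying complex of pro-$\mathcal O_U$-modules is homotopic to $0$. -/

import Mathlib

open CategoryTheory TensorProduct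


namespace CrysPoincare

noncomputable section

/-! ### The exterior derivative on Kähler forms -/

section ExteriorDerivative

variable (k A : Type*) [CommRing k] [CommRing A] [Algebra k A]

/-- The algebra of Kähler forms `⨁ₚ ⋀ᵖ Ω_{A/k}`. -/
abbrev FormAlg := ExteriorAlgebra A Ω[A⁄k]

/-- The universal derivation, seen in the algebra of forms. -/
def dForm (a : A) : FormAlg k A := ExteriorAlgebra.ι A (KaehlerDifferential.D k A a)

/-- The grade involution of the algebra of forms: multiplication by `(-1)ᵖ` on `p`-forms. -/
def grInv : FormAlg k A →ₐ[A] FormAlg k A := CliffordAlgebra.involute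

variable {k A}

lemma grInv_ι (w : Ω[A⁄k]) :
    grInv k A (ExteriorAlgebra.ι A w) = -ExteriorAlgebra.ι A w :=
  CliffordAlgebra.involute_ι w

lemma grInv_grInv (x : FormAlg k A) : grInv k A (grInv k A x) = x :=
  CliffordAlgebra.involute_involute x

lemma ι_mul_comm (w : Ω[A⁄k]) (x : FormAlg k A) :
    ExteriorAlgebra.ι A w * x = grInv k A x * ExteriorAlgebra.ι A w := by
  induction x using ExteriorAlgebra.induction with
  | algebraMap r => rw [AlgHom.commutes]; exact (Algebra.commutes r _).symm
  | ι v => rw [grInv_ι, neg_mul]; exact eq_neg_of_add_eq_zero_left (ExteriorAlgebra.ι_add_mul_swap w v)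
  | mul a b ha hb => rw [map_mul, ← mul_assoc, ha, mul_assoc, hb, mul_assoc]
  | add a b ha hb => rw [map_add, mul_add, add_mul, ha, hb]

variable (k A)

/-- Pairs of forms `(x, y)` with the product `(x, y)(x', y') = (xx', (-1)^{|x|} x y' + y x')`:
a linear map `d` on forms satisfies the graded Leibniz rule iff `x ↦ (x, d x)` is
multiplicative. -/
@[ext] structure LeibnizPair where
  val : FormAlg k A
  der : FormAlg k A

namespace LeibnizPair

instance : Add (LeibnizPair k A) := ⟨fun p q => ⟨p.val + q.val, p.der + q.der⟩⟩
instance : Zero (LeibnizPair k A) := ⟨⟨0, 0⟩⟩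
instance : Neg (LeibnizPair k A) := ⟨fun p => ⟨-p.val, -p.der⟩⟩
instance : One (LeibnizPair k A) := ⟨⟨1, 0⟩⟩
instance : Mul (LeibnizPair k A) :=
  ⟨fun p q => ⟨p.val * q.val, grInv k A p.val * q.der + p.der * q.val⟩⟩

variable {k A}
@[simp] lemma add_val (p q : LeibnizPair k A) : (p + q).val = p.val + q.val := rfl
@[simp] lemma add_der (p q : LeibnizPair k A) : (p + q).der = p.der + q.der := rfl
@[simp] lemma zero_val : (0 : LeibnizPair k A).val = 0 := rfl
@[simp] lemma zero_der : (0 : LeibnizPair k A).der = 0 := rfl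
@[simp] lemma neg_val (p : LeibnizPair k A) : (-p).val = -p.val := rfl
@[simp] lemma neg_der (p : LeibnizPair k A) : (-p).der = -p.der := rfl
@[simp] lemma one_val : (1 : LeibnizPair k A).val = 1 := rfl
@[simp] lemma one_der : (1 : LeibnizPair k A).der = 0 := rfl
@[simp] lemma mul_val (p q : LeibnizPair k A) : (p * q).val = p.val * q.val := rfl
@[simp] lemma mul_der (p q : LeibnizPair k A) :
    (p * q).der = grInv k A p.val * q.der + p.der * q.val := rfl
variable (k A)

instance : Ring (LeibnizPair k A) where
  add_assoc _ _ _ := by ext <;> simp [add_assoc]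
  zero_add _ := by ext <;> simp
  add_zero _ := by ext <;> simp
  add_comm _ _ := by ext <;> simp [add_comm]
  neg_add_cancel _ := by ext <;> simp
  left_distrib _ _ _ := by
    ext
    · simp [mul_add]
    · simp only [mul_der, add_val, add_der, mul_add]; abel
  right_distrib _ _ _ := by
    ext
    · simp [add_mul]
    · simp only [mul_der, add_val, add_der, map_add, add_mul]; abel
  zero_mul _ := by ext <;> simp
  mul_zero _ := by ext <;> simp
  mul_assoc _ _ _ := by
    ext
    · simp [mul_assoc]
    · simp only [mul_der, mul_val, map_mul, mul_add, add_mul, mul_assoc]; abel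
  one_mul _ := by ext <;> simp
  mul_one _ := by ext <;> simp
  nsmul := nsmulRec
  zsmul := zsmulRec

/-- `a ↦ (a, da)`. -/
def scalarHom : A →+* LeibnizPair k A where
  toFun a := ⟨algebraMap A _ a, dForm k A a⟩
  map_one' := by ext <;> simp [dForm]
  map_zero' := by ext <;> simp [dForm]
  map_add' _ _ := by ext <;> simp [dForm]
  map_mul' a b := by
    ext
    · simp
    · simp only [dForm, Derivation.leibniz, map_add, map_smul, mul_der, AlgHom.commutes,
        Algebra.smul_def]
      rw [← Algebra.commutes b]

instance : Algebra A (LeibnizPair k A) :=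
  (scalarHom k A).toAlgebra' fun a p => by
    ext
    · exact Algebra.commutes a _
    · simp only [scalarHom, RingHom.coe_mk, MonoidHom.coe_mk, OneHom.coe_mk, mul_der,
        AlgHom.commutes, dForm]
      rw [ι_mul_comm, Algebra.commutes a p.der, add_comm]

lemma algebraMap_val (a : A) : (algebraMap A (LeibnizPair k A) a).val = algebraMap A _ a := rfl
lemma algebraMap_der (a : A) : (algebraMap A (LeibnizPair k A) a).der = dForm k A a := rfl

instance : Algebra k (LeibnizPair k A) :=
  ((algebraMap A (LeibnizPair k A)).comp (algebraMap k A)).toAlgebra'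
    fun c p => Algebra.commutes (algebraMap k A c) p

instance : IsScalarTower k A (LeibnizPair k A) := IsScalarTower.of_algebraMap_eq fun _ => rfl

/-- The derivation `a ↦ (da, 0)`, expressing `d(da) = 0`. -/
def baseDerivation : Derivation k A (LeibnizPair k A) where
  toFun a := ⟨dForm k A a, 0⟩
  map_add' _ _ := by ext <;> simp [dForm]
  map_smul' c a := by
    have h : ∀ p : LeibnizPair k A, c • p = algebraMap A _ (algebraMap k A c) * p := fun p => by
      rw [← IsScalarTower.algebraMap_smul A c p]; exact Algebra.smul_def _ _
    rw [RingHom.id_apply, h]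
    ext
    · rw [mul_val, algebraMap_val, ← Algebra.smul_def]
      simp only [dForm, Derivation.map_smul]
      rw [← IsScalarTower.algebraMap_smul A c, map_smul]
    · simp [algebraMap_der, dForm]
  map_one_eq_zero' := by ext <;> simp [dForm]
  leibniz' a b := by
    simp only [Algebra.smul_def]
    ext
    · simp [algebraMap_val, dForm, Algebra.smul_def]
    · simp [algebraMap_val, algebraMap_der, dForm, ExteriorAlgebra.ι_add_mul_swap]

/-- `ω ↦ (ω, dω)` on `1`-forms. -/
def ofOneForm : Ω[A⁄k] →ₗ[A] LeibnizPair k A := (baseDerivation k A).liftKaehlerDifferential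

lemma ofOneForm_D (a : A) : ofOneForm k A (KaehlerDifferential.D k A a) = ⟨dForm k A a, 0⟩ :=
  Derivation.liftKaehlerDifferential_comp_D _ _

lemma ofOneForm_spec (w : Ω[A⁄k]) :
    (ofOneForm k A w).val = ExteriorAlgebra.ι A w ∧
      ∀ x, (ofOneForm k A w).der * x = x * (ofOneForm k A w).der := by
  have hw : w ∈ Submodule.span A (Set.range (KaehlerDifferential.D k A)) := by
    rw [KaehlerDifferential.span_range_derivation]; trivial
  induction hw using Submodule.span_induction with
  | mem w hw => obtain ⟨a, rfl⟩ := hw; simp [ofOneForm_D, dForm]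
  | zero => simp
  | add v w _ _ hv hw =>
    refine ⟨by simp [hv.1, hw.1], fun x => ?_⟩
    rw [map_add, add_der, add_mul, mul_add, hv.2, hw.2]
  | smul a w _ hw =>
    rw [map_smul, Algebra.smul_def]
    refine ⟨by simp [hw.1, algebraMap_val, Algebra.smul_def], fun x => ?_⟩
    simp only [mul_der, algebraMap_val, algebraMap_der, AlgHom.commutes, hw.1, dForm, add_mul,
      mul_add]
    congr 1
    · rw [mul_assoc, hw.2, ← mul_assoc, Algebra.commutes, mul_assoc]
    · rw [mul_assoc, ι_mul_comm w, ← mul_assoc, ι_mul_comm _ (grInv k A x), grInv_grInv, mul_assoc]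

/-- The algebra map `x ↦ (x, dx)`. -/
def toPair : FormAlg k A →ₐ[A] LeibnizPair k A :=
  ExteriorAlgebra.lift A ⟨ofOneForm k A, fun w => by
    obtain ⟨h1, h2⟩ := ofOneForm_spec k A w
    ext
    · simp [h1]
    · simp [h1, grInv_ι, h2]⟩

lemma toPair_ι (w : Ω[A⁄k]) : toPair k A (ExteriorAlgebra.ι A w) = ofOneForm k A w := by
  simp [toPair]

lemma toPair_val (x : FormAlg k A) : (toPair k A x).val = x := by
  induction x using ExteriorAlgebra.induction with
  | algebraMap r => rw [AlgHom.commutes]; rfl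
  | ι v => rw [toPair_ι, (ofOneForm_spec k A v).1]
  | mul a b ha hb => rw [map_mul, mul_val, ha, hb]
  | add a b ha hb => rw [map_add, add_val, ha, hb]

end LeibnizPair

open LeibnizPair

/-- The exterior derivative on the algebra of forms: the unique additive map with `d a = da`,
`d (da) = 0` and `d (xy) = dx y + (-1)^{|x|} x dy`. -/
def extD : FormAlg k A →ₗ[k] FormAlg k A where
  toFun x := (toPair k A x).der
  map_add' x y := by simp
  map_smul' c x := by
    rw [RingHom.id_apply, ← IsScalarTower.algebraMap_smul A c x, Algebra.smul_def, map_mul, mul_der,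
      AlgHom.commutes, algebraMap_der, algebraMap_val, AlgHom.commutes, ← Algebra.smul_def,
      IsScalarTower.algebraMap_smul]
    simp [dForm]

variable {k A}

lemma extD_algebraMap (a : A) : extD k A (algebraMap A _ a) = dForm k A a := by
  show (toPair k A _).der = _
  rw [AlgHom.commutes]; rfl

lemma extD_dForm (a : A) : extD k A (dForm k A a) = 0 := by
  show (toPair k A (ExteriorAlgebra.ι A _)).der = _
  rw [toPair_ι, ofOneForm_D]

lemma extD_mul (x y : FormAlg k A) :
    extD k A (x * y) = grInv k A x * extD k A y + extD k A x * y := by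
  show (toPair k A (x * y)).der = _
  rw [map_mul, mul_der, toPair_val, toPair_val]; rfl

lemma extD_smul (a : A) (x : FormAlg k A) :
    extD k A (a • x) = a • extD k A x + dForm k A a * x := by
  rw [Algebra.smul_def, extD_mul, extD_algebraMap, AlgHom.commutes, Algebra.smul_def]

/-- Forms are generated by functions and their differentials. -/
lemma form_induction {C : FormAlg k A → Prop} (hA : ∀ a, C (algebraMap A _ a))
    (hd : ∀ a, C (dForm k A a)) (hmul : ∀ x y, C x → C y → C (x * y))
    (hadd : ∀ x y, C x → C y → C (x + y)) (x : FormAlg k A) : C x := by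
  induction x using ExteriorAlgebra.induction with
  | algebraMap r => exact hA r
  | mul a b ha hb => exact hmul a b ha hb
  | add a b ha hb => exact hadd a b ha hb
  | ι w =>
    have hw : w ∈ Submodule.span A (Set.range (KaehlerDifferential.D k A)) := by
      rw [KaehlerDifferential.span_range_derivation]; trivial
    induction hw using Submodule.span_induction with
    | mem w hw => obtain ⟨a, rfl⟩ := hw; exact hd a
    | zero => simpa using hA 0
    | add v w _ _ hv hw => rw [map_add]; exact hadd _ _ hv hw
    | smul a w _ hw => rw [map_smul, Algebra.smul_def]; exact hmul _ _ (hA a) hw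

lemma extD_grInv (x : FormAlg k A) : extD k A (grInv k A x) = - grInv k A (extD k A x) := by
  induction x using form_induction with
  | hA a => simp [extD_algebraMap, dForm, grInv_ι]
  | hd a => rw [extD_dForm]; simp [dForm, grInv_ι]; exact extD_dForm a
  | hmul x y hx hy => simp only [map_mul, extD_mul, hx, hy, map_add, mul_neg, neg_mul]; abel
  | hadd x y hx hy => simp only [map_add, hx, hy]; abel

lemma extD_extD (x : FormAlg k A) : extD k A (extD k A x) = 0 := by
  induction x using form_induction with
  | hA a => rw [extD_algebraMap, extD_dForm]
  | hd a => rw [extD_dForm, map_zero]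
  | hmul x y hx hy =>
    simp only [extD_mul, map_add, hx, hy, extD_grInv]; simp
  | hadd x y hx hy => rw [map_add, map_add, hx, hy, add_zero]

/-- The exterior derivative raises the degree by one. -/
lemma extD_mem {p : ℕ} {x : FormAlg k A} (hx : x ∈ ⋀[A]^p Ω[A⁄k]) :
    extD k A x ∈ ⋀[A]^(p + 1) Ω[A⁄k] := by
  have hone : ∀ w : Ω[A⁄k], extD k A (ExteriorAlgebra.ι A w) ∈ ⋀[A]^2 Ω[A⁄k] := by
    intro w
    have hw : w ∈ Submodule.span A (Set.range (KaehlerDifferential.D k A)) := by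
      rw [KaehlerDifferential.span_range_derivation]; trivial
    induction hw using Submodule.span_induction with
    | mem w hw =>
      obtain ⟨a, rfl⟩ := hw
      have := extD_dForm (k := k) a
      rw [dForm] at this
      rw [this]; exact zero_mem _
    | zero => rw [map_zero, map_zero]; exact zero_mem _
    | add v w _ _ hv hw => rw [map_add, map_add]; exact add_mem hv hw
    | smul a w _ hw =>
      rw [map_smul, extD_smul]
      refine add_mem (Submodule.smul_mem _ _ hw) ?_
      rw [ExteriorAlgebra.exteriorPower, pow_two]
      exact Submodule.mul_mem_mul ⟨_, rfl⟩ ⟨_, rfl⟩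
  induction p generalizing x with
  | zero =>
    rw [ExteriorAlgebra.exteriorPower, pow_zero, Submodule.mem_one] at hx
    obtain ⟨a, rfl⟩ := hx
    rw [extD_algebraMap, ExteriorAlgebra.exteriorPower, zero_add, pow_one]
    exact ⟨_, rfl⟩
  | succ p ih =>
    rw [ExteriorAlgebra.exteriorPower, pow_succ'] at hx
    induction hx using Submodule.mul_induction_on' with
    | mem_mul_mem v hv y hy =>
      obtain ⟨w, rfl⟩ := hv
      rw [extD_mul, grInv_ι]
      refine add_mem ?_ ?_
      · rw [ExteriorAlgebra.exteriorPower, pow_succ', neg_mul]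
        exact neg_mem (Submodule.mul_mem_mul ⟨_, rfl⟩ (ih hy))
      · rw [ExteriorAlgebra.exteriorPower, show p + 1 + 1 = 2 + p by ring, pow_add]
        exact Submodule.mul_mem_mul (hone w) hy
    | add y _ z _ hy hz => rw [map_add]; exact add_mem hy hz

variable (k A) in
/-- The exterior derivative `⋀ᵖ Ω_{A/k} → ⋀ᵖ⁺¹ Ω_{A/k}`. -/
def extDeriv (p : ℕ) : ⋀[A]^p Ω[A⁄k] →ₗ[k] ⋀[A]^(p + 1) Ω[A⁄k] :=
  ((extD k A).comp ((⋀[A]^p Ω[A⁄k]).subtype.restrictScalars k)).codRestrict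
    ((⋀[A]^(p + 1) Ω[A⁄k]).restrictScalars k) fun x => extD_mem x.2

variable (k) {B : Type*} [CommRing B] [Algebra k B] [Algebra A B] [IsScalarTower k A B]

variable (A B) in
/-- Functoriality of forms in the algebra. -/
def formMap : FormAlg k A →ₐ[A] FormAlg k B :=
  ExteriorAlgebra.lift A
    ⟨((ExteriorAlgebra.ι B).restrictScalars A).comp (KaehlerDifferential.map k k A B), fun _ =>
      ExteriorAlgebra.ι_sq_zero _⟩

lemma formMap_ι (w : Ω[A⁄k]) : formMap k A B (ExteriorAlgebra.ι A w) =
    ExteriorAlgebra.ι B (KaehlerDifferential.map k k A B w) := by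
  exact ExteriorAlgebra.lift_ι_apply A _ _ w

lemma formMap_dForm (a : A) : formMap k A B (dForm k A a) = dForm k B (algebraMap A B a) := by
  rw [dForm, formMap_ι, KaehlerDifferential.map_D]; rfl

lemma formMap_algebraMap (a : A) :
    formMap k A B (algebraMap A _ a) = algebraMap B _ (algebraMap A B a) := by
  rw [AlgHom.commutes, IsScalarTower.algebraMap_apply A B]

lemma formMap_grInv (x : FormAlg k A) :
    formMap k A B (grInv k A x) = grInv k B (formMap k A B x) := by
  induction x using form_induction with
  | hA a => rw [AlgHom.commutes, formMap_algebraMap, AlgHom.commutes]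
  | hd a => rw [formMap_dForm, dForm, grInv_ι, dForm, grInv_ι, map_neg, ← dForm, formMap_dForm]; rfl
  | hmul x y hx hy => simp only [map_mul, hx, hy]
  | hadd x y hx hy => simp only [map_add, hx, hy]

lemma formMap_extD (x : FormAlg k A) :
    formMap k A B (extD k A x) = extD k B (formMap k A B x) := by
  induction x using form_induction with
  | hA a => rw [extD_algebraMap, formMap_algebraMap, extD_algebraMap, formMap_dForm]
  | hd a => rw [extD_dForm, formMap_dForm, extD_dForm, map_zero]
  | hmul x y hx hy => simp only [extD_mul, map_mul, map_add, hx, hy, formMap_grInv]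
  | hadd x y hx hy => simp only [map_add, hx, hy]

lemma formMap_mem {p : ℕ} {x : FormAlg k A} (hx : x ∈ ⋀[A]^p Ω[A⁄k]) :
    formMap k A B x ∈ ⋀[B]^p Ω[B⁄k] := by
  induction p generalizing x with
  | zero =>
    rw [ExteriorAlgebra.exteriorPower, pow_zero, Submodule.mem_one] at hx ⊢
    obtain ⟨a, rfl⟩ := hx
    exact ⟨_, (formMap_algebraMap k a).symm⟩
  | succ p ih =>
    rw [ExteriorAlgebra.exteriorPower, pow_succ'] at hx ⊢
    induction hx using Submodule.mul_induction_on' with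
    | mem_mul_mem v hv y hy =>
      obtain ⟨w, rfl⟩ := hv
      rw [map_mul, formMap_ι]
      exact Submodule.mul_mem_mul ⟨_, rfl⟩ (ih hy)
    | add y _ z _ hy hz => rw [map_add]; exact add_mem hy hz

end ExteriorDerivative
end
end CrysPoincare


namespace CrysPoincare

noncomputable section
/-! ### Principal parts of a module over an algebra -/

section PrincipalParts

variable (k A : Type*) [CommRing k] [CommRing A] [Algebra k A]
variable {M N L : Type*} [AddCommGroup M] [Module k M] [Module A M] [IsScalarTower k A M]
  [AddCommGroup N] [Module k N] [Module A N] [IsScalarTower k A N]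
  [AddCommGroup L] [Module k L] [Module A L] [IsScalarTower k A L]

/-- The action `f ⊗ g ↦ f ⊗ gx` of `A ⊗ A` on the element `1 ⊗ x` of `A ⊗ M`. -/
def act (x : M) : A ⊗[k] A →ₗ[A] A ⊗[k] M :=
  LinearMap.baseChange A ((LinearMap.toSpanSingleton A M x).restrictScalars k)

@[simp] lemma act_tmul (x : M) (f g : A) : act k A x (f ⊗ₜ g) = f ⊗ₜ[k] (g • x) := rfl

variable (M) in
/-- The submodule `Iⁿ · (A ⊗ M)` of `A ⊗ M`, where `I` is the kernel of the multiplication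
`A ⊗ A → A`. -/
def filt (n : ℕ) : Submodule A (A ⊗[k] M) :=
  Submodule.span A {y | ∃ (x : M) (s : A ⊗[k] A), s ∈ KaehlerDifferential.ideal k A ^ n ∧
    y = act k A x s}

variable (M) in
/-- The principal parts of order `m` of `M`:
`P^m ⊗_A M = (A ⊗ A)/I^{m+1} ⊗_A M = (A ⊗ M)/I^{m+1}(A ⊗ M)`,
where `P^m = (A ⊗ A)/I^{m+1}` is a right `A`-module through the second factor for the
formation of the tensor product; the result is an `A`-module through the first factor. -/
abbrev PrincipalParts (m : ℕ) : Type _ := (A ⊗[k] M) ⧸ filt k A M (m + 1)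

variable (M) in
/-- The operator "multiplication by `1 ⊗ g - g ⊗ 1`" on `A ⊗ M`. -/
def xi (g : A) : A ⊗[k] M →ₗ[A] A ⊗[k] M :=
  LinearMap.baseChange A ((LinearMap.lsmul A M g).restrictScalars k) - g • LinearMap.id

lemma xi_tmul (g a : A) (x : M) : xi k A M g (a ⊗ₜ x) = a ⊗ₜ (g • x) - (g * a) ⊗ₜ x := by
  simp [xi, smul_tmul']

lemma xi_act (g : A) (x : M) (s : A ⊗[k] A) :
    xi k A M g (act k A x s) = act k A x (s * (1 ⊗ₜ g - g ⊗ₜ 1)) := by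
  induction s using TensorProduct.induction_on with
  | zero => simp
  | tmul a b => simp [xi_tmul, mul_sub, smul_smul, mul_comm g]
  | add s t hs ht => rw [map_add, map_add, hs, ht, add_mul, map_add]

lemma xi_comm (g h : A) (y : A ⊗[k] M) :
    xi k A M g (xi k A M h y) = xi k A M h (xi k A M g y) := by
  induction y using TensorProduct.induction_on with
  | zero => simp
  | tmul a x =>
    simp only [xi_tmul, map_sub, smul_smul, mul_comm h g, mul_left_comm h g]
    abel
  | add y z hy hz => simp only [map_add, hy, hz]

lemma filt_zero : filt k A M 0 = ⊤ := by
  rw [eq_top_iff]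
  intro y _
  induction y using TensorProduct.induction_on with
  | zero => exact zero_mem _
  | tmul a x => exact Submodule.subset_span ⟨x, a ⊗ₜ 1, by simp, by simp⟩
  | add y z hy hz => exact add_mem (hy trivial) (hz trivial)

lemma filt_succ_le (n : ℕ) (Q : Submodule A (A ⊗[k] M))
    (h : ∀ g, ∀ y ∈ filt k A M n, xi k A M g y ∈ Q) : filt k A M (n + 1) ≤ Q := by
  refine Submodule.span_le.2 ?_
  rintro _ ⟨x, s, hs, rfl⟩
  rw [pow_succ] at hs
  induction hs using Submodule.mul_induction_on' with
  | add s _ t _ hs ht => rw [map_add]; exact add_mem hs ht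
  | mem_mul_mem s hs t ht =>
    have ht' : t ∈ (KaehlerDifferential.ideal k A).restrictScalars A := ht
    rw [← KaehlerDifferential.submodule_span_range_eq_ideal] at ht'
    induction ht' using Submodule.span_induction with
    | mem t h' =>
      obtain ⟨g, rfl⟩ := h'
      show act k A x (s * _) ∈ Q
      rw [← xi_act]
      exact h g _ (Submodule.subset_span ⟨x, s, hs, rfl⟩)
    | zero => simp
    | add t u h1 h2 iht ihu =>
      rw [mul_add, map_add]
      refine add_mem (iht ?_) (ihu ?_)
      · rw [KaehlerDifferential.submodule_span_range_eq_ideal] at h1; exact h1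
      · rw [KaehlerDifferential.submodule_span_range_eq_ideal] at h2; exact h2
    | smul a t h1 iht =>
      rw [mul_smul_comm, map_smul]
      refine Submodule.smul_mem _ _ (iht ?_)
      rw [KaehlerDifferential.submodule_span_range_eq_ideal] at h1; exact h1

lemma xi_mem {n : ℕ} (g : A) {y : A ⊗[k] M} (hy : y ∈ filt k A M n) :
    xi k A M g y ∈ filt k A M (n + 1) := by
  induction hy using Submodule.span_induction with
  | mem y hy =>
    obtain ⟨x, s, hs, rfl⟩ := hy
    rw [xi_act]
    refine Submodule.subset_span ⟨x, _, ?_, rfl⟩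
    rw [pow_succ]
    exact Ideal.mul_mem_mul hs (KaehlerDifferential.one_smul_sub_smul_one_mem_ideal k g)
  | zero => simp
  | add y z _ _ hy hz => rw [map_add]; exact add_mem hy hz
  | smul a y _ hy => rw [map_smul]; exact Submodule.smul_mem _ _ hy

lemma filt_anti {m n : ℕ} (h : m ≤ n) : filt k A M n ≤ filt k A M m := by
  refine Submodule.span_mono ?_
  rintro _ ⟨x, s, hs, rfl⟩
  exact ⟨x, s, Ideal.pow_le_pow_right h hs, rfl⟩

variable {k}

/-- The commutator `x ↦ D (a x) - a D x`. -/
def commutator (D : M →ₗ[k] N) (a : A) : M →ₗ[k] N :=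
  D ∘ₗ (LinearMap.lsmul A M a).restrictScalars k - (LinearMap.lsmul A N a).restrictScalars k ∘ₗ D

@[simp] lemma commutator_apply (D : M →ₗ[k] N) (a : A) (x : M) :
    commutator A D a x = D (a • x) - a • D x := rfl

/-- `D` is a differential operator of order at most `n` (Grothendieck's definition). -/
def IsDiffOp : ℕ → (M →ₗ[k] N) → Prop
  | 0, D => ∀ a : A, commutator A D a = 0
  | n + 1, D => ∀ a : A, IsDiffOp n (commutator A D a)

variable {A}

lemma baseChange_xi (D : M →ₗ[k] N) (g : A) (y : A ⊗[k] M) :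
    D.baseChange A (xi k A M g y) =
      xi k A N g (D.baseChange A y) + (commutator A D g).baseChange A y := by
  induction y using TensorProduct.induction_on with
  | zero => simp
  | tmul a x => simp [xi_tmul, tmul_sub]
  | add y z hy hz => simp only [map_add, hy, hz]; abel

/-- A differential operator `D` of order at most `n` induces `P^{m+n} ⊗ M → P^m ⊗ N`. -/
lemma IsDiffOp.filt_le {n : ℕ} {D : M →ₗ[k] N} (hD : IsDiffOp A n D) (m : ℕ) :
    filt k A M (m + n) ≤ (filt k A N m).comap (D.baseChange A) := by
  induction n generalizing m D with
  | zero =>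
    induction m with
    | zero => rw [filt_zero k A (M := N)]; exact le_top
    | succ m ih =>
      refine filt_succ_le k A _ _ fun g y hy => ?_
      rw [Submodule.mem_comap, baseChange_xi, hD g]
      simpa using xi_mem k A g (ih hy)
  | succ n ihn =>
    induction m with
    | zero => rw [filt_zero k A (M := N)]; exact le_top
    | succ m ih =>
      rw [show m + 1 + (n + 1) = m + (n + 1) + 1 by ring]
      refine filt_succ_le k A _ _ fun g y hy => ?_
      rw [Submodule.mem_comap, baseChange_xi]
      refine add_mem (xi_mem k A g (ih hy)) (ihn (hD g) (m + 1) ?_)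
      rwa [show m + 1 + n = m + (n + 1) by ring]

lemma IsDiffOp.of_linear {D : M →ₗ[k] N} (h : ∀ (a : A) x, D (a • x) = a • D x) :
    IsDiffOp A 0 D := fun a => by ext x; simp [h]

lemma IsDiffOp.comp_linear {n : ℕ} {D : M →ₗ[k] N} (hD : IsDiffOp A n D) {E : N →ₗ[k] L}
    (hE : ∀ (a : A) x, E (a • x) = a • E x) : IsDiffOp A n (E ∘ₗ D) := by
  have h : ∀ (D : M →ₗ[k] N) (a : A), commutator A (E ∘ₗ D) a = E ∘ₗ commutator A D a := by
    intro D a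
    ext x
    simp only [commutator_apply, LinearMap.comp_apply, map_sub, hE]
  induction n generalizing D with
  | zero => intro a; rw [h, hD a, LinearMap.comp_zero]
  | succ n ih =>
    intro a
    rw [h]
    exact ih (hD a)

variable (A) in
/-- The universal operator `x ↦ 1 ⊗ x` of order at most `m`. -/
def univOp (m : ℕ) : M →ₗ[k] PrincipalParts k A M m :=
  (filt k A M (m + 1)).mkQ.restrictScalars k ∘ₗ TensorProduct.mk k A M 1

lemma univOp_isDiffOp (m : ℕ) : IsDiffOp A m (univOp A m : M →ₗ[k] PrincipalParts k A M m) := by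
  have hc : ∀ (f : A ⊗[k] M →ₗ[A] A ⊗[k] M) (_ : ∀ g y, f (xi k A M g y) = xi k A M g (f y))
      (g : A), commutator A ((filt k A M (m + 1)).mkQ.restrictScalars k ∘ₗ
        f.restrictScalars k ∘ₗ TensorProduct.mk k A M 1) g =
        (filt k A M (m + 1)).mkQ.restrictScalars k ∘ₗ
          (xi k A M g ∘ₗ f).restrictScalars k ∘ₗ TensorProduct.mk k A M 1 := fun f hf g => by
    ext x
    simp only [commutator_apply, LinearMap.comp_apply, LinearMap.restrictScalars_apply,
      TensorProduct.mk_apply, ← hf, xi_tmul, ← map_smul, ← map_sub, mul_one, smul_tmul',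
      smul_eq_mul]
  have key : ∀ (n j : ℕ), n + j = m → ∀ f : A ⊗[k] M →ₗ[A] A ⊗[k] M,
      (∀ g y, f (xi k A M g y) = xi k A M g (f y)) → (∀ y, f y ∈ filt k A M j) →
      IsDiffOp A n ((filt k A M (m + 1)).mkQ.restrictScalars k ∘ₗ f.restrictScalars k ∘ₗ
        TensorProduct.mk k A M 1) := by
    intro n
    induction n with
    | zero =>
      intro j hn f hf hf' g
      rw [hc f hf]
      ext x
      obtain rfl : j = m := by omega
      simpa using xi_mem k A g (hf' (1 ⊗ₜ x))
    | succ n ih =>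
      intro j hn f hf hf' g
      rw [hc f hf]
      refine ih (j + 1) (by omega) _ (fun h y => ?_) (fun y => xi_mem k A g (hf' y))
      rw [LinearMap.comp_apply, hf, xi_comm, LinearMap.comp_apply]
  exact key m 0 rfl LinearMap.id (fun _ _ => rfl) (fun y => by rw [filt_zero]; trivial)

/-- The map `P^m ⊗ M → P^n ⊗ N` induced by a `k`-linear map `D : M → N` which is
compatible with the filtrations. -/
def ppMap {m n : ℕ} (D : M →ₗ[k] N)
    (h : filt k A M (m + 1) ≤ (filt k A N (n + 1)).comap (D.baseChange A)) :
    PrincipalParts k A M m →ₗ[A] PrincipalParts k A N n :=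
  Submodule.mapQ _ _ (D.baseChange A) h

variable (k A M) in
/-- The map `P^m ⊗ M → M`, `(f ⊗ g) ⊗ x ↦ fgx`, induced by the diagonal `P^m → A`. -/
def ppAug (m : ℕ) : PrincipalParts k A M m →ₗ[A] M :=
  (filt k A M (m + 1)).liftQ (LinearMap.liftBaseChange A (LinearMap.id (R := k) (M := M))) <| by
    refine (filt_anti k A (Nat.le_add_left 1 m)).trans (filt_succ_le k A 0 _ fun g y _ => ?_)
    rw [LinearMap.mem_ker]
    induction y using TensorProduct.induction_on with
    | zero => simp
    | tmul a x => simp [xi_tmul, smul_smul, mul_comm]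
    | add y z hy hz => rw [map_add, map_add, hy (by rw [filt_zero]; trivial), hz (by rw [filt_zero]; trivial), add_zero]

lemma ppAug_univOp (m : ℕ) (x : M) : ppAug k A M m (univOp A m x) = x := by
  show LinearMap.liftBaseChange A (LinearMap.id (R := k) (M := M)) ((1 : A) ⊗ₜ[k] x) = x
  simp

end PrincipalParts

section ChangeOfAlgebra

variable {k A B : Type*} [CommRing k] [CommRing A] [Algebra k A] [CommRing B] [Algebra k B]
variable {M N : Type*} [AddCommGroup M] [Module k M] [AddCommGroup N] [Module k N]

/-- The map `a ⊗ x ↦ φ a ⊗ ρ x`. -/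
def ppResAux (φ : A →ₐ[k] B) (ρ : M →ₗ[k] N) : A ⊗[k] M →ₗ[k] B ⊗[k] N :=
  TensorProduct.map φ.toLinearMap ρ

lemma ppResAux_smul (φ : A →ₐ[k] B) (ρ : M →ₗ[k] N) (a : A) (y : A ⊗[k] M) :
    ppResAux φ ρ (a • y) = φ a • ppResAux φ ρ y := by
  induction y using TensorProduct.induction_on with
  | zero => simp
  | tmul b x => simp [ppResAux, smul_tmul']
  | add y z hy hz => rw [smul_add, map_add, hy, hz, map_add, smul_add]

variable [Module A M] [IsScalarTower k A M] [Module B N] [IsScalarTower k B N]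

lemma ppResAux_mem (φ : A →ₐ[k] B) (ρ : M →ₗ[k] N) (hρ : ∀ (a : A) x, ρ (a • x) = φ a • ρ x)
    {n : ℕ} {y : A ⊗[k] M} (hy : y ∈ filt k A M n) : ppResAux φ ρ y ∈ filt k B N n := by
  induction hy using Submodule.span_induction with
  | mem y hy =>
    obtain ⟨x, s, hs, rfl⟩ := hy
    refine Submodule.subset_span ⟨ρ x, Algebra.TensorProduct.map φ φ s, ?_, ?_⟩
    · rw [← Ideal.mem_comap]
      refine (Ideal.le_comap_pow _ n) (Ideal.pow_right_mono ?_ n hs)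
      intro s hs
      have h : ∀ s : A ⊗[k] A, Algebra.TensorProduct.lmul' k (S := B)
          (Algebra.TensorProduct.map φ φ s) =
          φ (Algebra.TensorProduct.lmul' k (S := A) s) := fun s => by
        induction s using TensorProduct.induction_on with
        | zero => simp
        | tmul a b => simp
        | add s t hs ht => simp only [map_add, hs, ht]
      rw [Ideal.mem_comap, RingHom.mem_ker]
      have hs' : Algebra.TensorProduct.lmul' k (S := A) s = 0 := hs
      exact (h s).trans (by rw [hs', map_zero])
    · clear hs
      induction s using TensorProduct.induction_on with
      | zero => simp
      | tmul a b => simp [ppResAux, hρ]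
      | add s t hs ht => simp only [map_add, hs, ht]
  | zero => simp
  | add y z _ _ hy hz => rw [map_add]; exact add_mem hy hz
  | smul a y _ hy => rw [ppResAux_smul]; exact Submodule.smul_mem _ _ hy

/-- Functoriality of principal parts along a change of algebra. -/
def ppRes (m : ℕ) (φ : A →ₐ[k] B) (ρ : M →ₗ[k] N) (hρ : ∀ (a : A) x, ρ (a • x) = φ a • ρ x) :
    PrincipalParts k A M m →ₗ[k] PrincipalParts k B N m :=
  Submodule.mapQ ((filt k A M (m + 1)).restrictScalars k) ((filt k B N (m + 1)).restrictScalars k)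
    (ppResAux φ ρ) fun _ hy => ppResAux_mem φ ρ hρ hy

lemma ppRes_smul (m : ℕ) (φ : A →ₐ[k] B) (ρ : M →ₗ[k] N)
    (hρ : ∀ (a : A) x, ρ (a • x) = φ a • ρ x) (a : A) (y : PrincipalParts k A M m) :
    ppRes m φ ρ hρ (a • y) = φ a • ppRes m φ ρ hρ y := by
  obtain ⟨y, rfl⟩ := Submodule.Quotient.mk_surjective _ y
  exact congrArg (Submodule.Quotient.mk (p := filt k B N (m + 1))) (ppResAux_smul φ ρ a y)

lemma ppRes_univOp (m : ℕ) (φ : A →ₐ[k] B) (ρ : M →ₗ[k] N)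
    (hρ : ∀ (a : A) x, ρ (a • x) = φ a • ρ x) (x : M) :
    ppRes m φ ρ hρ (univOp A m x) = univOp B m (ρ x) := by
  refine congrArg (Submodule.Quotient.mk (p := filt k B N (m + 1))) ?_
  show φ 1 ⊗ₜ ρ x = _
  rw [map_one]; rfl

/-- Principal parts are generated by the elements `1 ⊗ x`. -/
lemma principalParts_induction {m : ℕ} {P : PrincipalParts k A M m → Prop}
    (h : ∀ (a : A) (x : M), P (a • univOp A m x)) (hadd : ∀ y z, P y → P z → P (y + z))
    (y : PrincipalParts k A M m) : P y := by
  obtain ⟨y, rfl⟩ := Submodule.Quotient.mk_surjective _ y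
  induction y using TensorProduct.induction_on with
  | zero => simpa using h 0 0
  | tmul a x =>
    have : (Submodule.Quotient.mk (a ⊗ₜ x) : PrincipalParts k A M m) = a • univOp A m x := by
      rw [show a ⊗ₜ[k] x = a • ((1 : A) ⊗ₜ[k] x) by simp [smul_tmul']]; rfl
    rw [this]; exact h a x
  | add y z hy hz => exact hadd _ _ hy hz

lemma ppMap_univOp {N : Type*} [AddCommGroup N] [Module k N] [Module A N] [IsScalarTower k A N]
    {m n : ℕ} (D : M →ₗ[k] N)
    (h : filt k A M (m + 1) ≤ (filt k A N (n + 1)).comap (D.baseChange A)) (x : M) :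
    ppMap D h (univOp A m x) = univOp A n (D x) := rfl

end ChangeOfAlgebra

end
end CrysPoincare


namespace CrysPoincare

noncomputable section
/-! ### Pro-objects -/

section ProObjects

open Opposite Limits

universe v u u'

/-- A pro-object of `C`: a projective system indexed by a small cofiltered category. -/
structure ProObj (C : Type u) [Category.{v} C] where
  I : Type v
  [cat : SmallCategory I]
  [cofiltered : IsCofiltered I]
  F : I ⥤ C

attribute [instance] ProObj.cat ProObj.cofiltered

namespace ProObj

variable {C : Type u} [Category.{v} C] [Preadditive C]
variable {D : Type u'} [Category.{v} D] [Preadditive D]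

/-- The group `colim_i Hom(P_i, c)`. -/
def Germ (P : ProObj C) (c : C) : AddCommGrpCat.{v} :=
  colimit (P.F.op ⋙ preadditiveYoneda.obj c)

/-- The class of a morphism `P_i ⟶ c` in `colim_i Hom(P_i, c)`. -/
def germ (P : ProObj C) {c : C} (i : P.I) : (P.F.obj i ⟶ c) →+ P.Germ c :=
  (colimit.ι (P.F.op ⋙ preadditiveYoneda.obj c) (op i)).hom

lemma germ_map (P : ProObj C) {c : C} {i j : P.I} (u : i ⟶ j) (f : P.F.obj j ⟶ c) :
    P.germ i (P.F.map u ≫ f) = P.germ j f :=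
  ConcreteCategory.congr_hom (colimit.w (P.F.op ⋙ preadditiveYoneda.obj c) u.op) f

lemma germ_eq (P : ProObj C) {c : C} {h i j : P.I} (u : h ⟶ i) (u' : h ⟶ j)
    {f : P.F.obj i ⟶ c} {g : P.F.obj j ⟶ c} (e : P.F.map u ≫ f = P.F.map u' ≫ g) :
    P.germ i f = P.germ j g := by
  rw [← P.germ_map u, e, P.germ_map]

lemma germ_rep (P : ProObj C) {c : C} (x : P.Germ c) : ∃ i f, P.germ i f = x := by
  obtain ⟨i, f, h⟩ := Concrete.colimit_exists_rep (P.F.op ⋙ preadditiveYoneda.obj c) x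
  exact ⟨i.unop, f, h⟩

/-- Maps out of `colim_i Hom(P_i, c)`. -/
def Germ.desc {P : ProObj C} {c : C} {G : Type v} [AddCommGroup G]
    (φ : ∀ i, (P.F.obj i ⟶ c) →+ G)
    (hφ : ∀ (i j : P.I) (u : i ⟶ j) (f : P.F.obj j ⟶ c), φ i (P.F.map u ≫ f) = φ j f) :
    P.Germ c →+ G :=
  (colimit.desc (P.F.op ⋙ preadditiveYoneda.obj c)
    { pt := AddCommGrpCat.of G
      ι := { app := fun i => AddCommGrpCat.ofHom (φ i.unop)
             naturality := fun i j u => by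
               ext f
               exact hφ _ _ u.unop f } }).hom

lemma Germ.desc_germ {P : ProObj C} {c : C} {G : Type v} [AddCommGroup G]
    (φ : ∀ i, (P.F.obj i ⟶ c) →+ G)
    (hφ : ∀ (i j : P.I) (u : i ⟶ j) (f : P.F.obj j ⟶ c), φ i (P.F.map u ≫ f) = φ j f)
    (i : P.I) (f : P.F.obj i ⟶ c) : Germ.desc φ hφ (P.germ i f) = φ i f :=
  ConcreteCategory.congr_hom (colimit.ι_desc (F := P.F.op ⋙ preadditiveYoneda.obj c) _ (op i)) f

/-- Composition with `g : c ⟶ c'` on `colim_i Hom(P_i, c)`. -/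
def push (P : ProObj C) {c c' : C} (g : c ⟶ c') : P.Germ c →+ P.Germ c' :=
  Germ.desc (fun i => (P.germ i).comp (Preadditive.rightComp _ g)) fun i j u f => by
    show P.germ i ((P.F.map u ≫ f) ≫ g) = P.germ j (f ≫ g)
    rw [Category.assoc, P.germ_map]

@[simp] lemma push_germ (P : ProObj C) {c c' : C} (g : c ⟶ c') (i : P.I) (f : P.F.obj i ⟶ c) :
    P.push g (P.germ i f) = P.germ i (f ≫ g) := Germ.desc_germ _ _ i f

/-- Morphisms of pro-objects: `lim_j colim_i Hom(P_i, Q_j)`. -/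
def homSubgroup (P Q : ProObj C) : AddSubgroup (∀ j, P.Germ (Q.F.obj j)) where
  carrier := {f | ∀ (j j' : Q.I) (u : j ⟶ j'), P.push (Q.F.map u) (f j) = f j'}
  add_mem' hf hg _ _ u := by simp [hf _ _ u, hg _ _ u]
  zero_mem' _ _ _ := by simp
  neg_mem' hf _ _ u := by simp [hf _ _ u]

/-- Morphisms of pro-objects: `lim_j colim_i Hom(P_i, Q_j)`. -/
@[ext] structure Hom (P Q : ProObj C) where
  toFun : homSubgroup P Q

/-- Composition with `f : P ⟶ Q` from `colim_j Hom(Q_j, c)` to `colim_i Hom(P_i, c)`. -/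
def pull {P Q : ProObj C} (f : homSubgroup P Q) (c : C) : Q.Germ c →+ P.Germ c :=
  Germ.desc (fun j => AddMonoidHom.mk' (fun g => P.push g (f.1 j)) fun g h => by
      obtain ⟨i, x, hx⟩ := P.germ_rep (f.1 j)
      simp [← hx]) fun j j' u g => by
    simp only [AddMonoidHom.mk'_apply, ← f.2 _ _ u]
    obtain ⟨i, x, hx⟩ := P.germ_rep (f.1 j)
    simp [← hx]

@[simp] lemma pull_germ {P Q : ProObj C} (f : homSubgroup P Q) {c : C} (j : Q.I)
    (g : Q.F.obj j ⟶ c) : pull f c (Q.germ j g) = P.push g (f.1 j) := Germ.desc_germ _ _ j g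

lemma push_pull {P Q : ProObj C} (f : homSubgroup P Q) {c c' : C} (g : c ⟶ c') (x : Q.Germ c) :
    P.push g (pull f c x) = pull f c' (Q.push g x) := by
  obtain ⟨j, x, rfl⟩ := Q.germ_rep x
  obtain ⟨i, y, hy⟩ := P.germ_rep (f.1 j)
  simp [← hy]

instance : Category (ProObj C) where
  Hom P Q := Hom P Q
  id P := ⟨⟨fun i => P.germ i (𝟙 _), fun _ _ u => by
    show P.push _ (P.germ _ (𝟙 _)) = P.germ _ (𝟙 _)
    rw [push_germ, Category.id_comp, ← P.germ_map u (𝟙 _), Category.comp_id]⟩⟩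
  comp {P Q R} f g := ⟨⟨fun k => pull f.toFun _ (g.toFun.1 k), fun _ _ u => by
    rw [push_pull, g.toFun.2 _ _ u]⟩⟩
  id_comp {P Q} f := by
    ext j
    show pull _ _ (f.toFun.1 j) = f.toFun.1 j
    obtain ⟨i, y, hy⟩ := P.germ_rep (f.toFun.1 j)
    simp [← hy]
  comp_id {P Q} f := by
    ext j
    show pull _ _ (Q.germ j _) = f.toFun.1 j
    obtain ⟨i, y, hy⟩ := P.germ_rep (f.toFun.1 j)
    simp [← hy]
  assoc {P Q R S} f g h := by
    ext l
    show pull _ _ (h.toFun.1 l) = pull _ _ (pull _ _ (h.toFun.1 l))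
    obtain ⟨k, z, hz⟩ := R.germ_rep (h.toFun.1 l)
    rw [← hz, pull_germ, pull_germ, ← push_pull]

/-- The component in `colim_i Hom(P_i, Q_j)` of a morphism of pro-objects. -/
def Hom.at {P Q : ProObj C} (f : P ⟶ Q) (j : Q.I) : P.Germ (Q.F.obj j) := Hom.toFun f |>.1 j

@[ext] lemma hom_ext {P Q : ProObj C} {f g : P ⟶ Q} (h : ∀ j, Hom.at f j = Hom.at g j) : f = g :=
  Hom.ext (Subtype.ext (funext h))

lemma id_at (P : ProObj C) (i : P.I) : Hom.at (𝟙 P) i = P.germ i (𝟙 _) := rfl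
lemma comp_at {P Q R : ProObj C} (f : P ⟶ Q) (g : Q ⟶ R) (k : R.I) :
    Hom.at (f ≫ g) k = pull (Hom.toFun f) _ (Hom.at g k) := rfl
lemma push_at {P Q : ProObj C} (f : P ⟶ Q) {j j' : Q.I} (u : j ⟶ j') :
    P.push (Q.F.map u) (Hom.at f j) = Hom.at f j' :=
  (Hom.toFun f).2 _ _ u

lemma comp_at_of_germ {P Q R : ProObj C} (f : P ⟶ Q) {g : Q ⟶ R} {k : R.I} {j : Q.I}
    {y : Q.F.obj j ⟶ R.F.obj k} (h : Hom.at g k = Q.germ j y) :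
    Hom.at (f ≫ g) k = P.push y (Hom.at f j) := by
  rw [comp_at, h, pull_germ]; rfl

lemma comp_at_germ {P Q R : ProObj C} {f : P ⟶ Q} {g : Q ⟶ R} {k : R.I} {j : Q.I}
    {y : Q.F.obj j ⟶ R.F.obj k} (hg : Hom.at g k = Q.germ j y) {i : P.I}
    {z : P.F.obj i ⟶ Q.F.obj j} (hf : Hom.at f j = P.germ i z) :
    Hom.at (f ≫ g) k = P.germ i (z ≫ y) := by
  rw [comp_at_of_germ f hg, hf, push_germ]

/-- Morphisms of pro-objects form a group. -/
def homEquiv (P Q : ProObj C) : (P ⟶ Q) ≃ homSubgroup P Q := ⟨Hom.toFun, Hom.mk, fun _ => rfl, fun _ => rfl⟩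

instance (P Q : ProObj C) : AddCommGroup (P ⟶ Q) := (homEquiv P Q).addCommGroup

lemma add_at {P Q : ProObj C} (f g : P ⟶ Q) (j : Q.I) :
    Hom.at (f + g) j = Hom.at f j + Hom.at g j := rfl
lemma zero_at {P Q : ProObj C} (j : Q.I) : Hom.at (0 : P ⟶ Q) j = 0 := rfl

instance : Preadditive (ProObj C) where
  add_comp P Q R f g h := by
    ext k
    obtain ⟨j, z, hz⟩ := Q.germ_rep (Hom.at h k)
    simp only [add_at, comp_at_of_germ _ hz.symm, map_add]
  comp_add P Q R f g h := by
    ext k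
    simp only [add_at, comp_at, map_add]

/-- A morphism of pro-objects given by a map of index categories and a natural family of
morphisms. -/
def ofLevel {P Q : ProObj C} (Φ : Q.I ⥤ P.I) (τ : Φ ⋙ P.F ⟶ Q.F) : P ⟶ Q :=
  Hom.mk ⟨fun j => P.germ (Φ.obj j) (τ.app j), fun j j' u => by
    rw [push_germ, ← τ.naturality]
    exact P.germ_map (Φ.map u) _⟩

lemma ofLevel_at {P Q : ProObj C} (Φ : Q.I ⥤ P.I) (τ : Φ ⋙ P.F ⟶ Q.F) (j : Q.I) :
    Hom.at (ofLevel Φ τ) j = P.germ (Φ.obj j) (τ.app j) := rfl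

lemma comp_ofLevel_at {P Q R : ProObj C} (f : P ⟶ Q) (Φ : R.I ⥤ Q.I) (τ : Φ ⋙ Q.F ⟶ R.F) (k : R.I) :
    Hom.at (f ≫ ofLevel Φ τ) k = P.push (τ.app k) (Hom.at f (Φ.obj k)) :=
  comp_at_of_germ f (ofLevel_at Φ τ k)

/-- Transport of `colim_i Hom(P_i, c)` along a functor `G`. -/
def germTrans {P : ProObj C} {P' : ProObj D} (Φ : P.I ⥤ P'.I) (G : C ⥤ D) [G.Additive]
    (τ : Φ ⋙ P'.F ⟶ P.F ⋙ G) (c : C) : P.Germ c →+ P'.Germ (G.obj c) :=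
  Germ.desc (fun i => (P'.germ (Φ.obj i)).comp
      ((Preadditive.leftComp _ (τ.app i)).comp G.mapAddHom)) fun i j u f => by
    have h : P'.F.map (Φ.map u) ≫ τ.app j = τ.app i ≫ G.map (P.F.map u) := τ.naturality u
    show P'.germ _ (τ.app i ≫ G.map (P.F.map u ≫ f)) = P'.germ _ (τ.app j ≫ G.map f)
    rw [← P'.germ_map (Φ.map u), reassoc_of% h, G.map_comp]

lemma germTrans_germ {P : ProObj C} {P' : ProObj D} (Φ : P.I ⥤ P'.I) (G : C ⥤ D) [G.Additive]
    (τ : Φ ⋙ P'.F ⟶ P.F ⋙ G) {c : C} (i : P.I) (f : P.F.obj i ⟶ c) :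
    germTrans Φ G τ c (P.germ i f) = P'.germ (Φ.obj i) (τ.app i ≫ G.map f) :=
  Germ.desc_germ _ _ i f

lemma germTrans_push {P : ProObj C} {P' : ProObj D} (Φ : P.I ⥤ P'.I) (G : C ⥤ D) [G.Additive]
    (τ : Φ ⋙ P'.F ⟶ P.F ⋙ G) {c c' : C} (g : c ⟶ c') (x : P.Germ c) :
    germTrans Φ G τ c' (P.push g x) = P'.push (G.map g) (germTrans Φ G τ c x) := by
  obtain ⟨i, y, rfl⟩ := P.germ_rep x
  simp [germTrans_germ]

/-- The extension of an additive functor to pro-objects. -/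
def mapFunctor (G : C ⥤ D) [G.Additive] : ProObj C ⥤ ProObj D where
  obj P := ⟨P.I, P.F ⋙ G⟩
  map {P Q} f := Hom.mk ⟨fun j => germTrans (P := P) (P' := ⟨P.I, P.F ⋙ G⟩) (𝟭 _) G (𝟙 _) _ (Hom.at f j),
    fun _ _ u => (germTrans_push (P := P) (P' := ⟨P.I, P.F ⋙ G⟩) _ G _ _ _).symm.trans
      (congrArg _ (push_at f u))⟩
  map_id P := by
    ext i
    show germTrans _ _ _ _ _ = _
    rw [id_at, germTrans_germ, id_at]
    simp
  map_comp {P Q R} f g := by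
    ext k
    show germTrans _ _ _ _ _ = pull _ _ (germTrans _ _ _ _ _)
    obtain ⟨j, z, hz⟩ := Q.germ_rep (Hom.at g k)
    rw [← hz, comp_at_of_germ _ hz.symm, germTrans_push, germTrans_germ, pull_germ]
    simp

instance (G : C ⥤ D) [G.Additive] : (mapFunctor G).Additive where
  map_add {P Q f g} := by
    ext j
    exact map_add (germTrans (P := P) (P' := ⟨P.I, P.F ⋙ G⟩) (𝟭 _) G (𝟙 _) _) _ _

/-- The constant pro-object. -/
@[simps]
def const (c : C) : ProObj C := ⟨PUnit.{v + 1}, (Functor.const _).obj c⟩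

end ProObj

end ProObjects
end
end CrysPoincare

namespace CrysPoincare


noncomputable section

section Sheaves

open AlgebraicGeometry Opposite

variable {X : Scheme.{0}} [X.Over (Spec (CommRingCat.of ℂ))]

/-- The structure map `ℂ → 𝒪(U)` of a scheme over `ℂ`. -/
def structureHom (U : X.Opens) : ℂ →+* Γ(X, U) :=
  ((X ↘ Spec (CommRingCat.of ℂ)).appLE ⊤ U le_top).hom.comp
    (Scheme.ΓSpecIso (CommRingCat.of ℂ)).inv.hom

instance (U : X.Opens) : Algebra ℂ Γ(X, U) := (structureHom U).toAlgebra

instance (M : X.Modules) (U : X.Opens) : Module ℂ Γ(M, U) :=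
  Module.compHom _ (structureHom U)

instance (M : X.Modules) (U : X.Opens) : IsScalarTower ℂ Γ(X, U) Γ(M, U) where
  smul_assoc c a x := mul_smul (structureHom U c) a x

/-- Restriction of functions. -/
def resFun {U V : X.Opens} (i : V ⟶ U) : Γ(X, U) →ₐ[ℂ] Γ(X, V) where
  toRingHom := (X.presheaf.map i.op).hom
  commutes' c := by
    show (X.presheaf.map i.op).hom (structureHom U c) = structureHom V c
    have := Scheme.Hom.appLE_map (X ↘ Spec (CommRingCat.of ℂ)) (U := ⊤) (V := U) le_top i.op
    exact ConcreteCategory.congr_hom this _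

/-- Restriction of sections of a sheaf of modules. -/
def resMod (M : X.Modules) {U V : X.Opens} (i : V ⟶ U) : Γ(M, U) →ₗ[ℂ] Γ(M, V) where
  toFun := M.presheaf.map i.op
  map_add' := map_add _
  map_smul' c x := by
    show M.presheaf.map i.op (structureHom U c • x) = structureHom V c • M.presheaf.map i.op x
    rw [Scheme.Modules.map_smul]
    exact congrArg (· • _) ((resFun i).commutes c)

lemma resMod_smul (M : X.Modules) {U V : X.Opens} (i : V ⟶ U) (a : Γ(X, U)) (x : Γ(M, U)) :
    resMod M i (a • x) = resFun i a • resMod M i x :=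
  Scheme.Modules.map_smul M i a x

/-- A `ℂ`-linear morphism of sheaves between two `𝒪_X`-modules. -/
@[ext] structure LinMap (M N : X.Modules) where
  app : ∀ U : X.Opens, Γ(M, U) →ₗ[ℂ] Γ(N, U)
  naturality : ∀ {U V : X.Opens} (i : V ⟶ U) (x : Γ(M, U)),
    app V (resMod M i x) = resMod N i (app U x)

namespace LinMap

variable {M N L : X.Modules}

/-- Composition. -/
def comp (D : LinMap M N) (E : LinMap N L) : LinMap M L where
  app U := E.app U ∘ₗ D.app U
  naturality i x := by simp [D.naturality, E.naturality]

/-- An `𝒪_X`-linear morphism is `ℂ`-linear. -/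
def ofHom (f : M ⟶ N) : LinMap M N where
  app U :=
    { toFun := f.app U
      map_add' := map_add _
      map_smul' := fun c x => Scheme.Modules.Hom.app_smul f (structureHom U c) x }
  naturality i x := ConcreteCategory.congr_hom (f.mapPresheaf.naturality i.op) x

@[simp] lemma ofHom_app (f : M ⟶ N) (U : X.Opens) (x : Γ(M, U)) :
    (ofHom f).app U x = f.app U x := rfl
@[simp] lemma comp_app (D : LinMap M N) (E : LinMap N L) (U : X.Opens) (x : Γ(M, U)) :
    (D.comp E).app U x = E.app U (D.app U x) := rfl

/-- Differential operators of order at most `n`. -/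
def IsDiffOp (n : ℕ) (D : LinMap M N) : Prop :=
  ∀ U : X.Opens, CrysPoincare.IsDiffOp Γ(X, U) n (D.app U)

/-- `D` induces a map on principal parts `P^m ⊗ M → P^n ⊗ N`. -/
def Compat (m n : ℕ) (D : LinMap M N) : Prop :=
  ∀ U : X.Opens, filt ℂ Γ(X, U) Γ(M, U) (m + 1) ≤
    (filt ℂ Γ(X, U) Γ(N, U) (n + 1)).comap ((D.app U).baseChange Γ(X, U))

lemma IsDiffOp.compat {n : ℕ} {D : LinMap M N} (hD : D.IsDiffOp n) (m : ℕ) :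
    D.Compat (m + n) m := fun U => by
  have := (hD U).filt_le (m + 1)
  rwa [show m + 1 + n = m + n + 1 by ring] at this

lemma compat_ofHom (f : M ⟶ N) {m n : ℕ} (h : n ≤ m) : (ofHom f).Compat m n := fun U =>
  (filt_anti ℂ Γ(X, U) (by omega)).trans
    ((CrysPoincare.IsDiffOp.of_linear (D := (ofHom f).app U)
      (fun a x => Scheme.Modules.Hom.app_smul f a x)).filt_le (n + 1))

end LinMap

/-- Restriction of principal parts. -/
def jetRes (m : ℕ) (M : X.Modules) {U V : X.Opens} (i : V ⟶ U) :
    PrincipalParts ℂ Γ(X, U) Γ(M, U) m →ₗ[ℂ] PrincipalParts ℂ Γ(X, V) Γ(M, V) m :=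
  ppRes m (resFun i) (resMod M i) (resMod_smul M i)

lemma jetRes_smul_univOp (m : ℕ) (M : X.Modules) {U V : X.Opens} (i : V ⟶ U) (a : Γ(X, U))
    (x : Γ(M, U)) : jetRes m M i (a • univOp Γ(X, U) m x) =
      resFun i a • univOp Γ(X, V) m (resMod M i x) := by
  rw [jetRes, ppRes_smul, ppRes_univOp]

lemma resMod_id (M : X.Modules) (U : X.Opens) (x : Γ(M, U)) : resMod M (𝟙 U) x = x :=
  ConcreteCategory.congr_hom (M.presheaf.map_id (op U)) x

lemma resMod_comp (M : X.Modules) {U V W : X.Opens} (i : V ⟶ U) (j : W ⟶ V) (x : Γ(M, U)) :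
    resMod M (j ≫ i) x = resMod M j (resMod M i x) :=
  ConcreteCategory.congr_hom (M.presheaf.map_comp i.op j.op) x

lemma resFun_id (U : X.Opens) (x : Γ(X, U)) : resFun (𝟙 U) x = x :=
  ConcreteCategory.congr_hom (X.presheaf.map_id (op U)) x

lemma resFun_comp {U V W : X.Opens} (i : V ⟶ U) (j : W ⟶ V) (x : Γ(X, U)) :
    resFun (j ≫ i) x = resFun j (resFun i x) :=
  ConcreteCategory.congr_hom (X.presheaf.map_comp i.op j.op) x

lemma jetRes_id (m : ℕ) (M : X.Modules) (U : X.Opens) (y) : jetRes m M (𝟙 U) y = y := by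
  induction y using principalParts_induction with
  | h a x => rw [jetRes_smul_univOp, resFun_id, resMod_id]
  | hadd y z hy hz => rw [map_add, hy, hz]

lemma jetRes_comp (m : ℕ) (M : X.Modules) {U V W : X.Opens} (i : V ⟶ U) (j : W ⟶ V) (y) :
    jetRes m M (j ≫ i) y = jetRes m M j (jetRes m M i y) := by
  induction y using principalParts_induction with
  | h a x => rw [jetRes_smul_univOp, jetRes_smul_univOp, jetRes_smul_univOp, resFun_comp, resMod_comp]
  | hadd y z hy hz => rw [map_add, map_add, map_add, hy, hz]

/-- The presheaf of abelian groups `U ↦ P^m_{𝒪(U)} ⊗ M(U)`. -/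
def jetPresheafAb (m : ℕ) (M : X.Modules) : TopCat.Presheaf Ab X where
  obj U := AddCommGrpCat.of (PrincipalParts ℂ Γ(X, U.unop) Γ(M, U.unop) m)
  map i := AddCommGrpCat.ofHom (jetRes m M i.unop).toAddMonoidHom
  map_id U := by
    ext y
    exact jetRes_id m M U.unop y
  map_comp i j := by
    ext y
    exact jetRes_comp m M i.unop j.unop y

instance (m : ℕ) (M : X.Modules) (U : (TopologicalSpace.Opens X)ᵒᵖ) :
    Module (X.ringCatSheaf.obj.obj U) ((jetPresheafAb m M).obj U) :=
  inferInstanceAs (Module Γ(X, U.unop) (PrincipalParts ℂ Γ(X, U.unop) Γ(M, U.unop) m))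

/-- The presheaf `U ↦ P^m_{𝒪(U)} ⊗ M(U)`, with its left module structure. -/
def jetPresheaf (m : ℕ) (M : X.Modules) : X.PresheafOfModules :=
  PresheafOfModules.ofPresheaf (jetPresheafAb m M) fun {_ _} i a y =>
    ppRes_smul m (resFun i.unop) (resMod M i.unop) (resMod_smul M i.unop) a y

/-- The `𝒪_X`-module `P^m_X ⊗ M` (the tensor product is formed with the right structure of
`P^m_X`, and the `𝒪_X`-module structure is the left one): the sheaf associated with
`U ↦ P^m_{𝒪(U)} ⊗ M(U)`. -/
def jet (m : ℕ) (M : X.Modules) : X.Modules :=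
  (PresheafOfModules.sheafification (𝟙 X.ringCatSheaf.obj)).obj (jetPresheaf m M)

/-- The canonical map from `P^m_{𝒪(U)} ⊗ M(U)` to sections of `P^m_X ⊗ M`. -/
def toJet (m : ℕ) (M : X.Modules) (U : X.Opens) :
    PrincipalParts ℂ Γ(X, U) Γ(M, U) m →ₗ[Γ(X, U)] Γ(jet m M, U) :=
  (((PresheafOfModules.sheafificationAdjunction (𝟙 X.ringCatSheaf.obj)).unit.app
    (jetPresheaf m M)).app (op U)).hom

lemma toJet_res (m : ℕ) (M : X.Modules) {U V : X.Opens} (i : V ⟶ U)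
    (y : PrincipalParts ℂ Γ(X, U) Γ(M, U) m) :
    toJet m M V (jetRes m M i y) = resMod (jet m M) i (toJet m M U y) :=
  PresheafOfModules.naturality_apply ((PresheafOfModules.sheafificationAdjunction
    (𝟙 X.ringCatSheaf.obj)).unit.app (jetPresheaf m M)) i.op y

/-- The universal differential operator `M → P^m_X ⊗ M` of order at most `m`, `x ↦ 1 ⊗ x`. -/
def jetUniv (m : ℕ) (M : X.Modules) : LinMap M (jet m M) where
  app U := (toJet m M U).restrictScalars ℂ ∘ₗ univOp Γ(X, U) m
  naturality i x := by
    refine Eq.trans ?_ (toJet_res m M i _)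
    show toJet m M _ _ = _
    rw [jetRes, ppRes_univOp]

lemma jetUniv_isDiffOp (m : ℕ) (M : X.Modules) : (jetUniv m M).IsDiffOp m := fun U =>
  (univOp_isDiffOp m).comp_linear (E := (toJet m M U).restrictScalars ℂ)
    (fun a x => (toJet m M U).map_smul a x)

lemma jet_hom_ext {m : ℕ} {M N : X.Modules} {f g : jet m M ⟶ N}
    (h : (jetUniv m M).comp (.ofHom f) = (jetUniv m M).comp (.ofHom g)) : f = g := by
  apply ((PresheafOfModules.sheafificationAdjunction (𝟙 X.ringCatSheaf.obj)).homEquiv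
    (jetPresheaf m M) N).injective
  refine PresheafOfModules.hom_ext fun U => ModuleCat.hom_ext (LinearMap.ext fun y => ?_)
  show f.app U.unop (toJet m M U.unop y) = g.app U.unop (toJet m M U.unop y)
  change PrincipalParts ℂ Γ(X, U.unop) Γ(M, U.unop) m at y
  induction y using principalParts_induction with
  | h a x =>
    rw [map_smul, Scheme.Modules.Hom.app_smul, Scheme.Modules.Hom.app_smul]
    exact congrArg (a • ·) (LinearMap.congr_fun (congrFun (congrArg LinMap.app h) U.unop) x)
  | hadd y z hy hz => rw [map_add, map_add, map_add, hy, hz]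

/-- The map `P^m ⊗ M → P^n ⊗ N` on presheaves induced by a `ℂ`-linear `D : M → N`. -/
def jetPresheafMap {m n : ℕ} {M N : X.Modules} (D : LinMap M N) (h : D.Compat m n) :
    jetPresheaf m M ⟶ jetPresheaf n N where
  app U := ModuleCat.ofHom (R := Γ(X, U.unop))
    (X := PrincipalParts ℂ Γ(X, U.unop) Γ(M, U.unop) m)
    (Y := PrincipalParts ℂ Γ(X, U.unop) Γ(N, U.unop) n) (ppMap (D.app U.unop) (h U.unop))
  naturality {U V} i := by
    refine ModuleCat.hom_ext (LinearMap.ext fun y => ?_)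
    change PrincipalParts ℂ Γ(X, U.unop) Γ(M, U.unop) m at y
    show ppMap (D.app V.unop) (h V.unop) (jetRes m M i.unop y) =
      jetRes n N i.unop (ppMap (D.app U.unop) (h U.unop) y)
    induction y using principalParts_induction with
    | h a x =>
      rw [jetRes_smul_univOp, map_smul, map_smul, ppMap_univOp, ppMap_univOp, jetRes_smul_univOp,
        D.naturality]
    | hadd y z hy hz => simp only [map_add, hy, hz]

/-- The `𝒪_X`-linear map `P^m_X ⊗ M → P^n_X ⊗ N`, `(f ⊗ g) ⊗ x ↦ (f ⊗ 1) ⊗ D (g x)`, induced by a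
`ℂ`-linear `D : M → N` which is compatible with the filtrations, for instance by a differential
operator of order at most `m - n`. -/
def jetMap {m n : ℕ} {M N : X.Modules} (D : LinMap M N) (h : D.Compat m n) :
    jet m M ⟶ jet n N :=
  (PresheafOfModules.sheafification (𝟙 X.ringCatSheaf.obj)).map (jetPresheafMap D h)

lemma jetMap_toJet {m n : ℕ} {M N : X.Modules} (D : LinMap M N) (h : D.Compat m n)
    (U : X.Opens) (y : PrincipalParts ℂ Γ(X, U) Γ(M, U) m) :
    (jetMap D h).app U (toJet m M U y) = toJet n N U (ppMap (D.app U) (h U) y) := by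
  have := (PresheafOfModules.sheafificationAdjunction
    (𝟙 X.ringCatSheaf.obj)).unit.naturality (jetPresheafMap D h)
  exact (ConcreteCategory.congr_hom (congrArg (fun f => PresheafOfModules.Hom.app f (op U)) this) y).symm

lemma jetUniv_jetMap {m n : ℕ} {M N : X.Modules} (D : LinMap M N) (h : D.Compat m n) :
    (jetUniv m M).comp (.ofHom (jetMap D h)) = D.comp (jetUniv n N) := by
  ext U x
  exact jetMap_toJet D h U _

/-- The morphism `P^m ⊗ M → M` on presheaves. -/
def jetPresheafAug (m : ℕ) (M : X.Modules) : jetPresheaf m M ⟶ M.val where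
  app U := ModuleCat.ofHom (R := Γ(X, U.unop))
    (X := PrincipalParts ℂ Γ(X, U.unop) Γ(M, U.unop) m) (Y := Γ(M, U.unop))
    (ppAug ℂ Γ(X, U.unop) Γ(M, U.unop) m)
  naturality {U V} i := by
    refine ModuleCat.hom_ext (LinearMap.ext fun y => ?_)
    change PrincipalParts ℂ Γ(X, U.unop) Γ(M, U.unop) m at y
    show ppAug ℂ Γ(X, V.unop) Γ(M, V.unop) m (jetRes m M i.unop y) =
      resMod M i.unop (ppAug ℂ Γ(X, U.unop) Γ(M, U.unop) m y)
    induction y using principalParts_induction with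
    | h a x => rw [jetRes_smul_univOp, map_smul, map_smul, ppAug_univOp, ppAug_univOp, resMod_smul]
    | hadd y z hy hz => simp only [map_add, hy, hz]

/-- The morphism `P^m_X ⊗ M → M`, `(f ⊗ g) ⊗ x ↦ fgx`, induced by the diagonal `P^m_X → 𝒪_X`. -/
def jetAug (m : ℕ) (M : X.Modules) : jet m M ⟶ M :=
  ((PresheafOfModules.sheafificationAdjunction (𝟙 X.ringCatSheaf.obj)).homEquiv
    (jetPresheaf m M) M).symm (jetPresheafAug m M)

end Sheaves
end
end CrysPoincare

namespace CrysPoincare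

noncomputable section

section JetCalculus

open AlgebraicGeometry Opposite

variable {X : Scheme.{0}}

/-- A morphism of `𝒪_X`-modules from its components. -/
def homMk {M N : X.Modules} (app : ∀ U : X.Opens, Γ(M, U) →ₗ[Γ(X, U)] Γ(N, U))
    (nat : ∀ (U V : X.Opens) (i : V ⟶ U) (x : Γ(M, U)),
      app V (M.presheaf.map i.op x) = N.presheaf.map i.op (app U x)) : M ⟶ N :=
  ⟨{ app U := ModuleCat.ofHom (R := Γ(X, U.unop)) (X := Γ(M, U.unop)) (Y := Γ(N, U.unop))
      (app U.unop)
     naturality {U V} i := ModuleCat.hom_ext (LinearMap.ext fun x => nat _ _ i.unop x) }⟩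

/-- The sheaf `𝒪_X` as a module over itself. -/
def structureSheaf (X : Scheme.{0}) : X.Modules := SheafOfModules.unit X.ringCatSheaf

/-- The section `1` of `𝒪_X`. -/
def oneSec (X : Scheme.{0}) : Γ(structureSheaf X, ⊤) := (1 : Γ(X, ⊤))

/-- The morphism `𝒪_X ⟶ N`, `f ↦ f s`, for a global section `s` of `N`. -/
def ofSec {N : X.Modules} (s : Γ(N, ⊤)) : structureSheaf X ⟶ N :=
  homMk (fun U => LinearMap.toSpanSingleton Γ(X, U) Γ(N, U) (N.presheaf.map (homOfLE le_top).op s))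
    fun U V i f => by
      change Γ(X, U) at f
      show X.presheaf.map i.op f • N.presheaf.map (homOfLE le_top).op s =
        N.presheaf.map i.op (f • N.presheaf.map (homOfLE le_top).op s)
      rw [Scheme.Modules.map_smul]
      congr 1
      exact ConcreteCategory.congr_hom (N.presheaf.map_comp (homOfLE le_top).op i.op) s

lemma ofSec_oneSec {N : X.Modules} (s : Γ(N, ⊤)) : (ofSec s).app ⊤ (oneSec X) = s := by
  show (1 : Γ(X, ⊤)) • N.presheaf.map (homOfLE le_top).op s = s
  rw [one_smul]
  exact ConcreteCategory.congr_hom (N.presheaf.map_id (op ⊤)) s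

lemma structureSheaf_hom_ext {N : X.Modules} {f g : structureSheaf X ⟶ N}
    (h : f.app ⊤ (oneSec X) = g.app ⊤ (oneSec X)) : f = g := by
  refine Scheme.Modules.hom_ext _ _ fun U => ?_
  ext a
  have key : ∀ f : structureSheaf X ⟶ N, f.app U a =
      (show Γ(X, U) from a) • N.presheaf.map (homOfLE (le_top : U ≤ ⊤)).op (f.app ⊤ (oneSec X)) := by
    intro f
    have h1 : f.app U ((structureSheaf X).presheaf.map (homOfLE (le_top : U ≤ ⊤)).op (oneSec X)) =
        N.presheaf.map (homOfLE (le_top : U ≤ ⊤)).op (f.app ⊤ (oneSec X)) :=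
      ConcreteCategory.congr_hom (f.mapPresheaf.naturality (homOfLE (le_top : U ≤ ⊤)).op) _
    rw [← h1, ← Scheme.Modules.Hom.app_smul]
    congr 1
    have h2 : (structureSheaf X).presheaf.map (homOfLE (le_top : U ≤ ⊤)).op (oneSec X) =
      (1 : Γ(X, U)) := map_one (X.presheaf.map (homOfLE (le_top : U ≤ ⊤)).op).hom
    rw [h2]
    exact (mul_one (show Γ(X, U) from a)).symm
  rw [key f, key g, h]

lemma ofSec_comp {M N : X.Modules} (s : Γ(M, ⊤)) (f : M ⟶ N) : ofSec s ≫ f = ofSec (f.app ⊤ s) :=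
  structureSheaf_hom_ext (by
    rw [ofSec_oneSec]
    show f.app ⊤ ((ofSec s).app ⊤ (oneSec X)) = _
    rw [ofSec_oneSec])

variable [X.Over (Spec (CommRingCat.of ℂ))] {L M N : X.Modules}

namespace LinMap

/-- The identity. -/
def id (M : X.Modules) : LinMap M M := ofHom (𝟙 M)

@[simp] lemma id_app (U : X.Opens) (x : Γ(M, U)) : (id M).app U x = x := rfl

lemma Compat.comp {l m n : ℕ} {D : LinMap L M} {E : LinMap M N} (hD : D.Compat l m)
    (hE : E.Compat m n) : (D.comp E).Compat l n := fun U y hy => by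
  have h := hE U (hD U hy)
  rw [Submodule.mem_comap] at h ⊢
  rw [LinMap.comp, LinearMap.baseChange_comp]
  exact h

lemma Compat.mono {m n n' : ℕ} {D : LinMap L M} (hD : D.Compat m n) (h : n' ≤ n) :
    D.Compat m n' := fun U => (hD U).trans (Submodule.comap_mono (filt_anti ℂ _ (by omega)))

end LinMap

@[simp] lemma jetMap_univ {m n : ℕ} (D : LinMap M N) (h : D.Compat m n) (U : X.Opens)
    (x : Γ(M, U)) :
    (jetMap D h).app U ((jetUniv m M).app U x) = (jetUniv n N).app U (D.app U x) :=
  LinearMap.congr_fun (congrFun (congrArg LinMap.app (jetUniv_jetMap D h)) U) x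

lemma jetAug_toJet (m : ℕ) (U : X.Opens) (y : PrincipalParts ℂ Γ(X, U) Γ(M, U) m) :
    (jetAug m M).app U (toJet m M U y) = ppAug ℂ Γ(X, U) Γ(M, U) m y := by
  have := ((PresheafOfModules.sheafificationAdjunction (𝟙 X.ringCatSheaf.obj)).homEquiv
    (jetPresheaf m M) M).apply_symm_apply (jetPresheafAug m M)
  exact (ConcreteCategory.congr_hom (congrArg (fun f => PresheafOfModules.Hom.app f (op U)) this) y)

@[simp] lemma jetAug_univ (m : ℕ) (U : X.Opens) (x : Γ(M, U)) :
    (jetAug m M).app U ((jetUniv m M).app U x) = x :=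
  (jetAug_toJet m U _).trans (ppAug_univOp m x)

lemma jet_ext {m : ℕ} {f g : jet m M ⟶ N}
    (h : ∀ U x, f.app U ((jetUniv m M).app U x) = g.app U ((jetUniv m M).app U x)) : f = g :=
  jet_hom_ext (by ext U x; exact h U x)

/-- Composition of the maps induced on principal parts. -/
lemma jetMap_comp {l m n : ℕ} (D : LinMap L M) (E : LinMap M N) (hD : D.Compat l m)
    (hE : E.Compat m n) : jetMap D hD ≫ jetMap E hE = jetMap (D.comp E) (hD.comp hE) :=
  jet_ext fun U x => by simp

lemma jetMap_congr {m n : ℕ} {D E : LinMap M N} (h : ∀ U x, D.app U x = E.app U x)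
    (hD : D.Compat m n) (hE : E.Compat m n) : jetMap D hD = jetMap E hE :=
  jet_ext fun U x => by simp [h]

variable (M) in
/-- The map `δ : P^{a+b}_X ⊗ M → P^a_X ⊗ P^b_X ⊗ M`,
`(f ⊗ g) ⊗ x ↦ (f ⊗ 1) ⊗ (1 ⊗ g) ⊗ x`. -/
def jetComul (a b : ℕ) : jet (a + b) M ⟶ jet a (jet b M) :=
  jetMap (jetUniv b M) ((jetUniv_isDiffOp b M).compat a)

lemma jetMap_ofHom_aug {m n : ℕ} (f : M ⟶ N) (h : (LinMap.ofHom f).Compat m n) :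
    jetMap (.ofHom f) h ≫ jetAug n N = jetAug m M ≫ f :=
  jet_ext fun U x => by simp

/-- The functor `M ↦ P^m_X ⊗ M`. -/
@[simps]
def jetFunctor (X : Scheme.{0}) [X.Over (Spec (CommRingCat.of ℂ))] (m : ℕ) :
    X.Modules ⥤ X.Modules where
  obj M := jet m M
  map f := jetMap (.ofHom f) (LinMap.compat_ofHom f le_rfl)
  map_id M := jet_ext fun U x => by simp
  map_comp f g := jet_ext fun U x => by simp

instance (m : ℕ) : (jetFunctor X m).Additive where
  map_add {M N f g} := jet_ext fun U x => by
    show (jetMap (.ofHom (f + g)) _).app U ((jetUniv m M).app U x) =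
      (jetMap (.ofHom f) _).app U ((jetUniv m M).app U x) +
        (jetMap (.ofHom g) _).app U ((jetUniv m M).app U x)
    rw [jetMap_univ, jetMap_univ, jetMap_univ, ← map_add]
    rfl

end JetCalculus
end
end CrysPoincare

namespace CrysPoincare

noncomputable section

section FormRes

variable {k A B C : Type*} [CommRing k] [CommRing A] [Algebra k A] [CommRing B] [Algebra k B]
  [CommRing C] [Algebra k C] (φ : A →ₐ[k] B)

/-- Functoriality of the algebra of forms along a homomorphism of algebras. -/
def formRes : FormAlg k A →+* FormAlg k B :=
  letI := φ.toRingHom.toAlgebra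
  haveI : IsScalarTower k A B := .of_algebraMap_eq' φ.comp_algebraMap.symm
  (formMap k A B).toRingHom

lemma formRes_algebraMap (a : A) : formRes φ (algebraMap A _ a) = algebraMap B _ (φ a) :=
  letI := φ.toRingHom.toAlgebra
  haveI : IsScalarTower k A B := .of_algebraMap_eq' φ.comp_algebraMap.symm
  formMap_algebraMap k a

lemma formRes_dForm (a : A) : formRes φ (dForm k A a) = dForm k B (φ a) :=
  letI := φ.toRingHom.toAlgebra
  haveI : IsScalarTower k A B := .of_algebraMap_eq' φ.comp_algebraMap.symm
  formMap_dForm k a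

lemma formRes_extD (x : FormAlg k A) : formRes φ (extD k A x) = extD k B (formRes φ x) :=
  letI := φ.toRingHom.toAlgebra
  haveI : IsScalarTower k A B := .of_algebraMap_eq' φ.comp_algebraMap.symm
  formMap_extD k x

lemma formRes_mem {p : ℕ} {x : FormAlg k A} (hx : x ∈ ⋀[A]^p Ω[A⁄k]) :
    formRes φ x ∈ ⋀[B]^p Ω[B⁄k] :=
  letI := φ.toRingHom.toAlgebra
  haveI : IsScalarTower k A B := .of_algebraMap_eq' φ.comp_algebraMap.symm
  formMap_mem k hx

lemma formRes_smul (a : A) (x : FormAlg k A) : formRes φ (a • x) = φ a • formRes φ x := by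
  rw [Algebra.smul_def, map_mul, formRes_algebraMap, Algebra.smul_def]

lemma formRes_id (x : FormAlg k A) (φ : A →ₐ[k] A) (h : ∀ a, φ a = a) : formRes φ x = x := by
  induction x using form_induction with
  | hA a => rw [formRes_algebraMap, h]
  | hd a => rw [formRes_dForm, h]
  | hmul x y hx hy => rw [map_mul, hx, hy]
  | hadd x y hx hy => rw [map_add, hx, hy]

lemma formRes_comp (x : FormAlg k A) (ψ : B →ₐ[k] C) (χ : A →ₐ[k] C) (h : ∀ a, χ a = ψ (φ a)) :
    formRes χ x = formRes ψ (formRes φ x) := by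
  induction x using form_induction with
  | hA a => rw [formRes_algebraMap, formRes_algebraMap, formRes_algebraMap, h]
  | hd a => rw [formRes_dForm, formRes_dForm, formRes_dForm, h]
  | hmul x y hx hy => rw [map_mul, map_mul, map_mul, hx, hy]
  | hadd x y hx hy => rw [map_add, map_add, map_add, hx, hy]

/-- Functoriality of forms of degree `p`. -/
def formResDeg (p : ℕ) : ⋀[A]^p Ω[A⁄k] →+ ⋀[B]^p Ω[B⁄k] where
  toFun x := ⟨formRes φ x, formRes_mem φ x.2⟩
  map_zero' := Subtype.ext (map_zero _)
  map_add' _ _ := Subtype.ext (map_add _ _ _)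

lemma formResDeg_smul (p : ℕ) (a : A) (x : ⋀[A]^p Ω[A⁄k]) :
    formResDeg φ p (a • x) = φ a • formResDeg φ p x :=
  Subtype.ext (formRes_smul φ a (x : FormAlg k A))

lemma formResDeg_id (p : ℕ) (x : ⋀[A]^p Ω[A⁄k]) (φ : A →ₐ[k] A) (h : ∀ a, φ a = a) :
    formResDeg φ p x = x :=
  Subtype.ext (formRes_id _ φ h)

lemma formResDeg_comp (p : ℕ) (x : ⋀[A]^p Ω[A⁄k]) (ψ : B →ₐ[k] C) (χ : A →ₐ[k] C)
    (h : ∀ a, χ a = ψ (φ a)) : formResDeg χ p x = formResDeg ψ p (formResDeg φ p x) :=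
  Subtype.ext (formRes_comp φ _ ψ χ h)

lemma extDeriv_formRes (p : ℕ) (x : ⋀[A]^p Ω[A⁄k]) :
    extDeriv k B p (formResDeg φ p x) = formResDeg φ (p + 1) (extDeriv k A p x) :=
  Subtype.ext (formRes_extD φ x).symm

lemma extDeriv_extDeriv (p : ℕ) (x : ⋀[A]^p Ω[A⁄k]) :
    extDeriv k A (p + 1) (extDeriv k A p x) = 0 :=
  Subtype.ext (extD_extD _)

lemma extDeriv_commutator (p : ℕ) (a b : A) (x : ⋀[A]^p Ω[A⁄k]) :
    extDeriv k A p (a • b • x) - a • extDeriv k A p (b • x) - b • extDeriv k A p (a • x)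
      + b • a • extDeriv k A p x = 0 := by
  refine Subtype.ext ?_
  show extD k A (a • b • (x : FormAlg k A)) - a • extD k A (b • (x : FormAlg k A)) -
    b • extD k A (a • (x : FormAlg k A)) + b • a • extD k A x = 0
  simp only [extD_smul, smul_add, mul_smul_comm]
  rw [smul_comm a b]
  abel

end FormRes

section DeRham

open AlgebraicGeometry Opposite

variable {X : Scheme.{0}}

/-- Sections of a sheaf of modules which agree locally are equal. -/
lemma eq_of_local {N : X.Modules} {U : X.Opens} {s t : Γ(N, U)}
    (h : ∀ x ∈ U, ∃ (V : X.Opens) (i : V ⟶ U), x ∈ V ∧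
      N.presheaf.map i.op s = N.presheaf.map i.op t) : s = t := by
  choose V i hx e using h
  exact TopCat.Sheaf.eq_of_locally_eq' ⟨N.presheaf, N.isSheaf⟩ (fun x : U => V x x.2) U
    (fun x => i x x.2) (fun x hx' => TopologicalSpace.Opens.mem_iSup.2 ⟨⟨x, hx'⟩, hx x hx'⟩) s t
    fun x => e x x.2

variable [X.Over (Spec (CommRingCat.of ℂ))]

variable (X) in
/-- The presheaf of abelian groups `U ↦ ⋀ᵖ Ω_{𝒪(U)/ℂ}`. For `p = 0` this is `𝒪_X`, since `⋀⁰` of an `A`-module is `A · 1`. -/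
def omegaPresheafAb (p : ℕ) : TopCat.Presheaf Ab X where
  obj U := AddCommGrpCat.of (⋀[Γ(X, U.unop)]^p Ω[Γ(X, U.unop)⁄ℂ])
  map i := AddCommGrpCat.ofHom (formResDeg (resFun i.unop) p)
  map_id U := by
    ext y
    exact congrArg Subtype.val (formResDeg_id p y _ (resFun_id _))
  map_comp i j := by
    ext y
    exact congrArg Subtype.val
      (formResDeg_comp (resFun i.unop) p y (resFun j.unop) _ (resFun_comp _ _))

instance (p : ℕ) (U : (TopologicalSpace.Opens X)ᵒᵖ) :
    Module (X.ringCatSheaf.obj.obj U) ((omegaPresheafAb X p).obj U) :=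
  inferInstanceAs (Module Γ(X, U.unop) (⋀[Γ(X, U.unop)]^p Ω[Γ(X, U.unop)⁄ℂ]))

variable (X) in
/-- The presheaf of modules `U ↦ ⋀ᵖ Ω_{𝒪(U)/ℂ}`. For `p = 0` this is `𝒪_X`, since `⋀⁰` of an `A`-module is `A · 1`. -/
def omegaPresheaf (p : ℕ) : X.PresheafOfModules :=
  PresheafOfModules.ofPresheaf (omegaPresheafAb X p) fun {_ _} i a y =>
    formResDeg_smul (resFun i.unop) p a y

variable (X) in
/-- The sheaf `Ωᵖ_X` of differential forms of degree `p` of `X` over `ℂ`: the sheaf associated with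
`U ↦ ⋀ᵖ Ω_{𝒪(U)/ℂ}`. For `p = 0` this is `𝒪_X`, since `⋀⁰` of an `A`-module is `A · 1`. -/
def omega (p : ℕ) : X.Modules :=
  (PresheafOfModules.sheafification (𝟙 X.ringCatSheaf.obj)).obj (omegaPresheaf X p)

/-- The canonical map from `⋀ᵖ Ω_{𝒪(U)/ℂ}` to sections of `Ωᵖ_X`. -/
def toOmega (p : ℕ) (U : X.Opens) :
    ⋀[Γ(X, U)]^p Ω[Γ(X, U)⁄ℂ] →ₗ[Γ(X, U)] Γ(omega X p, U) :=
  (((PresheafOfModules.sheafificationAdjunction (𝟙 X.ringCatSheaf.obj)).unit.app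
    (omegaPresheaf X p)).app (op U)).hom

lemma toOmega_res (p : ℕ) {U V : X.Opens} (i : V ⟶ U) (y : ⋀[Γ(X, U)]^p Ω[Γ(X, U)⁄ℂ]) :
    toOmega p V (formResDeg (resFun i) p y) = (omega X p).presheaf.map i.op (toOmega p U y) :=
  PresheafOfModules.naturality_apply ((PresheafOfModules.sheafificationAdjunction
    (𝟙 X.ringCatSheaf.obj)).unit.app (omegaPresheaf X p)) i.op y

lemma toOmega_local {p : ℕ} {U : X.Opens} (s : Γ(omega X p, U)) :
    ∀ x ∈ U, ∃ (V : X.Opens) (i : V ⟶ U), x ∈ V ∧ ∃ y : ⋀[Γ(X, V)]^p Ω[Γ(X, V)⁄ℂ],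
      toOmega p V y = (omega X p).presheaf.map i.op s := by
  have h : TopCat.Presheaf.IsLocallySurjective (CategoryTheory.toSheafify
    (Opens.grothendieckTopology X) (omegaPresheafAb X p)) :=
    inferInstanceAs (Presheaf.IsLocallySurjective _ _)
  intro x hx
  obtain ⟨V, i, ⟨y, hy⟩, hxV⟩ := (TopCat.Presheaf.isLocallySurjective_iff _).1 h U s x hx
  exact ⟨V, homOfLE i, hxV, y, hy⟩

/-- The exterior derivative on presheaves. -/
def derivPresheaf (X : Scheme.{0}) [X.Over (Spec (CommRingCat.of ℂ))] (p : ℕ) :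
    omegaPresheafAb X p ⟶ omegaPresheafAb X (p + 1) where
  app U := AddCommGrpCat.ofHom (extDeriv ℂ Γ(X, U.unop) p).toAddMonoidHom
  naturality U V i := by
    ext y
    exact extDeriv_formRes (resFun i.unop) p y

/-- The exterior derivative as a morphism of sheaves of abelian groups. -/
def derivAb (X : Scheme.{0}) [X.Over (Spec (CommRingCat.of ℂ))] (p : ℕ) :
    (omega X p).presheaf ⟶ (omega X (p + 1)).presheaf :=
  ((presheafToSheaf (Opens.grothendieckTopology X) AddCommGrpCat).map (derivPresheaf X p)).hom

lemma derivAb_toOmega (p : ℕ) (U : X.Opens) (y : ⋀[Γ(X, U)]^p Ω[Γ(X, U)⁄ℂ]) :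
    (derivAb X p).app (op U) (toOmega p U y) = toOmega (p + 1) U (extDeriv ℂ Γ(X, U) p y) := by
  have := CategoryTheory.toSheafify_naturality (Opens.grothendieckTopology X) (derivPresheaf X p)
  exact (ConcreteCategory.congr_hom (congrArg (fun f => NatTrans.app f (op U)) this) y).symm

/-- The exterior derivative `∇ : Ωᵖ_X → Ωᵖ⁺¹_X`. -/
def deriv (X : Scheme.{0}) [X.Over (Spec (CommRingCat.of ℂ))] (p : ℕ) :
    LinMap (omega X p) (omega X (p + 1)) where
  app U :=
    { toFun := (derivAb X p).app (op U)
      map_add' := map_add _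
      map_smul' := fun c s => by
        refine eq_of_local fun x hx => ?_
        obtain ⟨V, i, hxV, y, hy⟩ := toOmega_local s x hx
        refine ⟨V, i, hxV, ?_⟩
        have nat : ∀ s, (omega X (p + 1)).presheaf.map i.op ((derivAb X p).app (op U) s) =
          (derivAb X p).app (op V) ((omega X p).presheaf.map i.op s) := fun s =>
            (ConcreteCategory.congr_hom ((derivAb X p).naturality i.op) s).symm
        have h1 := (resMod (omega X p) i).map_smul c s
        have h2 := (resMod (omega X (p + 1)) i).map_smul c ((derivAb X p).app (op U) s)
        have h3 : c • toOmega p V y = toOmega p V (c • y) :=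
          ((toOmega p V).restrictScalars ℂ).map_smul c y |>.symm
        have h4 := ((toOmega (p + 1) V).restrictScalars ℂ).map_smul c (extDeriv ℂ Γ(X, V) p y)
        refine (nat _).trans (Eq.trans ?_ h2.symm)
        refine (congrArg _ h1).trans ?_
        show (derivAb X p).app (op V) (c • (omega X p).presheaf.map i.op s) =
          c • (omega X (p + 1)).presheaf.map i.op ((derivAb X p).app (op U) s)
        rw [nat, ← hy, h3, derivAb_toOmega, derivAb_toOmega, map_smul]
        exact h4 }
  naturality i s := ConcreteCategory.congr_hom ((derivAb X p).naturality i.op) s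

lemma deriv_toOmega (p : ℕ) (U : X.Opens) (y : ⋀[Γ(X, U)]^p Ω[Γ(X, U)⁄ℂ]) :
    (deriv X p).app U (toOmega p U y) = toOmega (p + 1) U (extDeriv ℂ Γ(X, U) p y) :=
  derivAb_toOmega p U y

lemma deriv_commutator (p : ℕ) (U : X.Opens) (a b : Γ(X, U)) (s : Γ(omega X p, U)) :
    (deriv X p).app U (a • b • s) - a • (deriv X p).app U (b • s) -
      b • ((deriv X p).app U (a • s) - a • (deriv X p).app U s) = 0 := by
  refine eq_of_local fun x hx => ?_
  obtain ⟨V, i, hxV, y, hy⟩ := toOmega_local s x hx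
  refine ⟨V, i, hxV, ?_⟩
  have hy' : resMod (omega X p) i s = toOmega p V y := hy.symm
  have h := congrArg (toOmega (p + 1) V) (extDeriv_commutator p (resFun i a) (resFun i b) y)
  show resMod (omega X (p + 1)) i _ = resMod (omega X (p + 1)) i _
  simp only [map_sub, map_zero, resMod_smul, ← (deriv X p).naturality, hy', map_add, map_smul,
    smul_sub] at h ⊢
  simp only [← map_smul, deriv_toOmega] at h ⊢
  rw [← h]
  abel

/-- The exterior derivative is a differential operator of order at most `1`. -/
lemma deriv_isDiffOp (p : ℕ) : (deriv X p).IsDiffOp 1 := fun U a b =>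
  LinearMap.ext fun s => deriv_commutator p U a b s

lemma deriv_deriv (p : ℕ) (U : X.Opens) (s : Γ(omega X p, U)) :
    (deriv X (p + 1)).app U ((deriv X p).app U s) = 0 := by
  refine eq_of_local fun x hx => ?_
  obtain ⟨V, i, hxV, y, hy⟩ := toOmega_local s x hx
  refine ⟨V, i, hxV, ?_⟩
  have hy' : resMod (omega X p) i s = toOmega p V y := hy.symm
  show resMod (omega X (p + 1 + 1)) i _ = resMod (omega X (p + 1 + 1)) i _
  rw [← (deriv X (p + 1)).naturality, ← (deriv X p).naturality, hy', deriv_toOmega, deriv_toOmega,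
    extDeriv_extDeriv, map_zero, map_zero]

variable (X) in
/-- The function `1`, as a form of degree `0`. -/
def oneForm : Γ(omega X 0, ⊤) :=
  toOmega 0 ⊤ ⟨1, by rw [ExteriorAlgebra.exteriorPower, pow_zero]; exact Submodule.one_le.1 le_rfl⟩

lemma deriv_oneForm : (deriv X 0).app ⊤ (oneForm X) = 0 := by
  rw [oneForm, deriv_toOmega, ← map_zero (toOmega (X := X) 1 ⊤)]
  congr 1
  refine Subtype.ext ?_
  show extD ℂ _ 1 = 0
  rw [← map_one (algebraMap Γ(X, ⊤) _), extD_algebraMap, dForm]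
  simp

end DeRham
end
end CrysPoincare

namespace CrysPoincare

noncomputable section

section Stratified

open AlgebraicGeometry Opposite

variable {X : Scheme.{0}} [X.Over (Spec (CommRingCat.of ℂ))]

/-- The projective system `(m, i) ↦ P^m_X ⊗ F_i`. -/
def jetDiagram {I : Type} [SmallCategory I] (F : I ⥤ X.Modules) : ℕᵒᵖ × I ⥤ X.Modules where
  obj a := jet a.1.unop (F.obj a.2)
  map u := jetMap (.ofHom (F.map u.2)) (LinMap.compat_ofHom _ (leOfHom u.1.unop))
  map_id a := jet_ext fun U x => by simp
  map_comp u v := jet_ext fun U x => by simp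

@[simp] lemma jetDiagram_obj {I : Type} [SmallCategory I] (F : I ⥤ X.Modules) (a : ℕᵒᵖ × I) :
    (jetDiagram F).obj a = jet a.1.unop (F.obj a.2) := rfl

lemma jetDiagram_map {I : Type} [SmallCategory I] (F : I ⥤ X.Modules) {a b : ℕᵒᵖ × I} (u : a ⟶ b) :
    (jetDiagram F).map u =
      jetMap (.ofHom (F.map u.2)) (LinMap.compat_ofHom _ (leOfHom u.1.unop)) := rfl

/-- The pro-object `{P^m_X} ⊗ F = {P^m_X ⊗ F_i}_{(m, i)}`. -/
def jetObj (P : ProObj X.Modules) : ProObj X.Modules := ⟨ℕᵒᵖ × P.I, jetDiagram P.F⟩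

/-- The passage from `colim_i Hom(P_i, c)` to `colim_{n, i} Hom(P^n_X ⊗ P_i, P^m_X ⊗ c)`. -/
def jetGerm (P : ProObj X.Modules) (m : ℕᵒᵖ) (c : X.Modules) :
    P.Germ c →+ (jetObj P).Germ (jet m.unop c) :=
  ProObj.germTrans (P := P) (P' := jetObj P) (Prod.sectR m P.I) (jetFunctor X m.unop)
    { app i := 𝟙 _
      naturality i j u := by
        refine (Category.comp_id _).trans (Eq.trans ?_ (Category.id_comp _).symm)
        exact jetMap_congr (fun U x => rfl) _ _ } c

lemma jetGerm_germ (P : ProObj X.Modules) (m : ℕᵒᵖ) {c : X.Modules} (i : P.I)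
    (f : P.F.obj i ⟶ c) : jetGerm P m c (P.germ i f) =
      (jetObj P).germ (m, i) (jetMap (.ofHom f) (LinMap.compat_ofHom f le_rfl)) := by
  refine (ProObj.germTrans_germ _ _ _ i f).trans ?_
  exact congrArg ((jetObj P).germ (c := jet m.unop c) (m, i)) (Category.id_comp _)

lemma jetGerm_push (P : ProObj X.Modules) {m n : ℕᵒᵖ} (u : m ⟶ n) {c c' : X.Modules} (g : c ⟶ c')
    (x : P.Germ c) :
    (jetObj P).push (jetMap (.ofHom g) (LinMap.compat_ofHom g (leOfHom u.unop))) (jetGerm P m c x) =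
      jetGerm P n c' (P.push g x) := by
  obtain ⟨i, f, rfl⟩ := P.germ_rep x
  rw [jetGerm_germ, ProObj.push_germ, jetGerm_germ]
  refine (ProObj.push_germ (jetObj P) _ (m, i) _).trans ?_
  refine Eq.trans ?_ ((jetObj P).germ_map (i := (m, i)) (j := (n, i)) (u, 𝟙 i) _)
  refine congrArg ((jetObj P).germ (c := jet n.unop c') (m, i)) ?_
  refine (jetMap_comp _ _ _ _).trans (Eq.trans ?_ (jetMap_comp _ _ _ _).symm)
  exact jetMap_congr (fun U x => by simp) _ _

variable (X) in
/-- The functor `F ↦ {P^m_X} ⊗ F` on pro-objects. -/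
def jetPro : ProObj X.Modules ⥤ ProObj X.Modules where
  obj P := jetObj P
  map {P Q} f := ProObj.Hom.mk ⟨fun b => jetGerm P b.1 (Q.F.obj b.2) (ProObj.Hom.at f b.2),
    fun b b' u => (jetGerm_push P u.1 (Q.F.map u.2) _).trans
      (congrArg _ (ProObj.push_at f u.2))⟩
  map_id P := by
    ext b
    show jetGerm P b.1 _ (ProObj.Hom.at (𝟙 P) b.2) = _
    rw [ProObj.id_at, jetGerm_germ]
    exact congrArg ((jetObj P).germ (c := jet b.1.unop (P.F.obj b.2)) b)
      ((jetFunctor X b.1.unop).map_id _)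
  map_comp {P Q R} f g := by
    ext c
    show jetGerm P c.1 _ (ProObj.Hom.at (f ≫ g) c.2) =
      ProObj.pull _ _ (jetGerm Q c.1 _ (ProObj.Hom.at g c.2))
    obtain ⟨j, z, hz⟩ := Q.germ_rep (ProObj.Hom.at g c.2)
    rw [← hz, ProObj.comp_at_of_germ _ hz.symm, jetGerm_germ]
    refine Eq.trans ?_ (ProObj.pull_germ (Q := jetObj Q) _ (c.1, j) _).symm
    exact (jetGerm_push P (𝟙 c.1) z _).symm

lemma jetPro_map_at {P Q : ProObj X.Modules} (f : P ⟶ Q) (b : ℕᵒᵖ × Q.I) :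
    ProObj.Hom.at ((jetPro X).map f) b = jetGerm P b.1 (Q.F.obj b.2) (ProObj.Hom.at f b.2) := rfl

instance : (jetPro X).Additive where
  map_add {P Q f g} := by
    ext b
    exact map_add (jetGerm P b.1 (Q.F.obj b.2)) _ _

/-- The morphism `{P^m_X} ⊗ F ⟶ F` induced by the diagonal. -/
def proAug (P : ProObj X.Modules) : (jetPro X).obj P ⟶ P :=
  ProObj.ofLevel (P := jetObj P) (Q := P) (Prod.sectR (op 0) P.I)
    { app i := jetAug 0 (P.F.obj i)
      naturality i j u := jetMap_ofHom_aug (P.F.map u) _ }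

/-- The morphism `{P^m_X} ⊗ F ⟶ {P^m_X} ⊗ {P^n_X} ⊗ F` with components
`δ : P^{m+n}_X ⊗ F_i ⟶ P^m_X ⊗ P^n_X ⊗ F_i`. -/
def proComul (P : ProObj X.Modules) : (jetPro X).obj P ⟶ (jetPro X).obj ((jetPro X).obj P) :=
  ProObj.ofLevel (P := jetObj P) (Q := jetObj (jetObj P))
    { obj a := (op (a.1.unop + a.2.1.unop), a.2.2)
      map u := ((homOfLE (add_le_add (leOfHom u.1.unop) (leOfHom u.2.1.unop))).op, u.2.2) }
    { app a := jetComul (P.F.obj a.2.2) a.1.unop a.2.1.unop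
      naturality a b u := by
        refine (jetMap_comp _ _ _ _).trans (Eq.trans ?_ (jetMap_comp _ _ _ _).symm)
        refine jetMap_congr (fun U x => ?_) _ _
        exact (jetMap_univ (.ofHom (P.F.map u.2.2)) _ U x).symm }

end Stratified
end
end CrysPoincare

namespace CrysPoincare

noncomputable section

section StratPro

open AlgebraicGeometry Opposite

variable {X : Scheme.{0}} [X.Over (Spec (CommRingCat.of ℂ))]

lemma germ_jet_eq {P : ProObj X.Modules} {m m' : ℕ} {i : P.I} {N : X.Modules} (h : m = m')
    {f : jet m (P.F.obj i) ⟶ N} {g : jet m' (P.F.obj i) ⟶ N}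
    (hfg : ∀ U x, f.app U ((jetUniv m _).app U x) = g.app U ((jetUniv m' _).app U x)) :
    (jetObj P).germ (op m, i) f = (jetObj P).germ (op m', i) g := by
  subst h
  rw [jet_ext hfg]

lemma proAug_at (P : ProObj X.Modules) (i : P.I) :
    ProObj.Hom.at (proAug P) i = (jetObj P).germ (op 0, i) (jetAug 0 (P.F.obj i)) := rfl

lemma proComul_at (P : ProObj X.Modules) (a b : ℕ) (i : P.I) :
    ProObj.Hom.at (proComul P) (op a, (op b, i)) =
      (jetObj P).germ (op (a + b), i) (jetComul (P.F.obj i) a b) := rfl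

lemma jetComul_univ (M : X.Modules) (a b : ℕ) (U : X.Opens) (x : Γ(M, U)) :
    (jetComul M a b).app U ((jetUniv (a + b) M).app U x) =
      (jetUniv a (jet b M)).app U ((jetUniv b M).app U x) := jetMap_univ _ _ U x

lemma jetComul_aug_univ (M : X.Modules) (m : ℕ) (U : X.Opens) (x : Γ(M, U)) :
    (jetComul M 0 m ≫ jetAug 0 (jet m M)).app U ((jetUniv (0 + m) M).app U x) =
      Scheme.Modules.Hom.app (𝟙 (jet m M)) U ((jetUniv m M).app U x) := by
  show (jetAug 0 (jet m M)).app U ((jetComul M 0 m).app U ((jetUniv (0 + m) M).app U x)) =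
    (jetUniv m M).app U x
  rw [jetComul_univ, jetAug_univ]

lemma jetComul_coassoc_univ (M : X.Modules) (a b c : ℕ) (U : X.Opens) (x : Γ(M, U)) :
    (jetComul M a (b + c) ≫
      jetMap (.ofHom (jetComul M b c)) (LinMap.compat_ofHom (m := a) _ le_rfl)).app U
        ((jetUniv (a + (b + c)) M).app U x) =
      (jetComul M (a + b) c ≫ jetComul (jet c M) a b).app U ((jetUniv (a + b + c) M).app U x) := by
  show (jetMap (.ofHom (jetComul M b c)) _).app U ((jetComul M a (b + c)).app U _) =
    (jetComul (jet c M) a b).app U ((jetComul M (a + b) c).app U _)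
  rw [jetComul_univ, jetComul_univ, jetComul_univ, jetMap_univ, LinMap.ofHom_app, jetComul_univ]

lemma jetComul_jetMap_univ {L N : X.Modules} {n : ℕ} (D : LinMap L N) (hD : D.IsDiffOp n) (a b : ℕ)
    (U : X.Opens) (x : Γ(L, U)) :
    (jetComul L a (b + n) ≫
      jetMap (.ofHom (jetMap D (hD.compat b))) (LinMap.compat_ofHom (m := a) _ le_rfl)).app U
        ((jetUniv (a + (b + n)) L).app U x) =
      (jetMap D (hD.compat (a + b)) ≫ jetComul N a b).app U ((jetUniv (a + b + n) L).app U x) := by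
  show (jetMap (.ofHom (jetMap D (hD.compat b))) _).app U ((jetComul L a (b + n)).app U _) =
    (jetComul N a b).app U ((jetMap D (hD.compat (a + b))).app U _)
  rw [jetComul_univ, jetMap_univ, jetMap_univ, LinMap.ofHom_app, jetMap_univ, jetComul_univ]

lemma ofSec_jetComul {N : X.Modules} (s : Γ(N, ⊤)) (a b : ℕ) :
    ofSec ((jetUniv a (structureSheaf X)).app ⊤ (oneSec X)) ≫
      jetMap (.ofHom (ofSec ((jetUniv b N).app ⊤ s))) (LinMap.compat_ofHom (m := a) _ le_rfl) =
    ofSec ((jetUniv (a + b) N).app ⊤ s) ≫ jetComul N a b := by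
  rw [ofSec_comp, ofSec_comp, jetMap_univ, LinMap.ofHom_app, ofSec_oneSec, jetComul_univ]

lemma ofSec_jetAug {N : X.Modules} (s : Γ(N, ⊤)) (a : ℕ) :
    ofSec ((jetUniv a N).app ⊤ s) ≫ jetAug a N = ofSec s := by
  rw [ofSec_comp, jetAug_univ]

lemma ofSec_oneSec_eq : ofSec (oneSec X) = 𝟙 (structureSheaf X) :=
  structureSheaf_hom_ext (ofSec_oneSec _)

lemma ofSec_jetMap {M N : X.Modules} {m n : ℕ} (s : Γ(M, ⊤)) (D : LinMap M N) (h : D.Compat m n)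
    (hs : D.app ⊤ s = 0) : ofSec ((jetUniv m M).app ⊤ s) ≫ jetMap D h = 0 := by
  rw [ofSec_comp, jetMap_univ, hs, map_zero]
  exact structureSheaf_hom_ext (ofSec_oneSec _)

lemma jetMap_comp_zero {L M N : X.Modules} {l m n : ℕ} (D : LinMap L M) (hD : D.Compat l m)
    (E : LinMap M N) (hE : E.Compat m n) (h : ∀ U x, E.app U (D.app U x) = 0) :
    jetMap D hD ≫ jetMap E hE = 0 :=
  jet_ext fun U x => by
    show (jetMap E hE).app U ((jetMap D hD).app U _) = 0
    rw [jetMap_univ, jetMap_univ, h, map_zero]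

lemma proComul_aug (P : ProObj X.Modules) :
    proComul P ≫ proAug ((jetPro X).obj P) = 𝟙 _ := by
  ext ⟨⟨m⟩, i⟩
  refine (ProObj.comp_at_germ (proAug_at (jetObj P) (op m, i)) (proComul_at P 0 m i)).trans ?_
  exact germ_jet_eq (P := P) (i := i) (f := jetComul _ 0 m ≫ jetAug 0 _) (g := 𝟙 (jet m _))
    (Nat.zero_add m) (jetComul_aug_univ _ m)

lemma proComul_coassoc (P : ProObj X.Modules) :
    proComul P ≫ (jetPro X).map (proComul P) = proComul P ≫ proComul ((jetPro X).obj P) := by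
  ext ⟨⟨a⟩, ⟨b⟩, ⟨c⟩, i⟩
  have h1 : ProObj.Hom.at ((jetPro X).map (proComul P)) (op a, (op b, (op c, i))) =
      (jetObj (jetObj P)).germ (op a, (op (b + c), i))
        (jetMap (.ofHom (jetComul (P.F.obj i) b c)) (LinMap.compat_ofHom _ le_rfl)) :=
    jetGerm_germ (jetObj P) (op a) (op (b + c), i) _
  have h2 : ProObj.Hom.at (proComul ((jetPro X).obj P)) (op a, (op b, (op c, i))) =
      (jetObj (jetObj P)).germ (op (a + b), (op c, i)) (jetComul (jet c (P.F.obj i)) a b) := rfl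
  refine (ProObj.comp_at_germ h1 (proComul_at P a (b + c) i)).trans
    (Eq.trans ?_ (ProObj.comp_at_germ h2 (proComul_at P (a + b) c i)).symm)
  exact germ_jet_eq (P := P) (i := i) (Nat.add_assoc a b c).symm (jetComul_coassoc_univ _ a b c)

/-- A pro-coherent `𝒪_X`-module: the terms of the system are coherent. As the schemes under
consideration are locally noetherian, coherent means of finite presentation. -/
def IsCoh (P : ProObj X.Modules) : Prop :=
  ∀ i, SheafOfModules.IsFinitePresentation (R := X.ringCatSheaf) (P.F.obj i)

variable (X) in
/-- A stratified pro-coherent module: a comodule over `{P^m_X}`, that is a pro-coherent module `F`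
with an `𝒪_X`-linear coaction `F ⟶ {P^m_X} ⊗ F` which is counital and coassociative. -/
structure StratPro where
  obj : ProObj X.Modules
  isCoh : IsCoh obj
  strat : obj ⟶ (jetPro X).obj obj
  counit : strat ≫ proAug obj = 𝟙 obj
  coassoc : strat ≫ (jetPro X).map strat = strat ≫ proComul obj

namespace StratPro

/-- Morphisms of pro-objects which commute with the stratifications. -/
def homSubgroup (F G : StratPro X) : AddSubgroup (F.obj ⟶ G.obj) where
  carrier := {f | F.strat ≫ (jetPro X).map f = f ≫ G.strat}
  add_mem' {f g} hf hg := by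
    have hf' : F.strat ≫ (jetPro X).map f = f ≫ G.strat := hf
    have hg' : F.strat ≫ (jetPro X).map g = g ≫ G.strat := hg
    show F.strat ≫ (jetPro X).map (f + g) = (f + g) ≫ G.strat
    rw [Functor.map_add, Preadditive.comp_add, Preadditive.add_comp, hf', hg']
  zero_mem' := by simp
  neg_mem' {f} hf := by
    have hf' : F.strat ≫ (jetPro X).map f = f ≫ G.strat := hf
    show F.strat ≫ (jetPro X).map (-f) = (-f) ≫ G.strat
    rw [Functor.map_neg, Preadditive.comp_neg, Preadditive.neg_comp, hf']

/-- Morphisms of stratified pro-modules. -/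
@[ext] structure Hom (F G : StratPro X) where
  toFun : homSubgroup F G

instance : Category (StratPro X) where
  Hom F G := Hom F G
  id F := ⟨⟨𝟙 _, by simp [homSubgroup]⟩⟩
  comp {F G H} f g := ⟨⟨f.toFun.1 ≫ g.toFun.1, by
    have hf : F.strat ≫ (jetPro X).map f.toFun.1 = f.toFun.1 ≫ G.strat := f.toFun.2
    have hg : G.strat ≫ (jetPro X).map g.toFun.1 = g.toFun.1 ≫ H.strat := g.toFun.2
    show F.strat ≫ (jetPro X).map (f.toFun.1 ≫ g.toFun.1) = (f.toFun.1 ≫ g.toFun.1) ≫ H.strat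
    rw [CategoryTheory.Functor.map_comp, reassoc_of% hf, hg, Category.assoc]⟩⟩
  id_comp f := Hom.ext (Subtype.ext (Category.id_comp _))
  comp_id f := Hom.ext (Subtype.ext (Category.comp_id _))
  assoc f g h := Hom.ext (Subtype.ext (Category.assoc _ _ _))

/-- The underlying morphism of pro-objects. -/
def Hom.hom {F G : StratPro X} (f : F ⟶ G) : F.obj ⟶ G.obj := (Hom.toFun f).1

@[ext] lemma hom_ext {F G : StratPro X} {f g : F ⟶ G} (h : Hom.hom f = Hom.hom g) : f = g :=
  Hom.ext (Subtype.ext h)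

/-- A morphism from a morphism of pro-objects. -/
def mkHom {F G : StratPro X} (f : F.obj ⟶ G.obj) (h : F.strat ≫ (jetPro X).map f = f ≫ G.strat) :
    F ⟶ G := Hom.mk ⟨f, h⟩

/-- Morphisms form a group. -/
def homEquiv (F G : StratPro X) : (F ⟶ G) ≃ homSubgroup F G :=
  ⟨Hom.toFun, Hom.mk, fun _ => rfl, fun _ => rfl⟩

instance (F G : StratPro X) : AddCommGroup (F ⟶ G) := (homEquiv F G).addCommGroup

lemma add_hom {F G : StratPro X} (f g : F ⟶ G) : Hom.hom (f + g) = Hom.hom f + Hom.hom g := rfl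
lemma comp_hom {F G H : StratPro X} (f : F ⟶ G) (g : G ⟶ H) :
    Hom.hom (f ≫ g) = Hom.hom f ≫ Hom.hom g := rfl
lemma zero_hom {F G : StratPro X} : Hom.hom (0 : F ⟶ G) = 0 := rfl

instance : Preadditive (StratPro X) where
  add_comp F G H f g h := by
    ext1
    rw [comp_hom, add_hom, add_hom, comp_hom, comp_hom, Preadditive.add_comp]
  comp_add F G H f g h := by
    ext1
    rw [comp_hom, add_hom, add_hom, comp_hom, comp_hom, Preadditive.comp_add]

variable (X) in
/-- Forgetting the stratification. -/
@[simps]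
def forgetStrat : StratPro X ⥤ ProObj X.Modules where
  obj F := F.obj
  map f := Hom.hom f
  map_id _ := rfl
  map_comp _ _ := rfl

instance : (forgetStrat X).Additive where
  map_add := rfl

end StratPro

variable (X) in
/-- The category of pro-coherent modules. -/
abbrev ProCoh : Type 1 := ObjectProperty.FullSubcategory (IsCoh (X := X))

variable (X) in
/-- Forgetting the stratification, as a functor to pro-coherent modules. -/
def StratPro.toProCoh : StratPro X ⥤ ProCoh X :=
  ObjectProperty.lift _ (StratPro.forgetStrat X) fun F => F.isCoh

instance : (StratPro.toProCoh X).Additive where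
  map_add := rfl

/-- The morphism of pro-objects `𝒪_X ⟶ {P^m_X} ⊗ N`, `f ↦ (f ⊗ 1) ⊗ s`, where `s` is a global
section of `N`. -/
def secToJet {N : X.Modules} (s : Γ(N, ⊤)) :
    ProObj.const (structureSheaf X) ⟶ (jetPro X).obj (ProObj.const N) :=
  ProObj.ofLevel (P := ProObj.const (structureSheaf X)) (Q := jetObj (ProObj.const N))
    ((CategoryTheory.Functor.const _).obj PUnit.unit)
    { app a := ofSec ((jetUniv a.1.unop N).app ⊤ s)
      naturality a b u := by
        refine (Category.id_comp _).trans (Eq.trans ?_ (ofSec_comp _ _).symm)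
        exact congrArg ofSec (jetMap_univ (.ofHom (𝟙 N)) _ ⊤ s).symm }

lemma secToJet_at {N : X.Modules} (s : Γ(N, ⊤)) (a : ℕᵒᵖ × PUnit.{1}) :
    ProObj.Hom.at (secToJet s) a =
      (ProObj.const (structureSheaf X)).germ PUnit.unit (ofSec ((jetUniv a.1.unop N).app ⊤ s)) := rfl

lemma secToJet_strat {N : X.Modules} (s : Γ(N, ⊤)) :
    secToJet (oneSec X) ≫ (jetPro X).map (secToJet s) = secToJet s ≫ proComul _ := by
  ext ⟨⟨a⟩, ⟨b⟩, i⟩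
  have h1 : ProObj.Hom.at ((jetPro X).map (secToJet s)) (op a, (op b, i)) =
      (jetObj (ProObj.const (structureSheaf X))).germ (op a, PUnit.unit)
        (jetMap (.ofHom (ofSec ((jetUniv b N).app ⊤ s))) (LinMap.compat_ofHom _ le_rfl)) :=
    jetGerm_germ (ProObj.const (structureSheaf X)) (op a) PUnit.unit _
  refine (ProObj.comp_at_germ h1 (secToJet_at (oneSec X) (op a, PUnit.unit))).trans
    (Eq.trans ?_ (ProObj.comp_at_germ (proComul_at (ProObj.const N) a b i)
      (secToJet_at s (op (a + b), PUnit.unit))).symm)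
  exact congrArg ((ProObj.const (structureSheaf X)).germ PUnit.unit) (ofSec_jetComul s a b)

/-- The structure sheaf with its canonical stratification `f ↦ f ⊗ 1`. -/
def stratO (h : IsCoh (ProObj.const (structureSheaf X))) : StratPro X where
  obj := ProObj.const (structureSheaf X)
  isCoh := h
  strat := secToJet (oneSec X)
  counit := by
    ext i
    refine (ProObj.comp_at_germ (proAug_at _ i) (secToJet_at _ (op 0, i))).trans ?_
    exact congrArg ((ProObj.const (structureSheaf X)).germ i)
      ((ofSec_jetAug (oneSec X) 0).trans ofSec_oneSec_eq)
  coassoc := secToJet_strat _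

/-- The stratified pro-module `{P^m_X} ⊗ L`, with the stratification induced by
`δ : P^{m+n}_X → P^m_X ⊗ P^n_X`, `f ⊗ g ↦ (f ⊗ 1) ⊗ (1 ⊗ g)`. -/
def linObj (L : X.Modules) (h : IsCoh ((jetPro X).obj (ProObj.const L))) : StratPro X where
  obj := (jetPro X).obj (ProObj.const L)
  isCoh := h
  strat := proComul _
  counit := proComul_aug _
  coassoc := proComul_coassoc _

variable {L M N : X.Modules}

/-- The linearization `{P^m_X} ⊗ L ⟶ {P^m_X} ⊗ N` of a differential operator `D : L → N` of order at
most `n`, with components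
`P^{m+n}_X ⊗ L ⟶ P^m_X ⊗ N`, `(f ⊗ g) ⊗ x ↦ (f ⊗ 1) ⊗ D (g x)`. -/
def linDiff {n : ℕ} (D : LinMap L N) (hD : D.IsDiffOp n) :
    (jetPro X).obj (ProObj.const L) ⟶ (jetPro X).obj (ProObj.const N) :=
  ProObj.ofLevel (P := jetObj (ProObj.const L)) (Q := jetObj (ProObj.const N))
    { obj a := (op (a.1.unop + n), PUnit.unit)
      map u := ((homOfLE (Nat.add_le_add_right (leOfHom u.1.unop) n)).op, 𝟙 _) }
    { app a := jetMap D (hD.compat a.1.unop)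
      naturality a b u := by
        refine (jetMap_comp _ _ _ _).trans (Eq.trans ?_ (jetMap_comp _ _ _ _).symm)
        exact jetMap_congr (fun U x => rfl) _ _ }

lemma linDiff_at {n : ℕ} (D : LinMap L N) (hD : D.IsDiffOp n) (a : ℕᵒᵖ × PUnit.{1}) :
    ProObj.Hom.at (linDiff D hD) a =
      (jetObj (ProObj.const L)).germ (op (a.1.unop + n), PUnit.unit)
        (jetMap D (hD.compat a.1.unop)) := rfl

lemma linDiff_strat {n : ℕ} (D : LinMap L N) (hD : D.IsDiffOp n) :
    proComul _ ≫ (jetPro X).map (linDiff D hD) = linDiff D hD ≫ proComul _ := by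
  ext ⟨⟨a⟩, ⟨b⟩, i⟩
  have h1 : ProObj.Hom.at ((jetPro X).map (linDiff D hD)) (op a, (op b, i)) =
      (jetObj (jetObj (ProObj.const L))).germ (op a, (op (b + n), PUnit.unit))
        (jetMap (.ofHom (jetMap D (hD.compat b))) (LinMap.compat_ofHom _ le_rfl)) :=
    jetGerm_germ (jetObj (ProObj.const L)) (op a) (op (b + n), PUnit.unit) _
  refine (ProObj.comp_at_germ h1 (proComul_at (ProObj.const L) a (b + n) PUnit.unit)).trans
    (Eq.trans ?_ (ProObj.comp_at_germ (proComul_at (ProObj.const N) a b i)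
      (linDiff_at D hD (op (a + b), PUnit.unit))).symm)
  exact germ_jet_eq (P := ProObj.const L) (i := PUnit.unit) (Nat.add_assoc a b n).symm
    (jetComul_jetMap_univ D hD a b)

lemma linDiff_comp {m n : ℕ} (D : LinMap L M) (hD : D.IsDiffOp m) (E : LinMap M N)
    (hE : E.IsDiffOp n) (h : ∀ U x, E.app U (D.app U x) = 0) : linDiff D hD ≫ linDiff E hE = 0 := by
  ext ⟨⟨a⟩, i⟩
  refine (ProObj.comp_at_germ (linDiff_at E hE (op a, PUnit.unit))
    (linDiff_at D hD (op (a + n), PUnit.unit))).trans ?_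
  exact (congrArg ((jetObj (ProObj.const L)).germ (c := jet a N) (op (a + n + m), PUnit.unit))
    (jetMap_comp_zero D _ E _ h)).trans (map_zero _)

lemma secToJet_linDiff {n : ℕ} (s : Γ(M, ⊤)) (D : LinMap M N) (hD : D.IsDiffOp n)
    (h : D.app ⊤ s = 0) : secToJet s ≫ linDiff D hD = 0 := by
  ext ⟨⟨a⟩, i⟩
  refine (ProObj.comp_at_germ (linDiff_at D hD (op a, PUnit.unit))
    (secToJet_at s (op (a + n), PUnit.unit))).trans ?_
  exact (congrArg ((ProObj.const (structureSheaf X)).germ (c := jet a N) PUnit.unit)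
    (ofSec_jetMap s D _ h)).trans (map_zero _)

variable (X) in
/-- The modules `𝒪_X` and `P^m_X ⊗ Ωᵖ_X` are coherent. -/
def CohTerms : Prop :=
  IsCoh (ProObj.const (structureSheaf X)) ∧
    ∀ p, IsCoh ((jetPro X).obj (ProObj.const (omega X p)))

/-- The stratified pro-module `{P^m_X} ⊗ Ωᵖ_X`. -/
def linOmega (h : CohTerms X) (p : ℕ) : StratPro X := linObj (omega X p) (h.2 p)

/-- The differential `{P^m_X} ⊗ Ωᵖ_X ⟶ {P^m_X} ⊗ Ωᵖ⁺¹_X`: the linearization of the exterior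
derivative. -/
def linDeriv (h : CohTerms X) (p : ℕ) : linOmega h p ⟶ linOmega h (p + 1) :=
  StratPro.mkHom (F := linObj (omega X p) (h.2 p)) (G := linObj (omega X (p + 1)) (h.2 (p + 1)))
    (linDiff (deriv X p) (deriv_isDiffOp p)) (linDiff_strat _ _)

lemma linDeriv_linDeriv (h : CohTerms X) (p : ℕ) : linDeriv h p ≫ linDeriv h (p + 1) = 0 :=
  StratPro.hom_ext
    (linDiff_comp _ (deriv_isDiffOp p) _ (deriv_isDiffOp (p + 1)) (deriv_deriv p))

/-- The linearized de Rham complex `{P^m_X} → {P^m_X} ⊗ Ω¹_X → {P^m_X} ⊗ Ω²_X → ⋯`. -/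
def linDeRham (h : CohTerms X) : CochainComplex (StratPro X) ℕ :=
  CochainComplex.of (linOmega h) (linDeriv h) (linDeriv_linDeriv h)

/-- The augmentation `d⁰ : 𝒪_X ⟶ {P^m_X} = {P^m_X} ⊗ Ω⁰_X`, `f ↦ f ⊗ 1`. -/
def augMap (h : CohTerms X) : stratO h.1 ⟶ linOmega h 0 :=
  StratPro.mkHom (F := stratO h.1) (G := linObj (omega X 0) (h.2 0)) (secToJet (oneForm X))
    (secToJet_strat _)

lemma augMap_linDeriv (h : CohTerms X) : augMap h ≫ linDeriv h 0 = 0 :=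
  StratPro.hom_ext (secToJet_linDiff _ _ (deriv_isDiffOp 0) deriv_oneForm)

lemma augMap_d (h : CohTerms X) :
    CategoryStruct.comp (Z := (linDeRham h).X 1) (augMap h) ((linDeRham h).d 0 1) = 0 := by
  have e : (linDeRham h).d 0 1 = linDeriv h 0 := CochainComplex.of_d (linOmega h) _ _
  exact (congrArg (augMap h ≫ ·) e).trans (augMap_linDeriv h)

/-- The augmented complex `𝒪_X → {P^m_X} → {P^m_X} ⊗ Ω¹_X → {P^m_X} ⊗ Ω²_X → ⋯`. -/
def augDeRham (h : CohTerms X) : CochainComplex (StratPro X) ℕ :=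
  (linDeRham h).augment (augMap h) (augMap_d h)

open Limits

instance (U : X.Opens) : (Scheme.Modules.restrictFunctor U.ι).Additive where
  map_add := rfl

/-- The restriction of pro-objects to an open subscheme. -/
def restrictPro (U : X.Opens) : ProObj X.Modules ⥤ ProObj U.toScheme.Modules :=
  ProObj.mapFunctor (Scheme.Modules.restrictFunctor U.ι)

instance (U : X.Opens) : (restrictPro U).Additive :=
  inferInstanceAs (ProObj.mapFunctor (Scheme.Modules.restrictFunctor U.ι)).Additive

variable (X) in
/-- `X` is everywhere of dimension at most `d` over `ℂ`. -/
def DimLE (d : ℕ) : Prop :=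
  ∀ x : X, ∃ U : X.Opens, x ∈ U ∧ ∃ e ≤ d,
    SmoothOfRelativeDimension e (U.ι ≫ X ↘ Spec (CommRingCat.of ℂ))

end StratPro
end
end CrysPoincare

open Limits AlgebraicGeometry CrysPoincare

/-!
# The crystalline Poincaré lemma

On a smooth algebra `A` over `ℂ` with coordinates `x i`, the principal parts of order `m` of a free
module with basis `b` are free on the monomials `ξ^α ⊗ b j` with `|α| ≤ m`, where
`ξ i = 1 ⊗ x i - x i ⊗ 1` (`Coords.jetBasis`; independence uses characteristic zero). The linearized
de Rham complex is therefore the de Rham complex of a formal polynomial ring in the `ξ i` over `A`,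
and the classical proof of the Poincaré lemma applies: contraction with the radial vector field
`Σ ξ i ∂/∂ξ i` is a homotopy from zero to the Lie derivative along this field, by Cartan's formula,
and the Lie derivative multiplies a monomial form of total degree `r` by `r`. Dividing by the
eigenvalues gives a homotopy `P^m ⊗ Ωᵖ⁺¹ → P^{m+1} ⊗ Ωᵖ` in each positive degree, and in degree zero
the value along the diagonal takes care of the monomial `1` (`Coords.jetHomotopy_add`,
`Coords.jetConst_add`).

The bases of forms and of principal parts are compatible with localization, hence are frames of the
sheaves `Ωᵖ` and `P^m ⊗ Ωᵖ` (`Coords.isFrame_omega`, `Coords.isFrame_jet`). So these sheaves are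
locally free of finite presentation, and the algebraic homotopy defines `O`-linear morphisms over the
domain of the coordinates, compatible with the transition maps (`Coords.contraction`). A smooth scheme
is covered by domains of coordinates, which gives the local homotopies
(`LocalContraction.exists_homotopy`); `Ωᵖ` vanishes as soon as `p` exceeds the numbers of coordinates.

The categories of pro-coherent modules and of stratified pro-modules are not known to be abelian
here, so exactness means that the homology exists and is zero. A criterion for this in a preadditive
category is `exact_of_factorization`: every differential has to factor as an epimorphism which is a
cokernel of the preceding differential, followed by a monomorphism which is a kernel of the next one.
The pro-object of the levelwise cokernels of the preceding differential does this. It is pro-coherent,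
being levelwise a cokernel of a morphism between modules with finite local frames, and it is a cokernel
in pro-objects of modules (`ProObj.levelCoker_desc`). The local contraction, which
exists level by level, shows that its map to the next term is levelwise a locally split monomorphism
(`Contracted.isLocallySplit_desc`) and that it has the property of a kernel
(`exists_lift_of_contracted`). The coaction descends to the cokernel (`StratPro.quot`). Since principal
parts preserve locally split monomorphisms (`IsLocallySplit.mono_jetMap`), lifts through these
images are automatically compatible with the coactions, so that the kernels and cokernels of pro-objects
are kernels and cokernels of stratified pro-modules as well (`StratPro.Factored.exact`). This proves
exactness in both categories at once (`HasCharts.exactAt`).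
-/

namespace CrysPoincare

noncomputable section

/-! ### Exactness through factorizations -/

/-- Exactness in a preadditive category which need not be abelian: if `f` factors through an
epimorphism followed by a kernel of `g`, and `g` factors through a cokernel of `f` followed by a
monomorphism, then the homology of `S` exists and is zero. -/
theorem exact_of_factorization {C : Type*} [Category C] [Preadditive C] (S : ShortComplex C)
    {B B' Z : C} (hZ : IsZero Z) (e : S.X₁ ⟶ B) (i : B ⟶ S.X₂) (hf : e ≫ i = S.f)
    (he : Epi e) (hi : Mono i)
    (hker : ∀ {T : C} (t : T ⟶ S.X₂), t ≫ S.g = 0 → ∃ s, s ≫ i = t)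
    (p : S.X₂ ⟶ B') (j : B' ⟶ S.X₃) (hg : p ≫ j = S.g) (hp : Epi p) (hj : Mono j)
    (hcok : ∀ {T : C} (t : S.X₂ ⟶ T), S.f ≫ t = 0 → ∃ s, p ≫ s = t) : S.Exact := by
  have wi : i ≫ S.g = 0 := by
    rw [← cancel_epi e, reassoc_of% hf, S.zero, comp_zero]
  have wp : S.f ≫ p = 0 := by
    rw [← cancel_mono j, Category.assoc, hg, S.zero, zero_comp]
  have ip : i ≫ p = 0 := by
    rw [← cancel_epi e, reassoc_of% hf, wp, comp_zero]
  -- `B` is a kernel of `g` and `B'` a cokernel of `f`; both homologies are zero.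
  choose lift hlift using @hker
  choose desc hdesc using @hcok
  have hK : IsLimit (KernelFork.ofι i wi) :=
    KernelFork.IsLimit.ofι i wi (fun t ht => lift t ht) (fun t ht => hlift t ht)
      (fun t ht b hb => by rw [← cancel_mono i, hb, hlift t ht])
  have hQ : IsColimit (CokernelCofork.ofπ p wp) :=
    CokernelCofork.IsColimit.ofπ p wp (fun t ht => desc t ht) (fun t ht => hdesc t ht)
      (fun t ht b hb => by rw [← cancel_epi p, hb, hdesc t ht])
  have hle : hK.lift (KernelFork.ofι S.f S.zero) = e := by
    rw [← cancel_mono i, hf]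
    exact Fork.IsLimit.lift_ι hK
  have hlg : hQ.desc (CokernelCofork.ofπ S.g S.zero) = j := by
    rw [← cancel_epi p, hg]
    exact Cofork.IsColimit.π_desc hQ
  refine ⟨⟨{
    left :=
      { K := B, H := Z, i := i, π := 0, wi := wi, hi := hK, wπ := comp_zero
        hπ := by
          refine CokernelCofork.IsColimit.ofπ _ _ (fun _ _ => 0) (fun k hk => ?_)
            (fun _ _ _ _ => hZ.eq_of_src _ _)
          rw [hle] at hk
          rw [← cancel_epi e, hk, zero_comp, comp_zero] }
    right :=
      { Q := B', H := Z, p := p, ι := 0, wp := wp, hp := hQ, wι := zero_comp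
        hι := by
          refine KernelFork.IsLimit.ofι _ _ (fun _ _ => 0) (fun k hk => ?_)
            (fun _ _ _ _ => hZ.eq_of_tgt _ _)
          rw [hlg] at hk
          rw [← cancel_mono j, hk, zero_comp, zero_comp] }
    iso := Iso.refl _
    comm := by simp [ip] }, hZ⟩⟩

/-! ### Kernels and cokernels of pro-objects -/

namespace ProObj

universe v u

variable {C : Type u} [Category.{v} C] [Preadditive C]

lemma germ_eq_zero (P : ProObj C) {c : C} {i : P.I} {f : P.F.obj i ⟶ c} (h : P.germ i f = 0) :
    ∃ (i' : P.I) (u : i' ⟶ i), P.F.map u ≫ f = 0 := by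
  have h0 : P.germ i f = P.germ i 0 := by rw [h, map_zero]
  obtain ⟨k, u, v, huv⟩ := Concrete.colimit_exists_of_rep_eq
    (P.F.op ⋙ preadditiveYoneda.obj c) (i := Opposite.op i) (j := Opposite.op i) f (0 : P.F.obj i ⟶ c) h0
  have huv' : P.F.map u.unop ≫ f = P.F.map v.unop ≫ 0 := huv
  exact ⟨k.unop, u.unop, by rw [huv', comp_zero]⟩

lemma push_comp (P : ProObj C) {a b c : C} (f : a ⟶ b) (g : b ⟶ c) (x : P.Germ a) :
    P.push g (P.push f x) = P.push (f ≫ g) x := by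
  obtain ⟨i, y, rfl⟩ := P.germ_rep x
  simp

lemma push_injective (P : ProObj C) {a b : C} (f : a ⟶ b) [Mono f] :
    Function.Injective (P.push f) := by
  rw [injective_iff_map_eq_zero]
  intro x hx
  obtain ⟨i, y, rfl⟩ := P.germ_rep x
  rw [push_germ] at hx
  obtain ⟨i', u, hu⟩ := P.germ_eq_zero hx
  rw [← P.germ_map u]
  rw [← Category.assoc] at hu
  rw [(cancel_mono f).mp (hu.trans zero_comp.symm), map_zero]

/-- Precomposition with `f` on germs, that is, on morphisms to constant pro-objects. -/
abbrev precomp {P Q : ProObj C} (f : P ⟶ Q) (c : C) : Q.Germ c →+ P.Germ c :=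
  pull (Hom.toFun f) c

lemma precomp_germ {P Q : ProObj C} (f : P ⟶ Q) {c : C} (j : Q.I) (g : Q.F.obj j ⟶ c) :
    precomp f c (Q.germ j g) = P.push g (Hom.at f j) := pull_germ _ _ _

lemma push_precomp {P Q : ProObj C} (f : P ⟶ Q) {c c' : C} (g : c ⟶ c') (x : Q.Germ c) :
    P.push g (precomp f c x) = precomp f c' (Q.push g x) := push_pull _ _ _

/-- A morphism of pro-objects from compatible germs. -/
def ofGerms {P Q : ProObj C} (x : ∀ j, P.Germ (Q.F.obj j))
    (h : ∀ (j j' : Q.I) (u : j ⟶ j'), P.push (Q.F.map u) (x j) = x j') : P ⟶ Q :=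
  Hom.mk ⟨x, h⟩

lemma ofGerms_at {P Q : ProObj C} (x : ∀ j, P.Germ (Q.F.obj j))
    (h : ∀ (j j' : Q.I) (u : j ⟶ j'), P.push (Q.F.map u) (x j) = x j') (j : Q.I) :
    Hom.at (ofGerms x h) j = x j := rfl

/-- A morphism is an epimorphism if precomposition with it is injective on morphisms to constant
pro-objects, since the components of a morphism of pro-objects are of this kind. -/
lemma epi_of_precomp {K B : ProObj C} (e : K ⟶ B)
    (he : ∀ c, Function.Injective (precomp e c)) : Epi e where
  left_cancellation g h hgh := by
    ext j
    exact he _ (congrArg (Hom.at · j) hgh)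

/-- Morphisms to pro-objects descend along `e` as soon as morphisms to constant pro-objects do. -/
lemma desc_of_precomp {K B T : ProObj C} (e : K ⟶ B)
    (he : ∀ c, Function.Injective (precomp e c)) (f : K ⟶ T)
    (hf : ∀ j, ∃ y, precomp e _ y = Hom.at f j) : ∃ g, e ≫ g = f := by
  choose y hy using hf
  refine ⟨ofGerms y fun j j' u => he _ ?_, ?_⟩
  · rw [← push_precomp, hy, hy, push_at]
  · ext j
    exact hy j

/-- A morphism of pro-objects with sufficiently many monomorphic components is a monomorphism. -/
lemma mono_of_level {P Q : ProObj C} (f : P ⟶ Q)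
    (h : ∀ i, ∃ (i' : P.I) (_ : i' ⟶ i) (j : Q.I) (y : P.F.obj i' ⟶ Q.F.obj j),
      Mono y ∧ Hom.at f j = P.germ i' y) : Mono f where
  right_cancellation {T} s t hst := by
    ext i
    obtain ⟨i', u, j, y, hy, hj⟩ := h i
    rw [← push_at s u, ← push_at t u]
    congr 1
    apply T.push_injective y
    rw [← comp_at_of_germ s hj, ← comp_at_of_germ t hj, hst]

/-- The kernel property of a levelwise monomorphism `τ`: a morphism whose components factor
through the components of `τ` factors through `τ`. -/
lemma lift_of_level {B K T : ProObj C} [Quiver.IsThin B.I] (Φ : K.I ⥤ B.I) (τ : Φ ⋙ B.F ⟶ K.F)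
    (hτ : ∀ k, Mono (τ.app k)) (hΦ : ∀ b, ∃ k, Nonempty (Φ.obj k ⟶ b)) (t : T ⟶ K)
    (ht : ∀ k, ∃ ξ, T.push (τ.app k) ξ = Hom.at t k) : ∃ s, s ≫ ofLevel Φ τ = t := by
  choose ξ hξ using ht
  have hnat : ∀ {k k' : K.I} (u : k ⟶ k'), T.push (B.F.map (Φ.map u)) (ξ k) = ξ k' := by
    intro k k' u
    apply T.push_injective (τ.app k')
    have := τ.naturality u
    have h2 : B.F.map (Φ.map u) ≫ τ.app k' = τ.app k ≫ K.F.map u := this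
    refine (T.push_comp _ _ _).trans ?_
    rw [h2, ← T.push_comp, hξ, hξ, push_at]
  -- As `B` is indexed by a thin category, the lift at `b` depends neither on `k` nor on `Φ k ⟶ b`.
  have key : ∀ {k k' : K.I} {b : B.I} (w : Φ.obj k ⟶ b) (w' : Φ.obj k' ⟶ b),
      T.push (B.F.map w) (ξ k) = T.push (B.F.map w') (ξ k') := by
    intro k k' b w w'
    rw [← hnat (IsCofiltered.minToLeft k k'), ← hnat (IsCofiltered.minToRight k k')]
    rw [T.push_comp, T.push_comp, ← B.F.map_comp, ← B.F.map_comp]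
    congr 3
    exact Subsingleton.elim _ _
  choose k w using hΦ
  refine ⟨ofGerms (fun b => T.push (B.F.map (w b).some) (ξ (k b))) fun b b' u => ?_, ?_⟩
  · rw [T.push_comp, ← B.F.map_comp]
    exact key _ _
  · ext j
    rw [comp_ofLevel_at, ofGerms_at, key (w (Φ.obj j)).some (𝟙 _), B.F.map_id]
    rw [← hξ j]
    congr 1
    obtain ⟨i, y, hy⟩ := T.germ_rep (ξ j)
    rw [← hy, push_germ, Category.comp_id]

section Cokernel

variable [HasCokernels C] {P K : ProObj C} (Φ : K.I ⥤ P.I) (δ : Φ ⋙ P.F ⟶ K.F)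

/-- The levelwise cokernel of a morphism of pro-objects given by levels. -/
def levelCoker : ProObj C where
  I := K.I
  F :=
    { obj j := cokernel (δ.app j)
      map u := cokernel.map _ _ _ _ (δ.naturality u).symm
      map_id j := by
        apply coequalizer.hom_ext
        simp
      map_comp u v := by
        apply coequalizer.hom_ext
        simp }

/-- The projection to the levelwise cokernel. -/
def levelCokerπ : K ⟶ levelCoker Φ δ :=
  ofLevel (Q := levelCoker Φ δ) (𝟭 K.I)
    { app j := cokernel.π (δ.app j)
      naturality _ _ _ := (cokernel.π_desc _ _ _).symm }

lemma levelCokerπ_at (j : K.I) :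
    Hom.at (levelCokerπ Φ δ) j = K.germ j (cokernel.π (δ.app j)) := rfl

/-- A morphism from a level of the cokernel which dies on a level of `K` dies on the corresponding
level of the cokernel, since the levelwise projections are epimorphisms. -/
lemma precomp_levelCokerπ_injective (c : C) :
    Function.Injective (precomp (levelCokerπ Φ δ) c) := by
  rw [injective_iff_map_eq_zero]
  intro x hx
  obtain ⟨j, y, rfl⟩ := (levelCoker Φ δ).germ_rep x
  have hx' : K.germ j (cokernel.π (δ.app j) ≫ y) = 0 :=
    (K.push_germ _ _ _).symm.trans ((precomp_germ (levelCokerπ Φ δ) j y).symm.trans hx)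
  obtain ⟨j', u, hu⟩ := K.germ_eq_zero hx'
  rw [← (levelCoker Φ δ).germ_map (i := j') u]
  have : (levelCoker Φ δ).F.map u ≫ y = 0 := by
    apply coequalizer.hom_ext
    refine Eq.trans ?_ (hu.trans comp_zero.symm)
    exact (cokernel.π_desc_assoc _ _ _ _).trans (Category.assoc _ _ _)
  rw [this, map_zero]

lemma ofLevel_levelCokerπ : ofLevel Φ δ ≫ levelCokerπ Φ δ = 0 := by
  ext j
  refine (comp_at_germ (levelCokerπ_at Φ δ j) (ofLevel_at Φ δ j)).trans ?_
  erw [cokernel.condition]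
  exact map_zero _

/-- The levelwise cokernel is a cokernel as soon as the index map is cofinal enough. -/
lemma levelCoker_desc
    (hΦ : ∀ (j : K.I) (i : P.I) (u : i ⟶ Φ.obj j), ∃ (j' : K.I) (v : j' ⟶ j) (w : Φ.obj j' ⟶ i),
      P.F.map (w ≫ u) = P.F.map (Φ.map v)) {T : ProObj C} (f : K ⟶ T)
    (hf : ofLevel Φ δ ≫ f = 0) : ∃ g, levelCokerπ Φ δ ≫ g = f := by
  refine desc_of_precomp _ (precomp_levelCokerπ_injective Φ δ) f fun k => ?_
  obtain ⟨j, y, hy⟩ := K.germ_rep (Hom.at f k)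
  have h0 : P.germ (Φ.obj j) (δ.app j ≫ y) = 0 :=
    (comp_at_germ hy.symm (ofLevel_at Φ δ j)).symm.trans (congrArg (Hom.at · k) hf)
  obtain ⟨i, u, hu⟩ := P.germ_eq_zero h0
  obtain ⟨j', v, w, hw⟩ := hΦ j i u
  have h1 : δ.app j' ≫ K.F.map v ≫ y = 0 := by
    have h2 : P.F.map (Φ.map v) ≫ δ.app j = δ.app j' ≫ K.F.map v := δ.naturality v
    rw [← reassoc_of% h2, ← hw, P.F.map_comp, Category.assoc, hu, comp_zero]
  refine ⟨(levelCoker Φ δ).germ j' (cokernel.desc (δ.app j') _ h1), ?_⟩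
  refine (precomp_germ (levelCokerπ Φ δ) j' _).trans ((K.push_germ _ _ _).trans ?_)
  refine (congrArg (K.germ j') (cokernel.π_desc _ _ _)).trans ?_
  rw [K.germ_map, hy]

end Cokernel

end ProObj

/-! ### Stratified pro-modules: naturality, quotients and exactness -/

section Stratified

open Opposite

variable {X : Scheme.{0}} [X.Over (Spec (CommRingCat.of ℂ))]

lemma proAug_naturality {P Q : ProObj X.Modules} (f : P ⟶ Q) :
    (jetPro X).map f ≫ proAug Q = proAug P ≫ f := by
  ext j
  obtain ⟨i, y, hy⟩ := P.germ_rep (ProObj.Hom.at f j)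
  have h1 : ProObj.Hom.at ((jetPro X).map f) (op 0, j) =
      (jetObj P).germ (op 0, i) (jetMap (.ofHom y) (LinMap.compat_ofHom y le_rfl)) := by
    rw [jetPro_map_at]
    refine (congrArg (jetGerm P (op 0) (Q.F.obj j)) hy.symm).trans (jetGerm_germ P (op 0) i y)
  refine (ProObj.comp_at_germ (proAug_at Q j) h1).trans
    (Eq.trans ?_ (ProObj.comp_at_germ hy.symm (proAug_at P i)).symm)
  exact congrArg ((jetObj P).germ (op 0, i)) (jetMap_ofHom_aug y _)

lemma jetComul_naturality {M N : X.Modules} (f : M ⟶ N) (a b : ℕ) :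
    jetComul M a b ≫ jetMap (.ofHom (jetMap (m := b) (.ofHom f) (LinMap.compat_ofHom f le_rfl)))
      (LinMap.compat_ofHom (m := a) _ le_rfl) =
    jetMap (.ofHom f) (LinMap.compat_ofHom f le_rfl) ≫ jetComul N a b :=
  jet_ext fun U x => by
    show (jetMap _ _).app U ((jetComul M a b).app U _) = (jetComul N a b).app U _
    rw [jetComul_univ, jetMap_univ, LinMap.ofHom_app, jetMap_univ]
    erw [jetMap_univ]
    rw [jetComul_univ]

lemma proComul_naturality {P Q : ProObj X.Modules} (f : P ⟶ Q) :
    proComul P ≫ (jetPro X).map ((jetPro X).map f) = (jetPro X).map f ≫ proComul Q := by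
  ext ⟨⟨a⟩, ⟨b⟩, j⟩
  obtain ⟨i, y, hy⟩ := P.germ_rep (ProObj.Hom.at f j)
  have h1 : ∀ n, ProObj.Hom.at ((jetPro X).map f) (n, j) =
      (jetObj P).germ (n, i) (jetMap (.ofHom y) (LinMap.compat_ofHom y le_rfl)) := by
    intro n
    rw [jetPro_map_at]
    exact (congrArg (jetGerm P n (Q.F.obj j)) hy.symm).trans (jetGerm_germ P n i y)
  have h2 : ProObj.Hom.at ((jetPro X).map ((jetPro X).map f)) (op a, (op b, j)) =
      (jetObj (jetObj P)).germ (op a, (op b, i)) (jetMap (.ofHom (jetMap (.ofHom y)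
        (LinMap.compat_ofHom y le_rfl))) (LinMap.compat_ofHom _ le_rfl)) := by
    rw [jetPro_map_at]
    exact (congrArg (jetGerm (jetObj P) (op a) _) (h1 (op b))).trans
      (jetGerm_germ (jetObj P) (op a) (op b, i) _)
  refine (ProObj.comp_at_germ h2 (proComul_at P a b i)).trans
    (Eq.trans ?_ (ProObj.comp_at_germ (proComul_at Q a b j) (h1 (op (a + b)))).symm)
  exact congrArg ((jetObj P).germ (op (a + b), i)) (jetComul_naturality y a b)

/-- The coaction on a quotient of a stratified pro-module by which it descends. -/
def StratPro.quot (G : StratPro X) {B : ProObj X.Modules} (hB : IsCoh B) (e : G.obj ⟶ B) [Epi e]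
    (s : B ⟶ (jetPro X).obj B) (hs : e ≫ s = G.strat ≫ (jetPro X).map e) : StratPro X where
  obj := B
  isCoh := hB
  strat := s
  counit := by
    rw [← cancel_epi e, reassoc_of% hs, proAug_naturality, ← Category.assoc, G.counit]
    simp
  coassoc := by
    rw [← cancel_epi e, reassoc_of% hs, reassoc_of% hs, ← Functor.map_comp, hs,
      Functor.map_comp, ← proComul_naturality]
    have := G.coassoc
    rw [reassoc_of% this]

lemma StratPro.mono_of_hom {F G : StratPro X} (f : F ⟶ G) [Mono (Hom.hom f)] : Mono f where
  right_cancellation s t h := hom_ext <| by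
    rw [← cancel_mono (Hom.hom f), ← comp_hom, h, comp_hom]

lemma StratPro.epi_of_hom {F G : StratPro X} (f : F ⟶ G) [Epi (Hom.hom f)] : Epi f where
  left_cancellation s t h := hom_ext <| by
    rw [← cancel_epi (Hom.hom f), ← comp_hom, h, comp_hom]

/-- A factorization of the underlying morphism through a subobject is compatible with the
stratifications. -/
lemma StratPro.exists_lift {B K T : StratPro X} (i : B ⟶ K) (hi : Mono ((jetPro X).map (Hom.hom i)))
    (t : T ⟶ K) (s : T.obj ⟶ B.obj) (hs : s ≫ Hom.hom i = Hom.hom t) : ∃ s' : T ⟶ B, s' ≫ i = t := by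
  have hI : B.strat ≫ (jetPro X).map (Hom.hom i) = Hom.hom i ≫ K.strat := (Hom.toFun i).2
  have hT : T.strat ≫ (jetPro X).map (Hom.hom t) = Hom.hom t ≫ K.strat := (Hom.toFun t).2
  refine ⟨mkHom s ?_, hom_ext hs⟩
  rw [← cancel_mono ((jetPro X).map (Hom.hom i)), Category.assoc, ← Functor.map_comp, hs, hT,
    Category.assoc, hI, reassoc_of% hs]

/-- A factorization of the underlying morphism through a quotient is compatible with the
stratifications. -/
lemma StratPro.exists_desc {B K T : StratPro X} (e : K ⟶ B) [Epi (Hom.hom e)]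
    (t : K ⟶ T) (s : B.obj ⟶ T.obj) (hs : Hom.hom e ≫ s = Hom.hom t) : ∃ s' : B ⟶ T, e ≫ s' = t := by
  have hE : K.strat ≫ (jetPro X).map (Hom.hom e) = Hom.hom e ≫ B.strat := (Hom.toFun e).2
  have hT : K.strat ≫ (jetPro X).map (Hom.hom t) = Hom.hom t ≫ T.strat := (Hom.toFun t).2
  refine ⟨mkHom s ?_, hom_ext hs⟩
  rw [← cancel_epi (Hom.hom e), ← reassoc_of% hE, ← Functor.map_comp, hs, hT, reassoc_of% hs]

/-- A stratified complex `K → L → M` whose first morphism factors through a kernel of the second,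
and whose second morphism factors through a cokernel of the first, at the level of pro-objects. -/
structure StratPro.Factored {K L M B B' : StratPro X} (f : K ⟶ L) (g : L ⟶ M)
    (e : K ⟶ B) (i : B ⟶ L) (p : L ⟶ B') (j : B' ⟶ M) : Prop where
  fac₁ : e ≫ i = f
  fac₂ : p ≫ j = g
  epi₁ : Epi (Hom.hom e)
  epi₂ : Epi (Hom.hom p)
  mono₁ : Mono (Hom.hom i)
  mono₂ : Mono (Hom.hom j)
  mono_jet : Mono ((jetPro X).map (Hom.hom i))
  ker : ∀ {T : ProObj X.Modules} (t : T ⟶ L.obj), t ≫ Hom.hom g = 0 → ∃ s, s ≫ Hom.hom i = t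
  coker : ∀ {T : ProObj X.Modules} (t : L.obj ⟶ T), Hom.hom f ≫ t = 0 → ∃ s, Hom.hom p ≫ s = t

/-- Exactness in the category of stratified pro-modules. The lift through `i` is compatible with the
coactions because `P ⊗ i` is a monomorphism, the descent along `p` because `p` is an epimorphism. -/
lemma StratPro.Factored.exact {K L M B B' : StratPro X} {f : K ⟶ L} {g : L ⟶ M}
    {e : K ⟶ B} {i : B ⟶ L} {p : L ⟶ B'} {j : B' ⟶ M} (h : Factored f g e i p j)
    (w : f ≫ g = 0) {Z : StratPro X} (hZ : IsZero Z) : (ShortComplex.mk f g w).Exact :=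
  have := h.epi₁; have := h.epi₂; have := h.mono₁; have := h.mono₂
  exact_of_factorization _ hZ e i h.fac₁ (epi_of_hom e) (mono_of_hom i)
    (fun t ht => by
      obtain ⟨s, hs⟩ := h.ker (Hom.hom t) (congrArg Hom.hom ht)
      exact exists_lift i h.mono_jet t s hs)
    p j h.fac₂ (epi_of_hom p) (mono_of_hom j)
    (fun t ht => by
      obtain ⟨s, hs⟩ := h.coker (Hom.hom t) (congrArg Hom.hom ht)
      exact exists_desc p t s hs)

/-- The same factorization gives exactness of the underlying complex of pro-coherent modules, where
no compatibility with the coactions is needed. -/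
lemma StratPro.Factored.exact_toProCoh {K L M B B' : StratPro X} {f : K ⟶ L} {g : L ⟶ M}
    {e : K ⟶ B} {i : B ⟶ L} {p : L ⟶ B'} {j : B' ⟶ M} (h : Factored f g e i p j)
    (w : f ≫ g = 0) {Z : StratPro X} (hZ : IsZero Z) :
    ((ShortComplex.mk f g w).map (toProCoh X)).Exact := by
  refine exact_of_factorization _ ((toProCoh X).map_isZero hZ) ((toProCoh X).map e)
    ((toProCoh X).map i) ?_ ?_ ?_ ?_ ((toProCoh X).map p) ((toProCoh X).map j) ?_ ?_ ?_ ?_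
  · exact ((toProCoh X).map_comp e i).symm.trans (congrArg (toProCoh X).map h.fac₁)
  · exact ⟨fun s t hst => ObjectProperty.hom_ext _ (h.epi₁.left_cancellation s.hom t.hom (congrArg (·.hom) hst))⟩
  · exact ⟨fun s t hst => ObjectProperty.hom_ext _ (h.mono₁.right_cancellation s.hom t.hom (congrArg (·.hom) hst))⟩
  · intro T t ht
    obtain ⟨s, hs⟩ := h.ker (T := T.obj) t.hom (congrArg (·.hom) ht)
    exact ⟨ObjectProperty.homMk s, ObjectProperty.hom_ext _ hs⟩
  · exact ((toProCoh X).map_comp p j).symm.trans (congrArg (toProCoh X).map h.fac₂)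
  · exact ⟨fun s t hst => ObjectProperty.hom_ext _ (h.epi₂.left_cancellation s.hom t.hom (congrArg (·.hom) hst))⟩
  · exact ⟨fun s t hst => ObjectProperty.hom_ext _ (h.mono₂.right_cancellation s.hom t.hom (congrArg (·.hom) hst))⟩
  · intro T t ht
    obtain ⟨s, hs⟩ := h.coker (T := T.obj) t.hom (congrArg (·.hom) ht)
    exact ⟨ObjectProperty.homMk s, ObjectProperty.hom_ext _ hs⟩

end Stratified

end
end CrysPoincare

namespace CrysPoincare

noncomputable section

/-! ### Principal parts in coordinates -/

section Coordinates

open MvPolynomial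

/-- Coordinates on a `k`-algebra `A`: functions whose differentials form a basis of `Ω[A⁄k]`. -/
structure Coords (k A : Type*) [CommRing k] [CommRing A] [Algebra k A] (n : ℕ) where
  x : Fin n → A
  basis : Module.Basis (Fin n) A Ω[A⁄k]
  basis_eq : ∀ i, basis i = KaehlerDifferential.D k A (x i)

namespace Coords

variable {k A : Type*} [Field k] [CommRing A] [Algebra k A] {n : ℕ} (c : Coords k A n)

/-- The partial derivative with respect to the coordinate `x i`. -/
def partialDer (i : Fin n) : Derivation k A A := (c.basis.coord i).compDer (KaehlerDifferential.D k A)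

lemma partialDer_apply (i : Fin n) (a : A) :
    c.partialDer i a = c.basis.coord i (KaehlerDifferential.D k A a) := rfl

lemma partialDer_x (i j : Fin n) : c.partialDer i (c.x j) = if i = j then 1 else 0 := by
  rw [partialDer_apply, ← c.basis_eq, Module.Basis.coord_apply, Module.Basis.repr_self,
    Finsupp.single_apply]
  simp [eq_comm]

lemma D_eq_sum (a : A) :
    KaehlerDifferential.D k A a = ∑ i, c.partialDer i a • KaehlerDifferential.D k A (c.x i) := by
  conv_lhs => rw [← c.basis.sum_repr (KaehlerDifferential.D k A a)]
  simp only [c.basis_eq]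
  rfl

/-- The function `1 ⊗ x i - x i ⊗ 1` on the formal neighbourhood of the diagonal. -/
def ξ (i : Fin n) : A ⊗[k] A := 1 ⊗ₜ c.x i - c.x i ⊗ₜ 1

/-- The partial derivative with respect to `x i` in the right variable. -/
def rightDer (i : Fin n) : Derivation A (A ⊗[k] A) (A ⊗[k] A) :=
  Derivation.mk' ((c.partialDer i).toLinearMap.baseChange A) fun s t => by
    induction s using TensorProduct.induction_on with
    | zero => simp
    | add s s' hs hs' => simp only [add_mul, map_add, hs, hs', add_smul, smul_add]; abel
    | tmul a b =>
      induction t using TensorProduct.induction_on with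
      | zero => simp
      | add t t' ht ht' => simp only [mul_add, map_add, ht, ht', add_smul, smul_add]; abel
      | tmul a' b' => simp [tmul_add, mul_comm]

lemma rightDer_tmul (i : Fin n) (a b : A) : c.rightDer i (a ⊗ₜ b) = a ⊗ₜ c.partialDer i b := rfl

lemma rightDer_ξ (i j : Fin n) : c.rightDer i (c.ξ j) = if i = j then 1 else 0 := by
  rw [ξ, map_sub, rightDer_tmul, rightDer_tmul, partialDer_x, Derivation.map_one_eq_zero,
    tmul_zero, sub_zero]
  split_ifs
  · rfl
  · exact tmul_zero _ _

lemma rightDer_aeval (i : Fin n) (p : MvPolynomial (Fin n) A) :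
    c.rightDer i (aeval c.ξ p) = aeval c.ξ (pderiv i p) := by
  induction p using MvPolynomial.induction_on with
  | C a => rw [aeval_C, pderiv_C, map_zero, Derivation.map_algebraMap]
  | add p q hp hq => simp only [map_add, hp, hq]
  | mul_X p j hp =>
    rw [map_mul, aeval_X, Derivation.leibniz, Derivation.leibniz, hp, rightDer_ξ, pderiv_X]
    simp only [smul_eq_mul, map_add, map_mul, aeval_X, Pi.single_apply]
    rcases eq_or_ne i j with rfl | h
    · simp
    · simp [h, h.symm]

variable {M : Type*} [AddCommGroup M] [Module k M] [Module A M] [IsScalarTower k A M]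

lemma partialDer_isDiffOp (i : Fin n) :
    IsDiffOp A 1 (c.partialDer i : A →ₗ[k] A) := fun a => by
  refine IsDiffOp.of_linear fun b x => ?_
  simp only [commutator_apply, smul_eq_mul, Derivation.coeFn_coe, Derivation.leibniz]
  ring

lemma rightDer_mem {m : ℕ} (i : Fin n) {s : A ⊗[k] A} (hs : s ∈ filt k A A (m + 1)) :
    c.rightDer i s ∈ filt k A A m :=
  (c.partialDer_isDiffOp i).filt_le m hs

/-- The first step of the filtration is killed by the multiplication map. -/
lemma lmul'_of_mem_filt {s : A ⊗[k] A} (hs : s ∈ filt k A A 1) :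
    Algebra.TensorProduct.lmul' k (S := A) s = 0 := by
  have : filt k A A 1 ≤ LinearMap.ker
      (LinearMap.liftBaseChange A (LinearMap.id (R := k) (M := A))) := by
    refine filt_succ_le k A 0 _ fun g y _ => ?_
    rw [LinearMap.mem_ker]
    induction y using TensorProduct.induction_on with
    | zero => simp
    | tmul a x => simp only [xi_tmul, map_sub, LinearMap.liftBaseChange_tmul, LinearMap.id_apply, smul_eq_mul]; ring
    | add y z hy hz =>
      rw [map_add, map_add, hy (by rw [filt_zero]; trivial), hz (by rw [filt_zero]; trivial),
        add_zero]
  have h := this hs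
  rw [LinearMap.mem_ker] at h
  rw [← h]
  clear h hs
  induction s using TensorProduct.induction_on with
  | zero => simp
  | tmul a x => simp
  | add y z hy hz => simp only [map_add, hy, hz]

/-- A polynomial of degree at most `m` in the `ξ i` which vanishes to order `m` along the diagonal
is zero: differentiating in the right variable lowers both the degree and the order by one. -/
lemma eq_zero_of_aeval_mem [CharZero k] {m : ℕ} (p : MvPolynomial (Fin n) A) (hp : p.totalDegree ≤ m)
    (h : aeval c.ξ p ∈ filt k A A (m + 1)) : p = 0 := by
  have hconst : ∀ a : A, aeval c.ξ (C a) ∈ filt k A A 1 → a = 0 := by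
    intro a ha
    have := lmul'_of_mem_filt ha
    rw [aeval_C, Algebra.TensorProduct.algebraMap_apply] at this
    simpa using this
  induction m generalizing p with
  | zero =>
    obtain ⟨a, rfl⟩ : ∃ a, p = C a := ⟨_, totalDegree_eq_zero_iff_eq_C.1 (Nat.le_zero.1 hp)⟩
    rw [hconst a h, map_zero]
  | succ m ih =>
    have hd : ∀ i, pderiv i p = 0 := fun i => by
      refine ih _ ?_ ?_
      · refine Finset.sup_le fun d hd => ?_
        rw [mem_support_iff, coeff_pderiv] at hd
        have h1 : d + Finsupp.single i 1 ∈ p.support := by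
          rw [mem_support_iff]; rintro h0; simp [h0] at hd
        have h2 := (le_totalDegree h1).trans hp
        have h3 : (d + Finsupp.single i 1).degree = d.degree + 1 := by
          rw [map_add, Finsupp.degree_single]
        have h4 : (d + Finsupp.single i 1).degree ≤ m + 1 := by
          simpa [Finsupp.degree_eq_sum, Finsupp.sum_fintype] using h2
        have h5 : d.degree ≤ m := by omega
        simpa [Finsupp.degree_eq_sum, Finsupp.sum_fintype] using h5
      · rw [← c.rightDer_aeval]
        exact c.rightDer_mem i h
    -- In characteristic zero, a polynomial whose partial derivatives vanish is constant.
    have hC : p = C (coeff 0 p) := by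
      ext d
      rw [coeff_C]
      split_ifs with h0
      · rw [h0]
      · obtain ⟨i, hi⟩ : ∃ i, d i ≠ 0 := by
          by_contra! hcon
          exact h0 (Finsupp.ext fun i => (hcon i).symm)
        have hle : Finsupp.single i 1 ≤ d := by
          rw [Finsupp.single_le_iff]; omega
        have h1 := congrArg (coeff (d - Finsupp.single i 1)) (hd i)
        rw [coeff_pderiv, tsub_add_cancel_of_le hle, coeff_zero] at h1
        have h2 : ((((d - Finsupp.single i 1 : Fin n →₀ ℕ) i + 1 : ℕ) : k)) • coeff d p = 0 := by
          rw [Algebra.smul_def, mul_comm, ← h1]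
          push_cast
          rfl
        rcases smul_eq_zero.1 h2 with h3 | h3
        · exact absurd h3 (Nat.cast_ne_zero.2 (Nat.succ_ne_zero _))
        · exact h3
    rw [hC] at h ⊢
    rw [hconst _ (filt_anti k A (by omega) h), map_zero]

/-- The monomial in the `ξ i` with exponent `α`. -/
def ξPow (α : Fin n →₀ ℕ) : A ⊗[k] A := aeval c.ξ (monomial α (1 : A))

lemma ξPow_zero : c.ξPow 0 = 1 := by
  rw [ξPow, show monomial (0 : Fin n →₀ ℕ) (1 : A) = 1 from rfl, map_one]

lemma ξPow_mul_ξ (α : Fin n →₀ ℕ) (i : Fin n) :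
    c.ξPow α * c.ξ i = c.ξPow (α + Finsupp.single i 1) := by
  have h := aeval_X (R := A) c.ξ i
  rw [ξPow, ξPow, ← h, ← map_mul, X, monomial_mul, one_mul]

/-- The Euler operator in the right variable acts on a monomial by its degree. -/
lemma sum_rightDer_ξPow (α : Fin n →₀ ℕ) :
    ∑ i, c.rightDer i (c.ξPow α) * c.ξ i = α.degree • c.ξPow α := by
  have h : ∀ i, c.rightDer i (c.ξPow α) * c.ξ i = α i • c.ξPow α := fun i => by
    have hX := aeval_X (R := A) c.ξ i
    rw [ξPow, rightDer_aeval, mul_comm]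
    conv_lhs => enter [1]; rw [← hX]
    rw [← map_mul, X_mul_pderiv_monomial, map_nsmul]
  rw [Finset.sum_congr rfl fun i _ => h i, ← Finset.sum_smul, Finsupp.degree_eq_sum]

/-- The first order Taylor expansion `1 ⊗ g - g ⊗ 1 ≡ Σ ∂g/∂x i · ξ i` modulo the square of the
ideal of the diagonal. -/
lemma tmul_sub_mem_sq (g : A) :
    (1 ⊗ₜ g - g ⊗ₜ 1 : A ⊗[k] A) - ∑ i, c.partialDer i g • c.ξ i ∈
      KaehlerDifferential.ideal k A ^ 2 := by
  have hξ : ∀ i, c.ξ i ∈ KaehlerDifferential.ideal k A := fun i =>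
    KaehlerDifferential.one_smul_sub_smul_one_mem_ideal k _
  have hsum : ∑ i, c.partialDer i g • c.ξ i ∈ KaehlerDifferential.ideal k A :=
    sum_mem fun i _ => by
      rw [Algebra.smul_def]
      exact Ideal.mul_mem_left _ _ (hξ i)
  have h := (Ideal.toCotangent_eq (KaehlerDifferential.ideal k A)
    (x := ⟨1 ⊗ₜ g - g ⊗ₜ 1, KaehlerDifferential.one_smul_sub_smul_one_mem_ideal k g⟩)
    (y := ⟨_, hsum⟩)).1
  refine h ?_
  have h1 := c.D_eq_sum g
  refine h1.trans ?_
  have h2 : (⟨∑ i, c.partialDer i g • c.ξ i, hsum⟩ : KaehlerDifferential.ideal k A) =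
      ∑ i, (c.partialDer i g) • (⟨c.ξ i, hξ i⟩ : KaehlerDifferential.ideal k A) := by
    ext
    rw [AddSubmonoidClass.coe_finsetSum]
    rfl
  rw [h2, map_sum]
  refine Finset.sum_congr rfl fun i _ => ?_
  exact (LinearMap.map_smul_of_tower (KaehlerDifferential.fromIdeal k A) (c.partialDer i g)
    (⟨c.ξ i, hξ i⟩ : KaehlerDifferential.ideal k A)).symm

section Basis

variable {J : Type*} (b : Module.Basis J A M)

lemma act_mem_filt {m : ℕ} (x : M) {s : A ⊗[k] A} (hs : s ∈ KaehlerDifferential.ideal k A ^ m) :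
    act k A x s ∈ filt k A M m := Submodule.subset_span ⟨x, s, hs, rfl⟩

lemma act_add (x y : M) (s : A ⊗[k] A) : act k A (x + y) s = act k A x s + act k A y s := by
  induction s using TensorProduct.induction_on with
  | zero => simp
  | tmul a b => simp [tmul_add]
  | add s t hs ht => simp only [map_add, hs, ht]; abel

/-- The monomials of degree `m` generate the `m`-th step of the filtration modulo the next one. -/
lemma filt_le_sup (m : ℕ) : filt k A M m ≤
    Submodule.span A (Set.range fun q : {α : Fin n →₀ ℕ // α.degree = m} × J =>
      act k A (b q.2) (c.ξPow q.1.1)) ⊔ filt k A M (m + 1) := by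
  induction m with
  | zero =>
    intro y _
    induction y using TensorProduct.induction_on with
    | zero => exact zero_mem _
    | add y z hy hz =>
      exact add_mem (hy (by rw [filt_zero]; trivial)) (hz (by rw [filt_zero]; trivial))
    | tmul a x =>
      rw [← b.linearCombination_repr x, Finsupp.linearCombination_apply, Finsupp.sum, tmul_sum]
      refine sum_mem fun j _ => ?_
      have : a ⊗ₜ[k] (b.repr x j • b j) = (a * b.repr x j) • act k A (b j) (c.ξPow 0) +
          a • act k A (b j) (1 ⊗ₜ (b.repr x j) - (b.repr x j) ⊗ₜ 1) := by
        rw [ξPow_zero, Algebra.TensorProduct.one_def, map_sub, act_tmul, act_tmul, act_tmul,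
          smul_sub]
        simp [smul_tmul']
      rw [this]
      refine add_mem (Submodule.mem_sup_left (Submodule.smul_mem _ _ (Submodule.subset_span
        ⟨(⟨0, by simp⟩, j), rfl⟩))) (Submodule.mem_sup_right (Submodule.smul_mem _ _
          (act_mem_filt _ ?_)))
      rw [zero_add, pow_one]
      exact KaehlerDifferential.one_smul_sub_smul_one_mem_ideal k _
  | succ m ih =>
    refine filt_succ_le k A m _ fun g y hy => ?_
    obtain ⟨y₁, hy₁, y₂, hy₂, rfl⟩ := Submodule.mem_sup.1 (ih hy)
    rw [map_add]
    refine add_mem ?_ (Submodule.mem_sup_right (xi_mem k A g hy₂))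
    clear hy
    induction hy₁ using Submodule.span_induction with
    | zero => rw [map_zero]; exact zero_mem _
    | add y z _ _ hy hz =>
      rw [map_add]
      exact add_mem hy hz
    | smul a y _ hy => rw [map_smul]; exact Submodule.smul_mem _ _ hy
    | mem y hy' =>
      obtain ⟨⟨⟨α, hα⟩, j⟩, rfl⟩ := hy'
      dsimp only
      rw [xi_act, ← sub_add_cancel (1 ⊗ₜ g - g ⊗ₜ 1 : A ⊗[k] A) (∑ i, c.partialDer i g • c.ξ i),
        mul_add, map_add]
      refine add_mem (Submodule.mem_sup_right (act_mem_filt _ ?_))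
        (Submodule.mem_sup_left ?_)
      · rw [show m + 1 + 1 = m + 2 by ring, pow_add]
        refine Ideal.mul_mem_mul ?_ (c.tmul_sub_mem_sq g)
        rw [ξPow, aeval_monomial, map_one, one_mul, ← hα, Finsupp.degree_eq_sum,
          ← Finset.prod_pow_eq_pow_sum, Finsupp.prod_fintype _ _ (fun _ => pow_zero _)]
        exact Ideal.prod_mem_prod fun i _ => Ideal.pow_mem_pow
          (KaehlerDifferential.one_smul_sub_smul_one_mem_ideal k _) _
      · rw [Finset.mul_sum, map_sum]
        refine sum_mem fun i _ => ?_
        rw [mul_smul_comm, map_smul, ξPow_mul_ξ]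
        exact Submodule.smul_mem _ _ (Submodule.subset_span
          ⟨(⟨α + Finsupp.single i 1, by rw [map_add, Finsupp.degree_single, hα]⟩, j), rfl⟩)

/-- The class in the principal parts of order `m` of the element `ξ^α ⊗ x`. -/
def jetMono (m : ℕ) (x : M) (α : Fin n →₀ ℕ) : PrincipalParts k A M m :=
  (filt k A M (m + 1)).mkQ (act k A x (c.ξPow α))

/-- The exponents of degree at most `m`. -/
abbrev JetIndex (n m : ℕ) : Type := {α : Fin n →₀ ℕ // α.degree ≤ m}

instance (n m : ℕ) : Finite (JetIndex n m) := (Finsupp.finite_of_degree_le (σ := Fin n) m)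

/-- Descending induction on the filtration: each of its graded pieces is generated by monomials. -/
lemma span_jetMono (m : ℕ) : ⊤ ≤ Submodule.span A
    (Set.range fun q : JetIndex n m × J => c.jetMono m (b q.2) q.1.1) := by
  set S := Submodule.span A
    (Set.range fun q : JetIndex n m × J => c.jetMono m (b q.2) q.1.1) with hS
  have key : ∀ i, filt k A M (m + 1 - i) ≤ S.comap (filt k A M (m + 1)).mkQ := by
    intro i
    induction i with
    | zero =>
      intro y hy
      show Submodule.Quotient.mk y ∈ S
      rw [(Submodule.Quotient.mk_eq_zero (filt k A M (m + 1))).2 hy]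
      exact zero_mem _
    | succ i ih =>
      by_cases hi : m + 1 ≤ i
      · rwa [show m + 1 - (i + 1) = m + 1 - i by omega]
      refine (c.filt_le_sup b _).trans (sup_le (Submodule.span_le.2 ?_) ?_)
      · rintro _ ⟨⟨⟨α, hα⟩, j⟩, rfl⟩
        exact Submodule.subset_span ⟨(⟨α, by omega⟩, j), rfl⟩
      · rwa [show m + 1 - (i + 1) + 1 = m + 1 - i by omega]
  intro y _
  obtain ⟨y, rfl⟩ := Submodule.Quotient.mk_surjective _ y
  have h := key (m + 1)
  rw [Nat.sub_self, filt_zero] at h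
  exact h (x := y) trivial

/-- Applying the coordinates of `b` to a relation gives a polynomial in the `ξ i` of degree at most
`m` which vanishes to order `m`, hence is zero. -/
lemma linearIndependent_jetMono [CharZero k] (m : ℕ) : LinearIndependent A
    (fun q : JetIndex n m × J => c.jetMono m (b q.2) q.1.1) := by
  classical
  rw [linearIndependent_iff']
  intro s g hg q₀ hq₀
  have h0 : ∑ q ∈ s, g q • act k A (b q.2) (c.ξPow q.1.1) ∈ filt k A M (m + 1) := by
    rw [← Submodule.Quotient.mk_eq_zero, ← hg]
    exact map_sum (filt k A M (m + 1)).mkQ _ _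
  have hcoord := (IsDiffOp.of_linear (A := A)
    (D := (b.coord q₀.2).restrictScalars k) (fun a x => (b.coord q₀.2).map_smul a x)).filt_le (m + 1) h0
  have hact : ∀ (q : JetIndex n m × J) (t : A ⊗[k] A),
      ((b.coord q₀.2).restrictScalars k).baseChange A (act k A (b q.2) t) =
        if q.2 = q₀.2 then t else 0 := by
    intro q t
    induction t using TensorProduct.induction_on with
    | zero => simp
    | add t u ht hu => rw [map_add, map_add, ht, hu]; split_ifs <;> simp
    | tmul a a' =>
      rw [act_tmul, LinearMap.baseChange_tmul, LinearMap.restrictScalars_apply, map_smul,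
        Module.Basis.coord_apply, Module.Basis.repr_self, Finsupp.single_apply]
      split_ifs <;> simp
  let p : MvPolynomial (Fin n) A := ∑ q ∈ s.filter (fun q => q.2 = q₀.2), monomial q.1.1 (g q)
  have hp : p = 0 := by
    refine c.eq_zero_of_aeval_mem (m := m) p ?_ ?_
    · refine (totalDegree_finsetSum _ _).trans (Finset.sup_le fun q _ => ?_)
      refine (totalDegree_monomial_le _ _).trans ?_
      exact q.1.2
    · rw [Submodule.mem_comap, map_sum] at hcoord
      convert hcoord using 1
      rw [map_sum, Finset.sum_filter]
      refine Finset.sum_congr rfl fun q _ => ?_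
      rw [map_smul, hact]
      split_ifs
      · rw [ξPow, ← map_smul, smul_monomial, smul_eq_mul, mul_one]
      · rw [smul_zero]
  have h1 := congrArg (coeff q₀.1.1) hp
  rw [coeff_sum, coeff_zero, Finset.sum_eq_single q₀] at h1
  · simpa using h1
  · intro q hq hne
    rw [coeff_monomial, if_neg]
    intro h
    exact hne (Prod.ext (Subtype.ext h) (Finset.mem_filter.1 hq).2)
  · intro h
    exact (h (Finset.mem_filter.2 ⟨hq₀, rfl⟩)).elim

/-- If `b` is a basis of `M`, the classes `ξ^α ⊗ b j` with `|α| ≤ m` form a basis of the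
principal parts of order `m` of `M`. -/
def jetBasis [CharZero k] (m : ℕ) : Module.Basis (JetIndex n m × J) A (PrincipalParts k A M m) :=
  Module.Basis.mk (c.linearIndependent_jetMono b m) (c.span_jetMono b m)

lemma jetBasis_apply [CharZero k] (m : ℕ) (q : JetIndex n m × J) :
    c.jetBasis b m q = c.jetMono m (b q.2) q.1.1 := Module.Basis.mk_apply _ _ _

end Basis

end Coords

end Coordinates

end
end CrysPoincare

namespace CrysPoincare

noncomputable section

/-! ### The algebraic homotopy -/

section AlgebraicHomotopy

section Act

variable {k A M : Type*} [Field k] [CommRing A] [Algebra k A] [AddCommGroup M] [Module k M]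
  [Module A M] [IsScalarTower k A M]

/-- The map `x ↦ act k A x s`. -/
def actRight (s : A ⊗[k] A) : M →+ A ⊗[k] M :=
  AddMonoidHom.mk' (fun x => act k A x s) fun x y => Coords.act_add x y s

lemma act_zero (s : A ⊗[k] A) : act k A (0 : M) s = 0 := (actRight s).map_zero

lemma act_sub (x y : M) (s : A ⊗[k] A) : act k A (x - y) s = act k A x s - act k A y s :=
  (actRight s).map_sub x y

lemma act_nsmul (q : ℕ) (x : M) (s : A ⊗[k] A) : act k A (q • x) s = q • act k A x s :=
  (actRight s).map_nsmul q x

lemma act_sum {ι : Type*} (t : Finset ι) (x : ι → M) (s : A ⊗[k] A) :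
    act k A (∑ i ∈ t, x i) s = ∑ i ∈ t, act k A (x i) s :=
  map_sum (actRight s) x t

lemma act_ite (P : Prop) [Decidable P] (x : M) (s : A ⊗[k] A) :
    act k A (if P then x else 0) s = if P then act k A x s else 0 := by
  split_ifs
  · rfl
  · exact act_zero s

end Act

namespace Coords

variable {k A : Type*} [Field k] [CommRing A] [Algebra k A] {n : ℕ} (c : Coords k A n)

/-- Contraction of differential forms with the partial derivative `∂/∂x i`. -/
def contr (i : Fin n) : FormAlg k A →ₗ[A] FormAlg k A :=
  CliffordAlgebra.contractLeft (c.basis.coord i)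

lemma contr_ι_mul (i : Fin n) (w : Ω[A⁄k]) (y : FormAlg k A) :
    c.contr i (ExteriorAlgebra.ι A w * y) =
      c.basis.coord i w • y - ExteriorAlgebra.ι A w * c.contr i y :=
  CliffordAlgebra.contractLeft_ι_mul _ _ _

lemma contr_algebraMap (i : Fin n) (a : A) : c.contr i (algebraMap A _ a) = 0 :=
  CliffordAlgebra.contractLeft_algebraMap _ _ _

lemma coord_D_x (i j : Fin n) :
    c.basis.coord i (KaehlerDifferential.D k A (c.x j)) = if i = j then 1 else 0 :=
  c.partialDer_x i j

lemma contr_mem (i : Fin n) {p : ℕ} {y : FormAlg k A} (hy : y ∈ ⋀[A]^(p + 1) Ω[A⁄k]) :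
    c.contr i y ∈ ⋀[A]^p Ω[A⁄k] := by
  induction p generalizing y with
  | zero =>
    rw [ExteriorAlgebra.exteriorPower, zero_add, pow_one] at hy
    obtain ⟨w, rfl⟩ := hy
    rw [ExteriorAlgebra.exteriorPower, pow_zero, Submodule.mem_one]
    exact ⟨_, (CliffordAlgebra.contractLeft_ι _ _ _).symm⟩
  | succ p ih =>
    rw [ExteriorAlgebra.exteriorPower, pow_succ'] at hy
    induction hy using Submodule.mul_induction_on' with
    | mem_mul_mem v hv y hy =>
      obtain ⟨w, rfl⟩ := hv
      rw [contr_ι_mul]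
      refine sub_mem (Submodule.smul_mem _ _ hy) ?_
      rw [ExteriorAlgebra.exteriorPower, pow_succ']
      exact Submodule.mul_mem_mul ⟨_, rfl⟩ (ih hy)
    | add y _ z _ hy hz => rw [map_add]; exact add_mem hy hz

/-- Contraction lowers the degree by one. -/
def contrDeg (i : Fin n) (p : ℕ) : ⋀[A]^(p + 1) Ω[A⁄k] →ₗ[A] ⋀[A]^p Ω[A⁄k] :=
  (c.contr i).restrict fun _ hy => c.contr_mem i hy

/-- Exterior multiplication by `d x i`. -/
def wedge (i : Fin n) (p : ℕ) : ⋀[A]^p Ω[A⁄k] →ₗ[A] ⋀[A]^(p + 1) Ω[A⁄k] :=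
  (LinearMap.mulLeft A (dForm k A (c.x i))).restrict fun y hy => by
    rw [ExteriorAlgebra.exteriorPower, pow_succ']
    exact Submodule.mul_mem_mul ⟨_, rfl⟩ hy

lemma sum_dForm_contr {p : ℕ} {y : FormAlg k A} (hy : y ∈ ⋀[A]^p Ω[A⁄k]) :
    ∑ i, dForm k A (c.x i) * c.contr i y = p • y := by
  induction p generalizing y with
  | zero =>
    rw [ExteriorAlgebra.exteriorPower, pow_zero, Submodule.mem_one] at hy
    obtain ⟨a, rfl⟩ := hy
    simp [contr_algebraMap]
  | succ p ih =>
    rw [ExteriorAlgebra.exteriorPower, pow_succ'] at hy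
    induction hy using Submodule.mul_induction_on' with
    | mem_mul_mem v hv y hy =>
      obtain ⟨w, rfl⟩ := hv
      have h1 : ∀ i, dForm k A (c.x i) * c.contr i (ExteriorAlgebra.ι A w * y) =
          ExteriorAlgebra.ι A (c.basis.coord i w • c.basis i) * y +
            ExteriorAlgebra.ι A w * (dForm k A (c.x i) * c.contr i y) := fun i => by
        have h2 := CliffordAlgebra.ι_mul_ι_add_swap (Q := (0 : QuadraticForm A Ω[A⁄k]))
          (KaehlerDifferential.D k A (c.x i)) w
        have h3 : dForm k A (c.x i) * ExteriorAlgebra.ι A w =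
            - (ExteriorAlgebra.ι A w * dForm k A (c.x i)) := by
          rw [eq_neg_iff_add_eq_zero]
          refine h2.trans ?_
          simp [QuadraticMap.polar]
        rw [contr_ι_mul, mul_sub, ← mul_assoc, h3, neg_mul, sub_neg_eq_add, map_smul,
          c.basis_eq, mul_smul_comm, smul_mul_assoc, mul_assoc]
        rfl
      rw [Finset.sum_congr rfl fun i _ => h1 i, Finset.sum_add_distrib, ← Finset.mul_sum, ih hy,
        ← Finset.sum_mul, ← map_sum]
      have h4 : ∑ i, c.basis.coord i w • c.basis i = w := c.basis.sum_repr w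
      rw [h4, add_smul, one_smul, mul_smul_comm, add_comm]
    | add y _ z _ hy hz =>
      simp only [map_add, mul_add, Finset.sum_add_distrib, hy, hz, smul_add]

/-- A form which is closed, as well as all its contractions: a form with constant coefficients,
for example. -/
def IsFlat (y : FormAlg k A) : Prop := extD k A y = 0 ∧ ∀ i, extD k A (c.contr i y) = 0

lemma extD_one (k A : Type*) [CommRing k] [CommRing A] [Algebra k A] :
    extD k A (1 : FormAlg k A) = 0 := by
  rw [← map_one (algebraMap A (FormAlg k A)), extD_algebraMap, dForm,
    Derivation.map_one_eq_zero, map_zero]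

lemma isFlat_one : c.IsFlat 1 := by
  refine ⟨extD_one k A, fun i => ?_⟩
  rw [← map_one (algebraMap A (FormAlg k A)), contr_algebraMap, map_zero]

lemma IsFlat.dForm_mul {y : FormAlg k A} (hy : c.IsFlat y) (j : Fin n) :
    c.IsFlat (dForm k A (c.x j) * y) := by
  refine ⟨by rw [extD_mul, extD_dForm, hy.1, mul_zero, zero_mul, add_zero], fun i => ?_⟩
  have h : c.contr i (dForm k A (c.x j) * y) =
      (if i = j then 1 else 0 : A) • y - dForm k A (c.x j) * c.contr i y := by
    rw [← c.coord_D_x i j]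
    exact c.contr_ι_mul i _ y
  rw [h, map_sub, extD_mul, extD_dForm, hy.2 i, mul_zero, zero_mul, add_zero, sub_zero]
  split_ifs
  · rw [one_smul, hy.1]
  · rw [zero_smul, map_zero]

variable (p : ℕ)

/-- The basis of `⋀ᵖ Ω[A⁄k]` of the products of `p` of the `d x i`. -/
def formBasis : Module.Basis (Set.powersetCard (Fin n) p) A (⋀[A]^p Ω[A⁄k]) :=
  c.basis.exteriorPower p

lemma formBasis_coe (J : Set.powersetCard (Fin n) p) : (c.formBasis p J : FormAlg k A) =
    (List.ofFn fun i => dForm k A (c.x (Set.powersetCard.ofFinEmbEquiv.symm J i))).prod := by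
  rw [formBasis, exteriorPower.basis_apply, exteriorPower.ιMulti_family_apply_coe,
    ExteriorAlgebra.ιMulti_family, ExteriorAlgebra.ιMulti_apply]
  simp only [Function.comp_apply, c.basis_eq]
  rfl

lemma isFlat_prod (f : Fin p → Fin n) :
    c.IsFlat (List.ofFn fun i => dForm k A (c.x (f i))).prod := by
  induction p with
  | zero => simpa using c.isFlat_one
  | succ p ih =>
    rw [List.ofFn_succ, List.prod_cons]
    exact (ih _).dForm_mul c _

lemma isFlat_formBasis (J : Set.powersetCard (Fin n) p) :
    c.IsFlat (c.formBasis p J : FormAlg k A) := by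
  rw [formBasis_coe]
  exact c.isFlat_prod p _

/-- The operator `Σ ξ i · (contraction with ∂/∂x i)` on `A ⊗ ⋀ᵖ⁺¹ Ω`: contraction with the radial
vector field. -/
def radial : A ⊗[k] ⋀[A]^(p + 1) Ω[A⁄k] →ₗ[A] A ⊗[k] ⋀[A]^p Ω[A⁄k] :=
  ∑ i, xi k A (⋀[A]^p Ω[A⁄k]) (c.x i) ∘ₗ ((c.contrDeg i p).restrictScalars k).baseChange A

lemma baseChange_act {M N : Type*} [AddCommGroup M] [Module k M] [Module A M] [IsScalarTower k A M]
    [AddCommGroup N] [Module k N] [Module A N] [IsScalarTower k A N] (f : M →ₗ[A] N) (x : M)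
    (s : A ⊗[k] A) :
    (f.restrictScalars k).baseChange A (act k A x s) = act k A (f x) s := by
  induction s using TensorProduct.induction_on with
  | zero => simp
  | tmul a b => simp
  | add s t hs ht => simp only [map_add, hs, ht]

lemma radial_act (ω : ⋀[A]^(p + 1) Ω[A⁄k]) (s : A ⊗[k] A) :
    c.radial p (act k A ω s) = ∑ i, act k A (c.contrDeg i p ω) (s * c.ξ i) := by
  rw [radial, LinearMap.sum_apply]
  refine Finset.sum_congr rfl fun i _ => ?_
  rw [LinearMap.comp_apply, baseChange_act, xi_act]
  rfl

lemma radial_mem {m : ℕ} {y : A ⊗[k] ⋀[A]^(p + 1) Ω[A⁄k]} (hy : y ∈ filt k A _ m) :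
    c.radial p y ∈ filt k A _ (m + 1) := by
  rw [radial, LinearMap.sum_apply]
  refine sum_mem fun i _ => xi_mem k A _ ?_
  exact (IsDiffOp.of_linear (D := (c.contrDeg i p).restrictScalars k)
    fun a x => (c.contrDeg i p).map_smul a x).filt_le m hy

lemma extDeriv_isDiffOp {k A : Type*} [CommRing k] [CommRing A] [Algebra k A] (p : ℕ) :
    IsDiffOp A 1 (extDeriv k A p) := fun a b =>
  LinearMap.ext fun s => by
    have h := extDeriv_commutator (k := k) p a b s
    simp only [commutator_apply, LinearMap.zero_apply, smul_sub]
    rw [← h]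
    abel

/-- The exterior derivative in the right variable. -/
abbrev rightD : A ⊗[k] ⋀[A]^p Ω[A⁄k] →ₗ[A] A ⊗[k] ⋀[A]^(p + 1) Ω[A⁄k] :=
  (extDeriv k A p).baseChange A

lemma rightD_mem {m : ℕ} {y : A ⊗[k] ⋀[A]^p Ω[A⁄k]} (hy : y ∈ filt k A _ (m + 1)) :
    rightD p y ∈ filt k A _ m :=
  (extDeriv_isDiffOp p).filt_le m hy

lemma rightD_rightD (y : A ⊗[k] ⋀[A]^p Ω[A⁄k]) : rightD (p + 1) (rightD p y) = 0 := by
  induction y using TensorProduct.induction_on with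
  | zero => simp
  | tmul a x => simp [extDeriv_extDeriv]
  | add s t hs ht => rw [map_add, map_add, hs, ht, add_zero]

lemma rightD_act (ω : ⋀[A]^p Ω[A⁄k]) (s : A ⊗[k] A) :
    rightD p (act k A ω s) =
      ∑ i, act k A (c.wedge i p ω) (c.rightDer i s) + act k A (extDeriv k A p ω) s := by
  induction s using TensorProduct.induction_on with
  | zero => simp
  | add s t hs ht => simp only [map_add, hs, ht, Finset.sum_add_distrib]; abel
  | tmul a b =>
    simp only [act_tmul, LinearMap.baseChange_tmul, rightDer_tmul]
    rw [← tmul_sum, ← tmul_add]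
    congr 1
    refine Subtype.ext ?_
    show extD k A (b • (ω : FormAlg k A)) = _
    rw [extD_smul, dForm, c.D_eq_sum b, map_sum, Finset.sum_mul, add_comm]
    simp only [Submodule.coe_add, AddSubmonoidClass.coe_finsetSum, Submodule.coe_smul]
    congr 1
    refine Finset.sum_congr rfl fun i _ => ?_
    rw [map_smul, smul_mul_assoc]
    rfl

lemma contrDeg_wedge (i j : Fin n) (ω : ⋀[A]^(p + 1) Ω[A⁄k]) :
    c.contrDeg i (p + 1) (c.wedge j (p + 1) ω) =
      (if i = j then ω else 0) - c.wedge j p (c.contrDeg i p ω) := by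
  refine Subtype.ext ?_
  refine (c.contr_ι_mul i _ _).trans ?_
  rw [coord_D_x]
  split_ifs
  · rw [one_smul]; rfl
  · rw [zero_smul]; rfl

lemma sum_wedge_contrDeg (ω : ⋀[A]^(p + 1) Ω[A⁄k]) :
    ∑ i, c.wedge i p (c.contrDeg i p ω) = (p + 1) • ω := by
  refine Subtype.ext ?_
  rw [AddSubmonoidClass.coe_finsetSum]
  exact c.sum_dForm_contr ω.2

/-- Cartan's formula: the Lie derivative along the radial vector field of a form with constant
coefficients times `s` is given by the Euler operator. -/
lemma lie_act {ω : ⋀[A]^(p + 1) Ω[A⁄k]} (hω : c.IsFlat (ω : FormAlg k A)) (s : A ⊗[k] A) :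
    c.radial (p + 1) (rightD (p + 1) (act k A ω s)) + rightD p (c.radial p (act k A ω s)) =
      act k A ω (∑ i, c.rightDer i s * c.ξ i) + (p + 1) • act k A ω s := by
  have h1 : extDeriv k A (p + 1) ω = 0 := Subtype.ext hω.1
  have h2 : ∀ i, extDeriv k A p (c.contrDeg i p ω) = 0 := fun i => Subtype.ext (hω.2 i)
  have key : ∀ i, rightD p (act k A (c.contrDeg i p ω) (s * c.ξ i)) =
      ∑ j, (act k A (c.wedge j p (c.contrDeg i p ω)) (c.rightDer j s * c.ξ i)) +
        act k A (c.wedge i p (c.contrDeg i p ω)) s := fun i => by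
    rw [c.rightD_act, h2, act_zero, add_zero]
    have : ∀ j, act k A (c.wedge j p (c.contrDeg i p ω)) (c.rightDer j (s * c.ξ i)) =
        act k A (c.wedge j p (c.contrDeg i p ω)) (c.rightDer j s * c.ξ i) +
          if j = i then act k A (c.wedge j p (c.contrDeg i p ω)) s else 0 := fun j => by
      rw [Derivation.leibniz, rightDer_ξ, map_add, smul_eq_mul, smul_eq_mul, mul_comm (c.ξ i)]
      refine (add_comm _ _).trans (congrArg _ ?_)
      split_ifs
      · rw [mul_one]
      · rw [mul_zero, map_zero]
    rw [Finset.sum_congr rfl fun j _ => this j, Finset.sum_add_distrib]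
    simp
  rw [c.rightD_act, h1, act_zero, add_zero, map_sum, radial_act, map_sum,
    Finset.sum_congr rfl fun i _ => key i, Finset.sum_add_distrib]
  have h3 : ∀ j, c.radial (p + 1) (act k A (c.wedge j (p + 1) ω) (c.rightDer j s)) =
      act k A ω (c.rightDer j s * c.ξ j) -
        ∑ i, act k A (c.wedge j p (c.contrDeg i p ω)) (c.rightDer j s * c.ξ i) := fun j => by
    rw [radial_act]
    simp only [contrDeg_wedge, act_sub, Finset.sum_sub_distrib, act_ite]
    rw [Finset.sum_ite_eq' Finset.univ j, if_pos (Finset.mem_univ j)]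
  rw [Finset.sum_congr rfl fun j _ => h3 j, Finset.sum_sub_distrib, Finset.sum_comm, ← map_sum]
  have h4 : ∑ i, act k A (c.wedge i p (c.contrDeg i p ω)) s = (p + 1) • act k A ω s := by
    rw [← act_sum, sum_wedge_contrDeg, act_nsmul]
  rw [h4]
  abel

lemma contrDeg_wedge_zero (i j : Fin n) (ω : ⋀[A]^0 Ω[A⁄k]) :
    c.contrDeg i 0 (c.wedge j 0 ω) = if i = j then ω else 0 := by
  refine Subtype.ext ?_
  refine (c.contr_ι_mul i _ _).trans ?_
  have h : c.contr i (ω : FormAlg k A) = 0 := by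
    obtain ⟨ω, hω⟩ := ω
    rw [ExteriorAlgebra.exteriorPower, pow_zero, Submodule.mem_one] at hω
    obtain ⟨a, rfl⟩ := hω
    exact c.contr_algebraMap i a
  have h' : c.contr i ((⋀[A]^0 Ω[A⁄k]).subtype ω) = 0 := h
  rw [coord_D_x, h', mul_zero, sub_zero]
  split_ifs
  · rw [one_smul]; rfl
  · rw [zero_smul]; rfl

/-- Cartan's formula for functions. -/
lemma lie_act_zero {ω : ⋀[A]^0 Ω[A⁄k]} (hω : extDeriv k A 0 ω = 0) (s : A ⊗[k] A) :
    c.radial 0 (rightD 0 (act k A ω s)) = act k A ω (∑ i, c.rightDer i s * c.ξ i) := by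
  rw [c.rightD_act, hω, act_zero, add_zero, map_sum, map_sum]
  refine Finset.sum_congr rfl fun j _ => ?_
  rw [radial_act]
  simp only [contrDeg_wedge_zero, act_ite]
  rw [Finset.sum_ite_eq' Finset.univ j, if_pos (Finset.mem_univ j)]

/-- The exterior derivative on principal parts. -/
def jetD (m p : ℕ) : PrincipalParts k A (⋀[A]^p Ω[A⁄k]) (m + 1) →ₗ[A]
    PrincipalParts k A (⋀[A]^(p + 1) Ω[A⁄k]) m :=
  ppMap (extDeriv k A p) ((extDeriv_isDiffOp p).filt_le (m + 1))

lemma jetD_mk (m p : ℕ) (y : A ⊗[k] ⋀[A]^p Ω[A⁄k]) :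
    jetD m p (Submodule.Quotient.mk y) = Submodule.Quotient.mk (rightD p y) := rfl

/-- Contraction with the radial vector field on principal parts. -/
def jetRadial (m p : ℕ) : PrincipalParts k A (⋀[A]^(p + 1) Ω[A⁄k]) m →ₗ[A]
    PrincipalParts k A (⋀[A]^p Ω[A⁄k]) (m + 1) :=
  Submodule.mapQ _ _ (c.radial p) fun _ hy => c.radial_mem p hy

lemma jetRadial_mk (m p : ℕ) (y : A ⊗[k] ⋀[A]^(p + 1) Ω[A⁄k]) :
    c.jetRadial m p (Submodule.Quotient.mk y) = Submodule.Quotient.mk (c.radial p y) := rfl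

/-- The Lie derivative along the radial vector field on principal parts. -/
def jetLie (m p : ℕ) : PrincipalParts k A (⋀[A]^(p + 1) Ω[A⁄k]) m →ₗ[A]
    PrincipalParts k A (⋀[A]^(p + 1) Ω[A⁄k]) m :=
  Submodule.mapQ _ _ (c.radial (p + 1) ∘ₗ rightD (p + 1) + rightD p ∘ₗ c.radial p) fun _ hy =>
    add_mem (c.radial_mem _ (rightD_mem _ hy)) (rightD_mem _ (c.radial_mem _ hy))

lemma jetLie_mk (m p : ℕ) (y : A ⊗[k] ⋀[A]^(p + 1) Ω[A⁄k]) :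
    c.jetLie m p (Submodule.Quotient.mk y) =
      Submodule.Quotient.mk (c.radial (p + 1) (rightD (p + 1) y) + rightD p (c.radial p y)) := rfl

lemma jetLie_jetMono (m p : ℕ) {ω : ⋀[A]^(p + 1) Ω[A⁄k]} (hω : c.IsFlat (ω : FormAlg k A))
    (α : Fin n →₀ ℕ) :
    c.jetLie m p (c.jetMono m ω α) = (α.degree + (p + 1)) • c.jetMono m ω α := by
  have h := c.lie_act p hω (c.ξPow α)
  rw [sum_rightDer_ξPow, map_nsmul, ← add_smul] at h
  refine (congrArg Submodule.Quotient.mk h).trans ?_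
  exact map_nsmul (filt k A (⋀[A]^(p + 1) Ω[A⁄k]) (m + 1)).mkQ _ _

lemma jetD_jetLie (m p : ℕ) (y : PrincipalParts k A (⋀[A]^(p + 1) Ω[A⁄k]) (m + 1)) :
    jetD m (p + 1) (c.jetLie (m + 1) p y) = c.jetLie m (p + 1) (jetD m (p + 1) y) := by
  obtain ⟨y, rfl⟩ := Submodule.Quotient.mk_surjective _ y
  rw [jetLie_mk, jetD_mk, jetD_mk, jetLie_mk]
  congr 1
  rw [map_add, rightD_rightD, rightD_rightD, map_zero, add_zero, zero_add]

/-- The function `1` as a form of degree zero. -/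
def oneForm₀ (k A : Type*) [CommRing k] [CommRing A] [Algebra k A] : ⋀[A]^0 Ω[A⁄k] :=
  ⟨1, by rw [ExteriorAlgebra.exteriorPower, pow_zero]; exact Submodule.one_le.1 le_rfl⟩

lemma extDeriv_oneForm₀ (k A : Type*) [CommRing k] [CommRing A] [Algebra k A] :
    extDeriv k A 0 (oneForm₀ k A) = 0 := Subtype.ext (extD_one k A)

lemma formBasis_zero (J : Set.powersetCard (Fin n) 0) : c.formBasis 0 J = oneForm₀ k A :=
  Subtype.ext (by rw [formBasis_coe]; simp [oneForm₀])

/-- The functions underlying forms of degree zero. -/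
def formZero (k A : Type*) [CommRing k] [CommRing A] [Algebra k A] : ⋀[A]^0 Ω[A⁄k] →ₗ[A] A :=
  (exteriorPower.zeroEquiv A Ω[A⁄k]).toLinearMap

lemma formZero_one (k A : Type*) [CommRing k] [CommRing A] [Algebra k A] :
    formZero k A (oneForm₀ k A) = 1 := by
  rw [← exteriorPower.zeroEquiv_ιMulti (R := A) (M := Ω[A⁄k]) Fin.elim0, formZero]
  refine congrArg (exteriorPower.zeroEquiv A Ω[A⁄k]) (Subtype.ext ?_)
  simp [oneForm₀]

/-- The value along the diagonal of a principal part of a function. -/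
def jetConst (k A : Type*) [CommRing k] [CommRing A] [Algebra k A] (m : ℕ) :
    PrincipalParts k A (⋀[A]^0 Ω[A⁄k]) m →ₗ[A] A :=
  formZero k A ∘ₗ ppAug k A _ m

lemma jetConst_univOp (k A : Type*) [CommRing k] [CommRing A] [Algebra k A] (m : ℕ) :
    jetConst k A m (univOp A m (oneForm₀ k A)) = 1 := by
  rw [jetConst, LinearMap.comp_apply, ppAug_univOp, formZero_one]

lemma ppAug_jetMono {M : Type*} [AddCommGroup M] [Module k M] [Module A M] [IsScalarTower k A M]
    (m : ℕ) (x : M) {α : Fin n →₀ ℕ} (hα : α ≠ 0) : ppAug k A M m (c.jetMono m x α) = 0 := by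
  obtain ⟨i, hi⟩ : ∃ i, α i ≠ 0 := by
    by_contra! hcon
    exact hα (Finsupp.ext hcon)
  have h1 : α - Finsupp.single i 1 + Finsupp.single i 1 = α :=
    tsub_add_cancel_of_le (by rw [Finsupp.single_le_iff]; omega)
  have h2 : act k A x (c.ξPow α) =
      xi k A M (c.x i) (act k A x (c.ξPow (α - Finsupp.single i 1))) := by
    rw [xi_act]
    change _ = act k A x (_ * c.ξ i)
    rw [ξPow_mul_ξ, h1]
  rw [jetMono, h2]
  show LinearMap.liftBaseChange A (LinearMap.id (R := k) (M := M)) _ = 0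
  generalize act k A x (c.ξPow (α - Finsupp.single i 1)) = y
  induction y using TensorProduct.induction_on with
  | zero => simp
  | tmul a x => simp [xi_tmul, smul_smul, mul_comm]
  | add y z hy hz => rw [map_add, map_add, hy, hz, add_zero]

/-- The transition map from principal parts of order `m + 1` to principal parts of order `m`. -/
def jetTrans (k A M : Type*) [CommRing k] [CommRing A] [Algebra k A] [AddCommGroup M] [Module k M]
    [Module A M] [IsScalarTower k A M] (m : ℕ) :
    PrincipalParts k A M (m + 1) →ₗ[A] PrincipalParts k A M m :=
  Submodule.factor (filt_anti k A (Nat.le_succ (m + 1)))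

lemma jetTrans_mk {k A M : Type*} [CommRing k] [CommRing A] [Algebra k A] [AddCommGroup M]
    [Module k M] [Module A M] [IsScalarTower k A M] (m : ℕ) (y : A ⊗[k] M) :
    jetTrans k A M m (Submodule.Quotient.mk y) = Submodule.Quotient.mk y := rfl

lemma jetTrans_jetLie (m p : ℕ) (y : PrincipalParts k A (⋀[A]^(p + 1) Ω[A⁄k]) (m + 1)) :
    jetTrans k A _ m (c.jetLie (m + 1) p y) = c.jetLie m p (jetTrans k A _ m y) := by
  obtain ⟨y, rfl⟩ := Submodule.Quotient.mk_surjective _ y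
  rw [jetLie_mk, jetTrans_mk, jetTrans_mk, jetLie_mk]

lemma jetTrans_jetRadial (m p : ℕ) (y : PrincipalParts k A (⋀[A]^(p + 1) Ω[A⁄k]) (m + 1)) :
    jetTrans k A _ (m + 1) (c.jetRadial (m + 1) p y) = c.jetRadial m p (jetTrans k A _ m y) := by
  obtain ⟨y, rfl⟩ := Submodule.Quotient.mk_surjective _ y
  rw [jetRadial_mk, jetTrans_mk, jetTrans_mk, jetRadial_mk]

lemma jetConst_jetMono (m : ℕ) (x : ⋀[A]^0 Ω[A⁄k]) {α : Fin n →₀ ℕ} (hα : α ≠ 0) :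
    jetConst k A m (c.jetMono m x α) = 0 := by
  rw [jetConst, LinearMap.comp_apply, ppAug_jetMono _ _ _ hα, map_zero]

lemma jetMono_zero {M : Type*} [AddCommGroup M] [Module k M] [Module A M] [IsScalarTower k A M]
    (m : ℕ) (x : M) : c.jetMono m x 0 = univOp A m x := by
  rw [jetMono, ξPow_zero, Algebra.TensorProduct.one_def, act_tmul, one_smul]
  rfl

lemma jetD_univOp (m p : ℕ) (ω : ⋀[A]^p Ω[A⁄k]) :
    jetD m p (univOp A (m + 1) ω) = univOp A m (extDeriv k A p ω) := rfl

lemma jetRadial_jetD_jetMono (m : ℕ) (α : Fin n →₀ ℕ) :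
    c.jetRadial m 0 (jetD m 0 (c.jetMono (m + 1) (oneForm₀ k A) α)) =
      α.degree • c.jetMono (m + 1) (oneForm₀ k A) α := by
  have h := c.lie_act_zero (extDeriv_oneForm₀ k A) (c.ξPow α)
  rw [sum_rightDer_ξPow, map_nsmul] at h
  refine (congrArg Submodule.Quotient.mk h).trans ?_
  exact map_nsmul (filt k A (⋀[A]^0 Ω[A⁄k]) (m + 1 + 1)).mkQ _ _

lemma jetD_jetRadial_jetD (m : ℕ) (y : PrincipalParts k A (⋀[A]^0 Ω[A⁄k]) (m + 1)) :
    jetD m 0 (c.jetRadial m 0 (jetD m 0 y)) = c.jetLie m 0 (jetD m 0 y) := by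
  obtain ⟨y, rfl⟩ := Submodule.Quotient.mk_surjective _ y
  rw [jetD_mk, jetLie_mk, rightD_rightD, map_zero, zero_add (rightD 0 _), jetRadial_mk, jetD_mk]

variable [CharZero k]

/-- The basis of the principal parts of order `m` of `⋀ᵖ Ω[A⁄k]`. -/
def jetFormBasis (m p : ℕ) : Module.Basis (JetIndex n m × Set.powersetCard (Fin n) p) A
    (PrincipalParts k A (⋀[A]^p Ω[A⁄k]) m) := c.jetBasis (c.formBasis p) m

lemma jetFormBasis_apply (m p : ℕ) (q : JetIndex n m × Set.powersetCard (Fin n) p) :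
    c.jetFormBasis m p q = c.jetMono m (c.formBasis p q.2) q.1.1 := c.jetBasis_apply _ _ _

/-- The inverse of the Lie derivative: it is diagonal in the basis `jetFormBasis`, with non-zero
integral eigenvalues. -/
def jetLieInv (m p : ℕ) : PrincipalParts k A (⋀[A]^(p + 1) Ω[A⁄k]) m →ₗ[A]
    PrincipalParts k A (⋀[A]^(p + 1) Ω[A⁄k]) m :=
  (c.jetFormBasis m (p + 1)).constr k fun q =>
    ((q.1.1.degree + (p + 1) : ℕ) : k)⁻¹ • c.jetFormBasis m (p + 1) q

lemma jetLieInv_basis (m p : ℕ) (q : JetIndex n m × Set.powersetCard (Fin n) (p + 1)) :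
    c.jetLieInv m p (c.jetFormBasis m (p + 1) q) =
      ((q.1.1.degree + (p + 1) : ℕ) : k)⁻¹ • c.jetFormBasis m (p + 1) q :=
  Module.Basis.constr_basis _ _ _ _

lemma jetLie_basis (m p : ℕ) (q : JetIndex n m × Set.powersetCard (Fin n) (p + 1)) :
    c.jetLie m p (c.jetFormBasis m (p + 1) q) =
      ((q.1.1.degree + (p + 1) : ℕ) : k) • c.jetFormBasis m (p + 1) q := by
  rw [jetFormBasis_apply, jetLie_jetMono _ _ _ (c.isFlat_formBasis _ _), Nat.cast_smul_eq_nsmul]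

lemma jetLieInv_jetLie (m p : ℕ) (y : PrincipalParts k A (⋀[A]^(p + 1) Ω[A⁄k]) m) :
    c.jetLieInv m p (c.jetLie m p y) = y := by
  suffices h : c.jetLieInv m p ∘ₗ c.jetLie m p = LinearMap.id from LinearMap.congr_fun h y
  refine (c.jetFormBasis m (p + 1)).ext fun q => ?_
  rw [LinearMap.comp_apply, jetLie_basis, LinearMap.map_smul_of_tower, jetLieInv_basis,
    smul_smul, mul_inv_cancel₀ (Nat.cast_ne_zero.2 (by omega)), one_smul, LinearMap.id_apply]

lemma jetLie_jetLieInv (m p : ℕ) (y : PrincipalParts k A (⋀[A]^(p + 1) Ω[A⁄k]) m) :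
    c.jetLie m p (c.jetLieInv m p y) = y := by
  suffices h : c.jetLie m p ∘ₗ c.jetLieInv m p = LinearMap.id from LinearMap.congr_fun h y
  refine (c.jetFormBasis m (p + 1)).ext fun q => ?_
  rw [LinearMap.comp_apply, jetLieInv_basis, LinearMap.map_smul_of_tower, jetLie_basis,
    smul_smul, inv_mul_cancel₀ (Nat.cast_ne_zero.2 (by omega)), one_smul, LinearMap.id_apply]

/-- The homotopy on principal parts: contraction with the radial vector field, divided by the
eigenvalues of the Lie derivative. -/
def jetHomotopy (m p : ℕ) : PrincipalParts k A (⋀[A]^(p + 1) Ω[A⁄k]) m →ₗ[A]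
    PrincipalParts k A (⋀[A]^p Ω[A⁄k]) (m + 1) :=
  c.jetRadial m p ∘ₗ c.jetLieInv m p

lemma jetHomotopy_jetLie (m p : ℕ) (y : PrincipalParts k A (⋀[A]^(p + 1) Ω[A⁄k]) m) :
    c.jetHomotopy m p (c.jetLie m p y) = c.jetRadial m p y := by
  rw [jetHomotopy, LinearMap.comp_apply, jetLieInv_jetLie]

/-- The homotopy identity in positive degrees. -/
lemma jetHomotopy_add (m p : ℕ) (y : PrincipalParts k A (⋀[A]^(p + 1) Ω[A⁄k]) (m + 1)) :
    c.jetHomotopy m (p + 1) (jetD m (p + 1) y) + jetD (m + 1) p (c.jetHomotopy (m + 1) p y) = y := by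
  obtain ⟨z, rfl⟩ : ∃ z, c.jetLie (m + 1) p z = y := ⟨_, c.jetLie_jetLieInv _ _ y⟩
  rw [jetD_jetLie, jetHomotopy_jetLie, jetHomotopy_jetLie]
  obtain ⟨z, rfl⟩ := Submodule.Quotient.mk_surjective _ z
  rw [jetD_mk, jetRadial_mk, jetRadial_mk, jetD_mk, jetLie_mk, Submodule.Quotient.mk_add]

/-- The homotopy identity on an eigenvector `w` of `R D` with eigenvalue `d`: the homotopy `H` inverts
`D` on `D w` because `L` acts on `D w` by the same eigenvalue. There is no need for the Lie
derivative on functions, which is not invertible. -/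
lemma homotopy_eq_of_eigenvector {P Q : Type*} [AddCommGroup P] [Module A P] [Module k P]
    [AddCommGroup Q] [Module A Q] (D : P →ₗ[A] Q) (R : Q →ₗ[A] P) (L : Q →ₗ[A] Q) (H : Q →ₗ[A] P)
    {w : P} {d : ℕ} (hd : d ≠ 0) (h₁ : R (D w) = d • w) (h₂ : D (R (D w)) = L (D w))
    (h₃ : H (L (D w)) = R (D w)) : H (D w) = w := by
  rw [← h₂, h₁, map_nsmul, map_nsmul, ← Nat.cast_smul_eq_nsmul k, ← Nat.cast_smul_eq_nsmul k] at h₃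
  exact (smul_right_inj (Nat.cast_ne_zero.2 hd : (d : k) ≠ 0)).1 h₃

/-- The homotopy identity in degree zero. -/
lemma jetConst_add (m : ℕ) (y : PrincipalParts k A (⋀[A]^0 Ω[A⁄k]) (m + 1)) :
    jetConst k A (m + 1) y • univOp A (m + 1) (oneForm₀ k A) +
      c.jetHomotopy m 0 (jetD m 0 y) = y := by
  suffices h : LinearMap.toSpanSingleton A _ (univOp A (m + 1) (oneForm₀ k A)) ∘ₗ
      jetConst k A (m + 1) + c.jetHomotopy m 0 ∘ₗ jetD m 0 = LinearMap.id from
    LinearMap.congr_fun h y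
  refine (c.jetFormBasis (m + 1) 0).ext fun ⟨⟨α, hα⟩, J⟩ => ?_
  rw [jetFormBasis_apply, formBasis_zero]
  show jetConst k A (m + 1) (c.jetMono (m + 1) (oneForm₀ k A) α) •
    univOp A (m + 1) (oneForm₀ k A) +
      c.jetHomotopy m 0 (jetD m 0 (c.jetMono (m + 1) (oneForm₀ k A) α)) =
        c.jetMono (m + 1) (oneForm₀ k A) α
  -- The monomial `1` is constant; on the other monomials the Euler operator is invertible.
  rcases eq_or_ne α 0 with rfl | hα'
  · rw [jetMono_zero, jetD_univOp, extDeriv_oneForm₀, map_zero, map_zero, jetConst_univOp,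
      one_smul, add_zero]
  · rw [c.jetConst_jetMono _ _ hα', zero_smul, zero_add]
    exact homotopy_eq_of_eigenvector (k := k) (jetD m 0) (c.jetRadial m 0) (c.jetLie m 0)
      (c.jetHomotopy m 0) (fun h => hα' ((Finsupp.degree_eq_zero_iff α).1 h))
      (c.jetRadial_jetD_jetMono m α) (c.jetD_jetRadial_jetD m _) (c.jetHomotopy_jetLie m 0 _)

/-- The homotopy is compatible with the transition maps, since the Lie derivative is invertible and
the transition maps commute with it and with the radial contraction. -/
lemma jetHomotopy_jetTrans (m p : ℕ) (y : PrincipalParts k A (⋀[A]^(p + 1) Ω[A⁄k]) (m + 1)) :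
    c.jetHomotopy m p (jetTrans k A _ m y) = jetTrans k A _ (m + 1) (c.jetHomotopy (m + 1) p y) := by
  obtain ⟨z, rfl⟩ : ∃ z, c.jetLie (m + 1) p z = y := ⟨_, c.jetLie_jetLieInv _ _ y⟩
  rw [jetTrans_jetLie, jetHomotopy_jetLie, jetHomotopy_jetLie, jetTrans_jetRadial]

end Coords

end AlgebraicHomotopy

end
end CrysPoincare

namespace CrysPoincare

noncomputable section

/-! ### Local frames of sheaves of modules -/

section Frames

open Opposite

variable {X : Scheme.{0}}

lemma presheaf_map_comp (M : X.Modules) {U V W : X.Opens} (i : V ⟶ U) (j : W ⟶ V) (s : Γ(M, U)) :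
    M.presheaf.map j.op (M.presheaf.map i.op s) = M.presheaf.map (j ≫ i).op s :=
  (ConcreteCategory.congr_hom (M.presheaf.map_comp i.op j.op) s).symm

lemma presheaf_map_id (M : X.Modules) {U : X.Opens} (i : U ⟶ U) (s : Γ(M, U)) :
    M.presheaf.map i.op s = s :=
  ConcreteCategory.congr_hom (M.presheaf.map_id (op U)) s

lemma presheaf_map_sum (M : X.Modules) {U V : X.Opens} (i : V ⟶ U) {I : Type*} [Fintype I]
    (c : I → Γ(X, U)) (e : I → Γ(M, U)) :
    M.presheaf.map i.op (∑ a, c a • e a) =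
      ∑ a, X.presheaf.map i.op (c a) • M.presheaf.map i.op (e a) := by
  rw [map_sum]
  exact Finset.sum_congr rfl fun a _ => Scheme.Modules.map_smul M i _ _

lemma app_presheaf_map {M N : X.Modules} (f : M ⟶ N) {U V : X.Opens} (i : V ⟶ U) (s : Γ(M, U)) :
    f.app V (M.presheaf.map i.op s) = N.presheaf.map i.op (f.app U s) :=
  ConcreteCategory.congr_hom (f.mapPresheaf.naturality i.op) s

/-- A frame of `M` over `U`: a family of sections of `M` over `U` whose restrictions form a basis
of the sections of `M` over every open subset of `U`. -/
def IsFrame {M : X.Modules} {U : X.Opens} {I : Type*} (e : I → Γ(M, U)) : Prop :=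
  ∀ (V : X.Opens) (i : V ⟶ U), LinearIndependent Γ(X, V) (fun a => M.presheaf.map i.op (e a)) ∧
    ⊤ ≤ Submodule.span Γ(X, V) (Set.range fun a => M.presheaf.map i.op (e a))

variable {M N L : X.Modules} {U : X.Opens} {I : Type*} {e : I → Γ(M, U)}

/-- The basis of the sections over an open subset given by a frame. -/
def IsFrame.basis (he : IsFrame e) {V : X.Opens} (i : V ⟶ U) : Module.Basis I Γ(X, V) Γ(M, V) :=
  Module.Basis.mk (he V i).1 (he V i).2

lemma IsFrame.basis_apply (he : IsFrame e) {V : X.Opens} (i : V ⟶ U) (a : I) :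
    he.basis i a = M.presheaf.map i.op (e a) := Module.Basis.mk_apply _ _ _

/-- Being a frame can be checked locally. -/
lemma isFrame_of_local [Fintype I]
    (hinj : ∀ (V : X.Opens) (i : V ⟶ U) (c : I → Γ(X, V)),
      ∑ a, c a • M.presheaf.map i.op (e a) = 0 → ∀ x ∈ V, ∃ (W : X.Opens) (j : W ⟶ V), x ∈ W ∧
        ∀ a, X.presheaf.map j.op (c a) = 0)
    (hsurj : ∀ (V : X.Opens) (i : V ⟶ U) (t : Γ(M, V)), ∀ x ∈ V, ∃ (W : X.Opens) (j : W ⟶ V),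
      x ∈ W ∧ ∃ c : I → Γ(X, W),
        ∑ a, c a • M.presheaf.map (j ≫ i).op (e a) = M.presheaf.map j.op t) : IsFrame e := by
  have inj : ∀ (V : X.Opens) (i : V ⟶ U) (c : I → Γ(X, V)),
      ∑ a, c a • M.presheaf.map i.op (e a) = 0 → ∀ a, c a = 0 := by
    intro V i c hc a
    refine eq_of_local (N := structureSheaf X) (s := c a) (t := (0 : Γ(X, V))) fun x hx => ?_
    obtain ⟨W, j, hxW, hW⟩ := hinj V i c hc x hx
    refine ⟨W, j, hxW, ?_⟩
    exact (hW a).trans (map_zero (X.presheaf.map j.op).hom).symm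
  intro V i
  refine ⟨Fintype.linearIndependent_iff.2 (inj V i), fun t _ => ?_⟩
  choose W j hxW c hc using fun x : V => hsurj V i t x x.2
  have hcov : V ≤ iSup W := fun x hx => TopologicalSpace.Opens.mem_iSup.2 ⟨⟨x, hx⟩, hxW ⟨x, hx⟩⟩
  have hcompat : ∀ a, TopCat.Presheaf.IsCompatible X.sheaf.1 W fun x => c x a := by
    intro a x y
    refine sub_eq_zero.1 ?_
    have h1 : ∑ a, X.presheaf.map (TopologicalSpace.Opens.infLELeft (W x) (W y)).op (c x a) •
        M.presheaf.map ((TopologicalSpace.Opens.infLELeft (W x) (W y)) ≫ j x ≫ i).op (e a) =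
        ∑ a, X.presheaf.map (TopologicalSpace.Opens.infLERight (W x) (W y)).op (c y a) •
        M.presheaf.map ((TopologicalSpace.Opens.infLERight (W x) (W y)) ≫ j y ≫ i).op (e a) := by
      have hx := congrArg (M.presheaf.map (TopologicalSpace.Opens.infLELeft (W x) (W y)).op) (hc x)
      have hy := congrArg (M.presheaf.map (TopologicalSpace.Opens.infLERight (W x) (W y)).op) (hc y)
      rw [presheaf_map_sum, presheaf_map_comp] at hx hy
      simp only [presheaf_map_comp] at hx hy
      rw [hx, hy]
      rfl
    refine inj (W x ⊓ W y) (TopologicalSpace.Opens.infLELeft (W x) (W y) ≫ j x ≫ i)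
      (fun a => X.presheaf.map (TopologicalSpace.Opens.infLELeft (W x) (W y)).op (c x a) -
        X.presheaf.map (TopologicalSpace.Opens.infLERight (W x) (W y)).op (c y a)) ?_ a
    simp only [sub_smul, Finset.sum_sub_distrib]
    rw [h1, sub_eq_zero]
    rfl
  have hglue : ∀ a, ∃ d : Γ(X, V), ∀ x, X.presheaf.map (j x).op d = c x a := fun a =>
    (TopCat.Sheaf.existsUnique_gluing' X.sheaf W V j hcov (fun x => c x a) (hcompat a)).exists
  choose d hd using hglue
  have ht : t = ∑ a, d a • M.presheaf.map i.op (e a) := by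
    refine eq_of_local fun x hx => ⟨W ⟨x, hx⟩, j ⟨x, hx⟩, hxW ⟨x, hx⟩, ?_⟩
    rw [← hc, presheaf_map_sum]
    refine Finset.sum_congr rfl fun a _ => ?_
    rw [presheaf_map_comp]
    congr 1
    exact (hd a _).symm
  rw [ht]
  exact sum_mem fun a _ => Submodule.smul_mem _ _ (Submodule.subset_span ⟨a, rfl⟩)

/-- The transport of a basis along a semilinear equivalence. -/
def basisOfSemilinear {I R R' P P' : Type*} [CommRing R] [CommRing R'] [AddCommGroup P]
    [AddCommGroup P'] [Module R P] [Module R' P'] (b : Module.Basis I R P) (σ : R ≃+* R')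
    (f : P ≃+ P') (hf : ∀ (r : R) x, f (r • x) = σ r • f x) : Module.Basis I R' P' :=
  letI : Module R' P := Module.compHom P (σ.symm : R' →+* R)
  have h : ∀ (c : R) (x : P), σ c • x = c • x := fun c x =>
    congrArg (· • x) (σ.symm_apply_apply c)
  (b.mapCoeffs σ h).map
    { f with
      map_smul' := fun r x => by
        obtain ⟨c, rfl⟩ := σ.surjective r
        show f (σ c • x) = σ c • f x
        rw [h, hf] }

lemma basisOfSemilinear_apply {I R R' P P' : Type*} [CommRing R] [CommRing R'] [AddCommGroup P]
    [AddCommGroup P'] [Module R P] [Module R' P'] (b : Module.Basis I R P) (σ : R ≃+* R')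
    (f : P ≃+ P') (hf : ∀ (r : R) x, f (r • x) = σ r • f x) (a : I) :
    basisOfSemilinear b σ f hf a = f (b a) := by
  let _ : Module R' P := Module.compHom P (σ.symm : R' →+* R)
  refine (Module.Basis.map_apply _ _ _).trans ?_
  exact congrArg f (Module.Basis.mapCoeffs_apply _ _ _ a)

/-! ### Morphisms over an open subset -/

/-- The inclusion of the image of an open subset of `U`. -/
def imageHom (U : X.Opens) (V : U.toScheme.Opens) : U.ι ''ᵁ V ⟶ U :=
  homOfLE (by rintro _ ⟨y, _, rfl⟩; exact y.2)

/-- The restriction of modules to the open subscheme `U`. -/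
abbrev restr (M : X.Modules) (U : X.Opens) : U.toScheme.Modules :=
  (Scheme.Modules.restrictFunctor U.ι).obj M

/-- The sections of the restriction of `M` to `U`. -/
def restrEquiv (M : X.Modules) (U : X.Opens) (V : U.toScheme.Opens) :
    Γ(M, U.ι ''ᵁ V) ≃+ Γ(restr M U, V) :=
  (M.restrictAppIso U.ι V).symm.addCommGroupIsoToAddEquiv

lemma restrEquiv_smul (M : X.Modules) (U : X.Opens) (V : U.toScheme.Opens)
    (r : Γ(X, U.ι ''ᵁ V)) (x : Γ(M, U.ι ''ᵁ V)) :
    restrEquiv M U V (r • x) =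
      (U.ι.appIso V).commRingCatIsoToRingEquiv r • restrEquiv M U V x :=
  ConcreteCategory.congr_hom (Scheme.Modules.smul_restrictAppIso_inv U.ι M V r) x

lemma restrEquiv_map (M : X.Modules) (U : X.Opens) {V W : U.toScheme.Opens} (i : W ⟶ V)
    (x : Γ(M, U.ι ''ᵁ V)) : (restr M U).presheaf.map i.op (restrEquiv M U V x) =
      restrEquiv M U W
        (M.presheaf.map (homOfLE (Scheme.Hom.image_mono U.ι (leOfHom i))).op x) :=
  ConcreteCategory.congr_hom (Scheme.Modules.restrictAppIso_inv_map U.ι M i.op) x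

/-- The restriction of a section over `U` to a section of the restricted module. -/
def secRestr {U : X.Opens} (s : Γ(M, U)) (V : U.toScheme.Opens) : Γ(restr M U, V) :=
  restrEquiv M U V (M.presheaf.map (imageHom U V).op s)

/-- The restriction of sections over `U` to sections of the restricted module, as an additive
map. -/
def secRestrHom (M : X.Modules) (U : X.Opens) (V : U.toScheme.Opens) :
    Γ(M, U) →+ Γ(restr M U, V) :=
  (restrEquiv M U V).toAddMonoidHom.comp (M.presheaf.map (imageHom U V).op).hom

/-- The morphism `g` over `U` maps the section `s` over `U` to the section `t` over `U`. -/
def Sends (g : restr M U ⟶ restr N U) (s : Γ(M, U)) (t : Γ(N, U)) : Prop :=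
  ∀ V : U.toScheme.Opens, g.app V (secRestr s V) = secRestr t V

lemma sends_restr (f : M ⟶ N) (s : Γ(M, U)) :
    Sends ((Scheme.Modules.restrictFunctor U.ι).map f) s (f.app U s) := fun V =>
  app_presheaf_map f (imageHom U V) s

lemma sends_id (s : Γ(M, U)) : Sends (𝟙 (restr M U)) s s := fun _ => rfl

lemma Sends.comp {g : restr M U ⟶ restr N U} {h : restr N U ⟶ restr L U} {s : Γ(M, U)}
    {t : Γ(N, U)} {r : Γ(L, U)} (hg : Sends g s t) (hh : Sends h t r) : Sends (g ≫ h) s r :=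
  fun V => (congrArg (h.app V) (hg V)).trans (hh V)

lemma Sends.add {g h : restr M U ⟶ restr N U} {s : Γ(M, U)} {t r : Γ(N, U)} (hg : Sends g s t)
    (hh : Sends h s r) : Sends (g + h) s (t + r) := fun V =>
  (congrArg₂ (· + ·) (hg V) (hh V)).trans (map_add (secRestrHom N U V) t r).symm

lemma secRestr_smul (a : Γ(X, U)) (s : Γ(M, U)) (V : U.toScheme.Opens) :
    secRestr (a • s) V =
      (U.ι.appIso V).commRingCatIsoToRingEquiv (X.presheaf.map (imageHom U V).op a) •
        secRestr s V := by
  rw [secRestr, Scheme.Modules.map_smul, restrEquiv_smul, secRestr]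

lemma Sends.sum {g : restr M U ⟶ restr N U} {s : I → Γ(M, U)} {t : I → Γ(N, U)}
    (h : ∀ a, Sends g (s a) (t a)) (S : Finset I) :
    Sends g (∑ a ∈ S, s a) (∑ a ∈ S, t a) := fun V => by
  show (g.app V).hom (secRestrHom M U V _) = secRestrHom N U V _
  rw [map_sum, map_sum, map_sum]
  exact Finset.sum_congr rfl fun a _ => h a V

lemma Sends.congr {g : restr M U ⟶ restr N U} {s : Γ(M, U)} {t t' : Γ(N, U)} (h : Sends g s t)
    (e : t = t') : Sends g s t' := e ▸ h

lemma Sends.smul {g : restr M U ⟶ restr N U} {s : Γ(M, U)} {t : Γ(N, U)} (h : Sends g s t)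
    (a : Γ(X, U)) : Sends g (a • s) (a • t) := fun V => by
  rw [secRestr_smul, secRestr_smul, Scheme.Modules.Hom.app_smul, h V]

lemma secRestr_map (s : Γ(M, U)) {V W : U.toScheme.Opens} (i : W ⟶ V) :
    (restr M U).presheaf.map i.op (secRestr s V) = secRestr s W := by
  rw [secRestr, restrEquiv_map, presheaf_map_comp, secRestr]
  rfl

/-- The basis over `V` of the restricted module given by a frame. -/
def IsFrame.basisRestr (he : IsFrame e) (V : U.toScheme.Opens) :
    Module.Basis I Γ(U, V) Γ(restr M U, V) :=
  basisOfSemilinear (he.basis (imageHom U V)) (U.ι.appIso V).commRingCatIsoToRingEquiv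
    (restrEquiv M U V) (restrEquiv_smul M U V)

lemma IsFrame.basisRestr_apply (he : IsFrame e) (V : U.toScheme.Opens) (a : I) :
    he.basisRestr V a = secRestr (e a) V := by
  rw [basisRestr, basisOfSemilinear_apply, he.basis_apply, secRestr]

lemma IsFrame.restr (he : IsFrame e) : IsFrame (M := restr M U) (U := ⊤) fun a =>
    secRestr (e a) ⊤ := fun V i => by
  have h : (fun a => (CrysPoincare.restr M U).presheaf.map i.op (secRestr (e a) ⊤)) =
      he.basisRestr V := funext fun a => by rw [secRestr_map, he.basisRestr_apply]
  rw [h]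
  exact ⟨(he.basisRestr V).linearIndependent, (he.basisRestr V).span_eq.ge⟩

/-- Morphisms which agree on a global frame are equal. -/
lemma IsFrame.hom_ext_top {e : I → Γ(M, ⊤)} (he : IsFrame e) {g h : M ⟶ N}
    (H : ∀ a, g.app ⊤ (e a) = h.app ⊤ (e a)) : g = h := by
  refine Scheme.Modules.hom_ext _ _ fun V => ?_
  ext s
  have hs : s ∈ Submodule.span Γ(X, V) (Set.range (he.basis (homOfLE (le_top : V ≤ ⊤)))) := by
    rw [Module.Basis.span_eq]; trivial
  induction hs using Submodule.span_induction with
  | mem s hs =>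
    obtain ⟨a, rfl⟩ := hs
    rw [he.basis_apply]
    exact (app_presheaf_map g _ _).trans
      ((congrArg _ (H a)).trans (app_presheaf_map h _ _).symm)
  | zero => rw [map_zero, map_zero]
  | add s t _ _ hs ht => rw [map_add, map_add, hs, ht]
  | smul a s _ hs =>
    exact (Scheme.Modules.Hom.app_smul g a s).trans
      ((congrArg (a • ·) hs).trans (Scheme.Modules.Hom.app_smul h a s).symm)

/-- The morphism with prescribed values on a global frame. -/
def IsFrame.homTop {e : I → Γ(M, ⊤)} (he : IsFrame e) (t : I → Γ(N, ⊤)) : M ⟶ N :=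
  homMk (fun V => (he.basis (homOfLE (le_top : V ≤ ⊤))).constr ℕ fun a =>
      N.presheaf.map (homOfLE (le_top : V ≤ ⊤)).op (t a))
    fun V W i s => by
      have hs : s ∈ Submodule.span Γ(X, V) (Set.range (he.basis (homOfLE (le_top : V ≤ ⊤)))) := by
        rw [Module.Basis.span_eq]; trivial
      induction hs using Submodule.span_induction with
      | mem s hs =>
        obtain ⟨a, rfl⟩ := hs
        rw [Module.Basis.constr_basis, he.basis_apply, presheaf_map_comp, presheaf_map_comp]
        exact (congrArg _ (he.basis_apply (homOfLE (le_top : W ≤ ⊤)) a).symm).trans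
          (Module.Basis.constr_basis _ _ _ _)
      | zero => simp only [map_zero]
      | add s t _ _ hs ht => simp only [map_add, hs, ht]
      | smul a s _ hs =>
        rw [Scheme.Modules.map_smul, map_smul, map_smul, Scheme.Modules.map_smul, hs]

lemma IsFrame.homTop_app {e : I → Γ(M, ⊤)} (he : IsFrame e) (t : I → Γ(N, ⊤)) (V : X.Opens)
    (a : I) : (he.homTop t).app V (M.presheaf.map (homOfLE (le_top : V ≤ ⊤)).op (e a)) =
      N.presheaf.map (homOfLE (le_top : V ≤ ⊤)).op (t a) := by
  rw [← he.basis_apply]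
  exact (he.basis (homOfLE (le_top : V ≤ ⊤))).constr_basis ℕ
    (fun a => N.presheaf.map (homOfLE (le_top : V ≤ ⊤)).op (t a)) a

lemma IsFrame.homTop_app_top {e : I → Γ(M, ⊤)} (he : IsFrame e) (t : I → Γ(N, ⊤)) (a : I) :
    (he.homTop t).app ⊤ (e a) = t a := by
  have := he.homTop_app t ⊤ a
  rwa [presheaf_map_id, presheaf_map_id] at this

/-- Morphisms over `U` which agree on a frame are equal. -/
lemma IsFrame.hom_ext (he : IsFrame e) {g h : CrysPoincare.restr M U ⟶ CrysPoincare.restr N U}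
    {t : I → Γ(N, U)} (hg : ∀ a, Sends g (e a) (t a)) (hh : ∀ a, Sends h (e a) (t a)) : g = h :=
  he.restr.hom_ext_top fun a => (hg a ⊤).trans (hh a ⊤).symm

/-- The morphism over `U` with prescribed values on a frame. -/
def IsFrame.hom (he : IsFrame e) (t : I → Γ(N, U)) :
    CrysPoincare.restr M U ⟶ CrysPoincare.restr N U :=
  he.restr.homTop fun a => secRestr (t a) ⊤

lemma IsFrame.sends_hom (he : IsFrame e) (t : I → Γ(N, U)) (a : I) : Sends (he.hom t) (e a) (t a) :=
  fun V => by
    have := he.restr.homTop_app (N := CrysPoincare.restr N U) (fun a => secRestr (t a) ⊤) V a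
    rwa [secRestr_map, secRestr_map] at this

/-- A module with a global frame is free. -/
def IsFrame.isColimit {I : Type} {e : I → Γ(M, ⊤)} (he : IsFrame e) :
    IsColimit (Cofan.mk (f := fun _ : I => structureSheaf X) M fun a => ofSec (e a)) :=
  Cofan.IsColimit.mk _ (fun s => he.homTop fun a => (s.inj a).app ⊤ (oneSec X))
    (fun s a => structureSheaf_hom_ext (by
      show (he.homTop _).app ⊤ ((ofSec (e a)).app ⊤ (oneSec X)) = _
      rw [ofSec_oneSec, he.homTop_app_top]))
    fun s f hf => he.hom_ext_top fun a => by
      rw [he.homTop_app_top, ← hf a]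
      show _ = f.app ⊤ ((ofSec (e a)).app ⊤ (oneSec X))
      rw [ofSec_oneSec]

/-- The isomorphism with a free module given by a global frame. -/
def IsFrame.freeIso {I : Type} {e : I → Γ(M, ⊤)} (he : IsFrame e) :
    (SheafOfModules.free I : X.Modules) ≅ M :=
  (SheafOfModules.isColimitFreeCofan (R := X.ringCatSheaf) I).coconePointUniqueUpToIso he.isColimit

lemma sends_of_basis {M N : X.Modules} {U : X.Opens} {P I : Type*} [AddCommGroup P]
    [Module Γ(X, U) P] [Fintype I] (b : Module.Basis I Γ(X, U) P) (θ : P →ₗ[Γ(X, U)] Γ(M, U))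
    (f : P →ₗ[Γ(X, U)] Γ(N, U)) {g : restr M U ⟶ restr N U}
    (h : ∀ q, Sends g (θ (b q)) (f (b q))) (y : P) : Sends g (θ y) (f y) := by
  rw [← b.sum_repr y, map_sum, map_sum]
  refine Sends.sum (fun q => ?_) _
  rw [map_smul, map_smul]
  exact (h q).smul _

end Frames

end
end CrysPoincare

namespace CrysPoincare

noncomputable section

/-! ### Local freeness and finite presentation -/

section FreeSheaves

universe u v₁ u₁ v₂ u₂

open SheafOfModules

variable {C : Type u₁} [Category.{v₁} C] {J : GrothendieckTopology C} {R : Sheaf J RingCat.{u}}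
  [HasSheafify J AddCommGrpCat.{u}] [J.WEqualsLocallyBijective AddCommGrpCat.{u}]

/-- The generating sections of a module isomorphic to a free one. -/
def freeGenerators {N : SheafOfModules.{u} R} {I : Type u} (e : free I ≅ N) :
    N.GeneratingSections := (free.generatingSections I).ofEpi e.hom

instance {N : SheafOfModules.{u} R} {I : Type u} (e : free I ≅ N) :
    IsIso (freeGenerators e).π := by
  have h : (freeGenerators e).π = e.hom :=
    (GeneratingSections.ofEpi_π _ _).trans
      ((congrArg (· ≫ e.hom) (free.generatingSections_π I)).trans (Category.id_comp _))
  rw [h]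
  exact Iso.isIso_hom e

lemma isIso_ofEpi_π {N N' : SheafOfModules.{u} R} (G : N.GeneratingSections) [IsIso G.π] (e : N ≅ N') :
    IsIso (G.ofEpi e.hom).π := by
  have h : (G.ofEpi e.hom).π = (asIso G.π ≪≫ e).hom := GeneratingSections.ofEpi_π _ _
  rw [h]
  exact Iso.isIso_hom _

/-- Functors which preserve colimits and the structure sheaf preserve free modules. -/
lemma exists_freeGenerators {C' : Type u₂} [Category.{v₂} C'] {J' : GrothendieckTopology C'}
    {S : Sheaf J' RingCat.{u}} [HasSheafify J' AddCommGrpCat] [J'.WEqualsLocallyBijective AddCommGrpCat]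
    (F : SheafOfModules.{u} R ⥤ SheafOfModules.{u} S) [PreservesColimitsOfSize.{u, u} F]
    (η : unit S ≅ F.obj (unit R)) {N : SheafOfModules.{u} R} {N' : SheafOfModules.{u} S}
    {I : Type u} (e : free I ≅ N) (e' : F.obj N ≅ N') :
    ∃ G : N'.GeneratingSections, IsIso G.π :=
  ⟨((freeGenerators e).map F η).ofEpi e'.hom, isIso_ofEpi_π _ e'⟩

/-- A presentation of the cokernel of a morphism between free modules. -/
lemma exists_presentation {N₁ N₂ N : SheafOfModules.{u} R} {I₁ I₂ : Type u} [Finite I₁] [Finite I₂]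
    (e₁ : free I₁ ≅ N₁) (e₂ : free I₂ ≅ N₂) (f : N₁ ⟶ N₂) (e : cokernel f ≅ N) :
    ∃ P : N.Presentation, P.IsFinite := by
  let f' : free I₁ ⟶ free I₂ := e₁.hom ≫ f ≫ e₂.inv
  let P := presentationOfIsCokernelFree f' (cokernel.π f') (cokernel.condition f')
    (cokernelIsCokernel f')
  have hP : P.IsFinite := ⟨⟨inferInstanceAs (Finite I₂)⟩, ⟨inferInstanceAs (Finite I₁)⟩⟩
  let i : cokernel f' ≅ cokernel f := cokernel.mapIso _ _ e₁ e₂ (by simp [f'])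
  exact ⟨P.ofIsIso (i ≪≫ e).hom, inferInstance⟩

end FreeSheaves

section Coherence

open Opposite

variable {X : Scheme.{0}} {M N : X.Modules}

/-- The inverse of `overEquiv`, as a functor between categories of sheaves of modules. -/
def overInverse (U : X.Opens) : SheafOfModules.{0} U.toScheme.ringCatSheaf ⥤
    SheafOfModules.{0} (X.ringCatSheaf.over U) := (Scheme.Modules.overEquiv U).inverse

/-- The equivalence between modules over the open subscheme `U` and over the slice site maps the
structure sheaf to the structure sheaf. -/
def unitOverIso (U : X.Opens) : SheafOfModules.unit (X.ringCatSheaf.over U) ≅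
    (overInverse U).obj (SheafOfModules.unit U.toScheme.ringCatSheaf) :=
  (Scheme.Modules.overEquiv U).unitIso.app _ ≪≫ (Scheme.Modules.overEquiv U).inverse.mapIso
    ((Scheme.Modules.overFunctorEquiv U).app (SheafOfModules.unit X.ringCatSheaf) ≪≫
      Scheme.Modules.restrictUnitIso U.ι)

/-- The restriction to the open subscheme `U` corresponds to the restriction to the slice site. -/
def restrOverIso (M : X.Modules) (U : X.Opens) :
    (overInverse U).obj (restr M U) ≅ SheafOfModules.over (R := X.ringCatSheaf) M U :=
  (overInverse U).mapIso ((Scheme.Modules.overFunctorEquiv U).app M).symm ≪≫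
    ((Scheme.Modules.overEquiv U).unitIso.app _).symm

instance (U : X.Opens) : PreservesColimitsOfSize.{0, 0} (overInverse U) :=
  (Scheme.Modules.overEquiv U).symm.toAdjunction.leftAdjoint_preservesColimits

lemma coversTop_of_mem {I : Type*} (U : I → X.Opens) (hU : ∀ x, ∃ i, x ∈ U i) :
    (Opens.grothendieckTopology X).CoversTop U := by
  rw [Opens.coversTop_iff]
  exact TopologicalSpace.IsOpenCover.mk (by
    ext x; simpa using hU x)

/-- A module with local frames is locally free. -/
lemma isLocallyFree_of_frames (M : X.Modules)
    (h : ∀ x : X, ∃ U : X.Opens, x ∈ U ∧ ∃ (I : Type) (e : I → Γ(M, U)), IsFrame e) :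
    SheafOfModules.IsLocallyFree (R := X.ringCatSheaf) M := by
  choose U hxU I e he using h
  choose G hG using fun x => exists_freeGenerators (overInverse (U x)) (unitOverIso (U x))
    (he x).restr.freeIso (restrOverIso M (U x))
  let q : SheafOfModules.LocalGeneratorsData (R := X.ringCatSheaf) M :=
    { I := X
      X := U
      coversTop := coversTop_of_mem U fun x => ⟨x, hxU x⟩
      generators := G }
  have : q.IsLocallyFreeData := ⟨hG⟩
  exact q.isLocallyFree

/-- Finite presentation can be checked on an open cover, over which the open subschemes and the
slice sites have the same modules. -/
lemma isFinitePresentation_of_local (M : X.Modules)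
    (h : ∀ x : X, ∃ U : X.Opens, x ∈ U ∧ ∃ P : SheafOfModules.Presentation
      (R := U.toScheme.ringCatSheaf) (restr M U), P.IsFinite) :
    SheafOfModules.IsFinitePresentation (R := X.ringCatSheaf) M := by
  choose U hxU P hP using h
  let Q (x : X) : SheafOfModules.Presentation (R := X.ringCatSheaf.over (U x))
      (SheafOfModules.over (R := X.ringCatSheaf) M (U x)) :=
    ((P x).map (overInverse (U x)) (unitOverIso (U x))).ofIsIso (restrOverIso M (U x)).hom
  have hQ (x : X) : (Q x).IsFinite := by
    have : ((P x).map (overInverse (U x)) (unitOverIso (U x))).IsFinite :=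
      ⟨⟨(hP x).isFiniteType_generators.finite⟩, ⟨(hP x).isFiniteType_relations.finite⟩⟩
    infer_instance
  exact ⟨⟨X, U, coversTop_of_mem U fun x => ⟨x, hxU x⟩, Q⟩, ⟨hQ⟩⟩

/-- A cokernel of a morphism between modules with finite local frames is of finite presentation. -/
lemma isFinitePresentation_cokernel {N₁ N₂ : X.Modules} (f : N₁ ⟶ N₂)
    (h : ∀ x : X, ∃ U : X.Opens, x ∈ U ∧ ∃ (I₁ I₂ : Type) (_ : Finite I₁) (_ : Finite I₂)
      (e₁ : I₁ → Γ(N₁, U)) (e₂ : I₂ → Γ(N₂, U)), IsFrame e₁ ∧ IsFrame e₂) :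
    SheafOfModules.IsFinitePresentation (R := X.ringCatSheaf) (cokernel f) := by
  refine isFinitePresentation_of_local _ fun x => ?_
  obtain ⟨U, hxU, I₁, I₂, _, _, e₁, e₂, h₁, h₂⟩ := h x
  refine ⟨U, hxU, ?_⟩
  exact exists_presentation (R := U.toScheme.ringCatSheaf) h₁.restr.freeIso h₂.restr.freeIso
    ((Scheme.Modules.restrictFunctor U.ι).map f)
    (PreservesCokernel.iso (Scheme.Modules.restrictFunctor U.ι) f).symm

lemma isFinitePresentation_of_frames (M : X.Modules)
    (h : ∀ x : X, ∃ U : X.Opens, x ∈ U ∧ ∃ (I : Type) (_ : Finite I) (e : I → Γ(M, U)),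
      IsFrame e) : SheafOfModules.IsFinitePresentation (R := X.ringCatSheaf) M := by
  refine isFinitePresentation_of_local _ fun x => ?_
  obtain ⟨U, hxU, I, _, e, he⟩ := h x
  refine ⟨U, hxU, ?_⟩
  exact exists_presentation (R := U.toScheme.ringCatSheaf)
    (N₂ := restr M U) (Iso.refl (SheafOfModules.free PEmpty)) he.restr.freeIso
    (Zero.zero (α := (SheafOfModules.free PEmpty : SheafOfModules U.toScheme.ringCatSheaf) ⟶ _))
    (cokernelZeroIsoTarget (C := SheafOfModules U.toScheme.ringCatSheaf))

lemma isFrame_structureSheaf (U : X.Opens) :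
    IsFrame (M := structureSheaf X) (U := U) fun _ : Unit => (1 : Γ(X, U)) := fun V i => by
  have h : (fun _ : Unit => (structureSheaf X).presheaf.map i.op (1 : Γ(X, U))) =
      fun _ => (1 : Γ(X, V)) := funext fun _ => map_one (X.presheaf.map i.op).hom
  have h' : (fun _ : Unit => (1 : Γ(X, V))) = Module.Basis.singleton Unit Γ(X, V) :=
    funext fun _ => by simp
  rw [h, h']
  exact ⟨(Module.Basis.singleton Unit Γ(X, V)).linearIndependent,
    (Module.Basis.singleton Unit Γ(X, V)).span_eq.ge⟩

end Coherence

end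
end CrysPoincare

namespace CrysPoincare

noncomputable section

/-! ### Frames of the sheaves of forms and of principal parts -/

section SheafFrames

open Opposite

variable {X : Scheme.{0}}

/-- Sections of a presheaf with the same image in the associated sheaf agree locally. -/
lemma eq_of_toSheafify_eq (F : TopCat.Presheaf Ab X) {U : X.Opens} (y z : F.obj (op U))
    (h : (CategoryTheory.toSheafify (Opens.grothendieckTopology X) F).app (op U) y =
      (CategoryTheory.toSheafify (Opens.grothendieckTopology X) F).app (op U) z) :
    ∀ x ∈ U, ∃ (V : X.Opens) (i : V ⟶ U), x ∈ V ∧ F.map i.op y = F.map i.op z := by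
  intro x hx
  obtain ⟨V, i, hi, hxV⟩ := Presheaf.equalizerSieve_mem (Opens.grothendieckTopology X)
    (CategoryTheory.toSheafify (Opens.grothendieckTopology X) F) y z h x hx
  exact ⟨V, i, hxV, hi⟩

/-- Let `τ : P ⟶ N` be a locally bijective morphism from a presheaf of modules to a sheaf of
modules. If a family of sections of `P` becomes locally a basis of `P`, then its image is a frame
of `N`. -/
lemma isFrame_of_presheaf {N : X.Modules} {P : X.Opens → Type} [∀ V, AddCommGroup (P V)]
    [∀ V, Module Γ(X, V) (P V)] (res : ∀ {U V : X.Opens}, (V ⟶ U) → P U →+ P V)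
    (res_comp : ∀ {U V W : X.Opens} (i : V ⟶ U) (j : W ⟶ V) y, res (j ≫ i) y = res j (res i y))
    (res_smul : ∀ {U V : X.Opens} (i : V ⟶ U) (a : Γ(X, U)) y,
      res i (a • y) = X.presheaf.map i.op a • res i y)
    (τ : ∀ V, P V →ₗ[Γ(X, V)] Γ(N, V))
    (τ_res : ∀ {U V : X.Opens} (i : V ⟶ U) y, τ V (res i y) = N.presheaf.map i.op (τ U y))
    (inj : ∀ (U : X.Opens) (y : P U), τ U y = 0 → ∀ x ∈ U, ∃ (V : X.Opens) (i : V ⟶ U), x ∈ V ∧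
      res i y = 0)
    (surj : ∀ (U : X.Opens) (s : Γ(N, U)), ∀ x ∈ U, ∃ (V : X.Opens) (i : V ⟶ U), x ∈ V ∧
      ∃ y, τ V y = N.presheaf.map i.op s)
    {U : X.Opens} {I : Type*} [Finite I] (e : I → P U)
    (he : ∀ (V : X.Opens) (i : V ⟶ U), ∀ x ∈ V, ∃ (W : X.Opens) (j : W ⟶ V), x ∈ W ∧
      ∃ b : Module.Basis I Γ(X, W) (P W), ∀ a, b a = res (j ≫ i) (e a)) :
    IsFrame fun a => τ U (e a) := by
  have := Fintype.ofFinite I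
  refine isFrame_of_local (fun V i c hc x hx => ?_) fun V i t x hx => ?_
  · have h0 : τ V (∑ a, c a • res i (e a)) = 0 := by
      rw [map_sum, ← hc]
      exact Finset.sum_congr rfl fun a _ => by rw [map_smul, τ_res]
    obtain ⟨W₁, j₁, hx₁, h₁⟩ := inj V _ h0 x hx
    obtain ⟨W, j, hxW, b, hb⟩ := he W₁ (j₁ ≫ i) x hx₁
    refine ⟨W, j ≫ j₁, hxW, fun a => ?_⟩
    have h2 : ∑ a, X.presheaf.map (j ≫ j₁).op (c a) • b a = 0 := by
      rw [← map_zero (res j), ← h₁, ← res_comp, map_sum]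
      refine Finset.sum_congr rfl fun a _ => ?_
      rw [res_smul, hb, ← res_comp, Category.assoc]
    exact Fintype.linearIndependent_iff.1 b.linearIndependent _ h2 a
  · obtain ⟨W₁, j₁, hx₁, y, hy⟩ := surj V t x hx
    obtain ⟨W, j, hxW, b, hb⟩ := he W₁ (j₁ ≫ i) x hx₁
    refine ⟨W, j ≫ j₁, hxW, fun a => b.repr (res j y) a, ?_⟩
    have h := congrArg (τ W) (b.sum_repr (res j y))
    rw [τ_res, hy, presheaf_map_comp, map_sum] at h
    rw [← h]
    refine Finset.sum_congr rfl fun a _ => ?_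
    rw [map_smul, hb, τ_res, Category.assoc]

variable [X.Over (Spec (CommRingCat.of ℂ))]

lemma toOmega_eq_zero_local {p : ℕ} {U : X.Opens} (y : ⋀[Γ(X, U)]^p Ω[Γ(X, U)⁄ℂ])
    (h : toOmega p U y = 0) : ∀ x ∈ U, ∃ (V : X.Opens) (i : V ⟶ U), x ∈ V ∧
      formResDeg (resFun i) p y = 0 := by
  intro x hx
  obtain ⟨V, i, hxV, hi⟩ := eq_of_toSheafify_eq (omegaPresheafAb X p) (U := U) y 0
    (h.trans (map_zero (toOmega p U)).symm) x hx
  exact ⟨V, i, hxV, hi.trans (map_zero (formResDeg (resFun i) p))⟩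

lemma toJet_eq_zero_local {m : ℕ} {M : X.Modules} {U : X.Opens}
    (y : PrincipalParts ℂ Γ(X, U) Γ(M, U) m) (h : toJet m M U y = 0) :
    ∀ x ∈ U, ∃ (V : X.Opens) (i : V ⟶ U), x ∈ V ∧ jetRes m M i y = 0 := by
  intro x hx
  obtain ⟨V, i, hxV, hi⟩ := eq_of_toSheafify_eq (jetPresheafAb m M) (U := U) y 0
    (h.trans (map_zero (toJet m M U)).symm) x hx
  exact ⟨V, i, hxV, hi.trans (map_zero (jetRes m M i))⟩

lemma toJet_local {m : ℕ} {M : X.Modules} {U : X.Opens} (s : Γ(jet m M, U)) :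
    ∀ x ∈ U, ∃ (V : X.Opens) (i : V ⟶ U), x ∈ V ∧ ∃ y : PrincipalParts ℂ Γ(X, V) Γ(M, V) m,
      toJet m M V y = (jet m M).presheaf.map i.op s := by
  have h : TopCat.Presheaf.IsLocallySurjective (CategoryTheory.toSheafify
    (Opens.grothendieckTopology X) (jetPresheafAb m M)) :=
    inferInstanceAs (Presheaf.IsLocallySurjective _ _)
  intro x hx
  obtain ⟨V, i, ⟨y, hy⟩, hxV⟩ := (TopCat.Presheaf.isLocallySurjective_iff _).1 h U s x hx
  exact ⟨V, homOfLE i, hxV, y, hy⟩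

/-- The coordinates restrict to coordinates on arbitrarily small neighbourhoods of every point. -/
def Coords.IsLocal {U : X.Opens} {n : ℕ} (c : Coords ℂ Γ(X, U) n) : Prop :=
  ∀ (V : X.Opens) (i : V ⟶ U), ∀ x ∈ V, ∃ (W : X.Opens) (j : W ⟶ V), x ∈ W ∧
    ∃ c' : Coords ℂ Γ(X, W) n, ∀ a, c'.x a = resFun (j ≫ i) (c.x a)

variable {U V : X.Opens} {n : ℕ} {c : Coords ℂ Γ(X, U) n} {c' : Coords ℂ Γ(X, V) n}

lemma Coords.formBasis_res {i : V ⟶ U} (h : ∀ a, c'.x a = resFun i (c.x a)) (p : ℕ)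
    (J : Set.powersetCard (Fin n) p) :
    c'.formBasis p J = formResDeg (resFun i) p (c.formBasis p J) := by
  refine Subtype.ext ?_
  show _ = formRes (resFun i) _
  rw [formBasis_coe, formBasis_coe, map_list_prod, List.map_ofFn]
  congr 2
  funext a
  show _ = formRes (resFun i) _
  rw [formRes_dForm, h]

lemma Coords.jetMono_res {M : X.Modules} {i : V ⟶ U} (h : ∀ a, c'.x a = resFun i (c.x a)) (m : ℕ)
    (s : Γ(M, U)) (α : Fin n →₀ ℕ) :
    c'.jetMono m (M.presheaf.map i.op s) α = jetRes m M i (c.jetMono m s α) := by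
  have h1 : ∀ t : Γ(X, U) ⊗[ℂ] Γ(X, U), ppResAux (resFun i) (resMod M i) (act ℂ Γ(X, U) s t) =
      act ℂ Γ(X, V) (resMod M i s) (Algebra.TensorProduct.map (resFun i) (resFun i) t) := fun t => by
    induction t using TensorProduct.induction_on with
    | zero => simp
    | tmul a b => simp [ppResAux, resMod_smul]
    | add s t hs ht => simp only [map_add, hs, ht]
  have h2 : Algebra.TensorProduct.map (resFun i) (resFun i) (c.ξPow α) = c'.ξPow α := by
    rw [ξPow, ξPow, MvPolynomial.aeval_monomial, MvPolynomial.aeval_monomial, map_one, map_one,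
      one_mul, one_mul, map_finsuppProd]
    refine Finsupp.prod_congr fun a _ => ?_
    rw [map_pow, ξ, ξ, map_sub, h]
    simp
  have h3 := h1 (c.ξPow α)
  rw [h2] at h3
  have h4 : jetRes m M i (c.jetMono m s α) = (filt ℂ Γ(X, V) Γ(M, V) (m + 1)).mkQ
    (ppResAux (resFun i) (resMod M i) (act ℂ Γ(X, U) s (c.ξPow α))) := rfl
  rw [h4, h3]
  rfl

/-- The products of the `d x i` form a frame of the sheaf of forms. -/
lemma Coords.isFrame_omega (hc : c.IsLocal) (p : ℕ) :
    IsFrame fun J : Set.powersetCard (Fin n) p => toOmega p U (c.formBasis p J) := by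
  refine isFrame_of_presheaf (N := omega X p) (P := fun V => ⋀[Γ(X, V)]^p Ω[Γ(X, V)⁄ℂ])
    (fun i => formResDeg (resFun i) p)
    (fun i j y => formResDeg_comp (resFun i) p y (resFun j) (resFun (j ≫ i)) (resFun_comp i j))
    (fun i a y => formResDeg_smul (resFun i) p a y) (toOmega p) (fun i y => toOmega_res p i y)
    (fun U y h => toOmega_eq_zero_local y h) (fun U s => toOmega_local s) _ fun V i x hx => ?_
  obtain ⟨W, j, hxW, c', h⟩ := hc V i x hx
  exact ⟨W, j, hxW, c'.formBasis p, fun a => Coords.formBasis_res h p a⟩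

/-- The monomials in the `ξ i` times the elements of a frame of `M` form a frame of the principal
parts of `M`. -/
lemma Coords.isFrame_jet (hc : c.IsLocal) {M : X.Modules} {J : Type*} [Finite J] {b : J → Γ(M, U)}
    (hb : IsFrame b) (m : ℕ) :
    IsFrame fun q : JetIndex n m × J => toJet m M U (c.jetMono m (b q.2) q.1.1) := by
  have loc : ∀ (V : X.Opens) (i : V ⟶ U), ∀ x ∈ V, ∃ (W : X.Opens) (j : W ⟶ V), x ∈ W ∧
      ∃ b' : Module.Basis (JetIndex n m × J) Γ(X, W) (PrincipalParts ℂ Γ(X, W) Γ(M, W) m),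
        ∀ q, b' q = jetRes m M (j ≫ i) (c.jetMono m (b q.2) q.1.1) := fun V i x hx => by
    obtain ⟨W, j, hxW, c', h⟩ := hc V i x hx
    refine ⟨W, j, hxW, c'.jetBasis (hb.basis (j ≫ i)) m, fun q => ?_⟩
    rw [jetBasis_apply, hb.basis_apply]
    exact Coords.jetMono_res h m _ _
  have key := isFrame_of_presheaf (N := jet m M) (P := fun V => PrincipalParts ℂ Γ(X, V) Γ(M, V) m)
    (fun i => (jetRes m M i).toAddMonoidHom) (fun i j y => jetRes_comp m M i j y)
    (fun i a y => ppRes_smul m (resFun i) (resMod M i) (resMod_smul M i) a y) (toJet m M)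
    (fun i y => toJet_res m M i y)
    (fun U y h => toJet_eq_zero_local y h) (fun U s => toJet_local s)
    (fun q : JetIndex n m × J => c.jetMono m (b q.2) q.1.1)
  exact key loc

end SheafFrames

end
end CrysPoincare

namespace CrysPoincare

noncomputable section

/-! ### The local contraction of the linearized de Rham complex -/

section LocalContraction

open Opposite

variable {X : Scheme.{0}} [X.Over (Spec (CommRingCat.of ℂ))]

variable (X) in
/-- The differential `P^{m+1} ⊗ Ωᵖ ⟶ P^m ⊗ Ωᵖ⁺¹`. -/
def levelD (m p : ℕ) : jet (m + 1) (omega X p) ⟶ jet m (omega X (p + 1)) :=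
  jetMap (deriv X p) ((deriv_isDiffOp p).compat m)

/-- The transition map `P^n ⊗ M ⟶ P^m ⊗ M` for `m ≤ n`. -/
def levelT (M : X.Modules) {m n : ℕ} (h : m ≤ n) : jet n M ⟶ jet m M :=
  jetMap (.ofHom (𝟙 M)) (LinMap.compat_ofHom _ h)

variable (X) in
/-- The augmentation `𝒪 ⟶ P^m ⊗ Ω⁰`. -/
def levelAug (m : ℕ) : structureSheaf X ⟶ jet m (omega X 0) :=
  ofSec ((jetUniv m (omega X 0)).app ⊤ (oneForm X))

lemma levelT_refl (M : X.Modules) (m : ℕ) : levelT M (le_refl m) = 𝟙 _ :=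
  (jetFunctor X m).map_id M

lemma levelT_trans (M : X.Modules) {l m n : ℕ} (h : l ≤ m) (h' : m ≤ n) :
    levelT M h' ≫ levelT M h = levelT M (h.trans h') :=
  (jetMap_comp _ _ _ _).trans (jetMap_congr (fun _ _ => rfl) _ _)

lemma levelD_levelT (p : ℕ) {m n : ℕ} (h : m ≤ n) :
    levelD X n p ≫ levelT _ h = levelT _ (Nat.add_le_add_right h 1) ≫ levelD X m p := by
  rw [levelD, levelT, jetMap_comp, levelT, levelD, jetMap_comp]
  exact jetMap_congr (fun _ _ => rfl) _ _

lemma levelAug_levelT {m n : ℕ} (h : m ≤ n) : levelAug X n ≫ levelT _ h = levelAug X m :=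
  (ofSec_comp _ _).trans (congrArg ofSec (jetMap_univ (.ofHom (𝟙 _)) _ ⊤ _))

lemma levelD_levelD (m p : ℕ) : levelD X (m + 1) p ≫ levelD X m (p + 1) = 0 :=
  jetMap_comp_zero _ _ _ _ (deriv_deriv p)

lemma levelAug_levelD (m : ℕ) : levelAug X (m + 1) ≫ levelD X m 0 = 0 :=
  ofSec_jetMap _ _ _ deriv_oneForm

/-- A contraction over `U` of the augmented linearized de Rham complex: operators
`h : P^m ⊗ Ωᵖ⁺¹ ⟶ P^{m+1} ⊗ Ωᵖ` and `c : P^m ⊗ Ω⁰ ⟶ 𝒪` over `U`, compatible with the transition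
maps, such that `dh + hd = 1`. -/
structure LocalContraction (U : X.Opens) where
  h (m p : ℕ) : restr (jet m (omega X (p + 1))) U ⟶ restr (jet (m + 1) (omega X p)) U
  c (m : ℕ) : restr (jet m (omega X 0)) U ⟶ restr (structureSheaf X) U
  aug_c (m : ℕ) : (Scheme.Modules.restrictFunctor U.ι).map (levelAug X m) ≫ c m = 𝟙 _
  c_aug (m : ℕ) : c (m + 1) ≫ (Scheme.Modules.restrictFunctor U.ι).map (levelAug X (m + 1)) +
    (Scheme.Modules.restrictFunctor U.ι).map (levelD X m 0) ≫ h m 0 = 𝟙 _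
  h_d (m p : ℕ) : h (m + 1) p ≫ (Scheme.Modules.restrictFunctor U.ι).map (levelD X (m + 1) p) +
    (Scheme.Modules.restrictFunctor U.ι).map (levelD X m (p + 1)) ≫ h m (p + 1) = 𝟙 _
  t_h {m n : ℕ} (hmn : m ≤ n) (p : ℕ) :
    (Scheme.Modules.restrictFunctor U.ι).map (levelT (omega X (p + 1)) hmn) ≫ h m p =
      h n p ≫ (Scheme.Modules.restrictFunctor U.ι).map
        (levelT (omega X p) (Nat.add_le_add_right hmn 1))
  t_c {m n : ℕ} (hmn : m ≤ n) :
    (Scheme.Modules.restrictFunctor U.ι).map (levelT (omega X 0) hmn) ≫ c m = c n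

/-- Linear maps on principal parts which agree on the elements `1 ⊗ x` are equal. -/
lemma principalParts_hom_ext {k A M P : Type*} [CommRing k] [CommRing A] [Algebra k A]
    [AddCommGroup M] [Module k M] [Module A M] [IsScalarTower k A M] [AddCommGroup P] [Module A P]
    {m : ℕ} {f g : PrincipalParts k A M m →ₗ[A] P}
    (h : ∀ x, f (univOp A m x) = g (univOp A m x)) (y : PrincipalParts k A M m) : f y = g y := by
  induction y using principalParts_induction with
  | h a x => rw [map_smul, map_smul, h]
  | hadd y z hy hz => rw [map_add, map_add, hy, hz]

/-- The linear map on sections over `U` given by a morphism of modules. -/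
def appLin {M N : X.Modules} (f : M ⟶ N) (U : X.Opens) : Γ(M, U) →ₗ[Γ(X, U)] Γ(N, U) where
  toFun := f.app U
  map_add' := map_add (f.app U).hom
  map_smul' := Scheme.Modules.Hom.app_smul f

variable {U : X.Opens} {n : ℕ}

/-- The map from the principal parts of order `m` of `⋀ᵖ Ω_{𝒪(U)}` to the sections of
`P^m ⊗ Ωᵖ` over `U`. -/
def jetForm (m p : ℕ) (U : X.Opens) : PrincipalParts ℂ Γ(X, U) (⋀[Γ(X, U)]^p Ω[Γ(X, U)⁄ℂ]) m
    →ₗ[Γ(X, U)] Γ(jet m (omega X p), U) :=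
  toJet m (omega X p) U ∘ₗ ppMap (m := m) (n := m) ((toOmega p U).restrictScalars ℂ)
    ((IsDiffOp.of_linear (A := Γ(X, U)) (D := (toOmega p U).restrictScalars ℂ)
      (fun a x => (toOmega p U).map_smul a x)).filt_le (m + 1))

lemma jetForm_univOp (m p : ℕ) (x : ⋀[Γ(X, U)]^p Ω[Γ(X, U)⁄ℂ]) :
    jetForm m p U (univOp Γ(X, U) m x) = (jetUniv m (omega X p)).app U (toOmega p U x) := rfl

lemma jetForm_jetMono (c : Coords ℂ Γ(X, U) n) (m p : ℕ) (x : ⋀[Γ(X, U)]^p Ω[Γ(X, U)⁄ℂ])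
    (α : Fin n →₀ ℕ) : jetForm m p U (c.jetMono m x α) =
      toJet m (omega X p) U (c.jetMono m (toOmega p U x) α) := by
  refine congrArg (toJet m (omega X p) U) ?_
  exact congrArg (filt ℂ Γ(X, U) Γ(omega X p, U) (m + 1)).mkQ
    (Coords.baseChange_act (toOmega p U) x (c.ξPow α))

lemma jetForm_jetD (m p : ℕ)
    (y : PrincipalParts ℂ Γ(X, U) (⋀[Γ(X, U)]^p Ω[Γ(X, U)⁄ℂ]) (m + 1)) :
    (levelD X m p).app U (jetForm (m + 1) p U y) = jetForm m (p + 1) U (Coords.jetD m p y) := by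
  refine principalParts_hom_ext (f := appLin (levelD X m p) U ∘ₗ jetForm (m + 1) p U)
    (g := jetForm m (p + 1) U ∘ₗ Coords.jetD m p) (fun x => ?_) y
  exact (jetMap_univ (deriv X p) ((deriv_isDiffOp p).compat m) U (toOmega p U x)).trans
    (congrArg ((jetUniv m (omega X (p + 1))).app U) (deriv_toOmega p U x))

lemma jetForm_jetTrans (m p : ℕ)
    (y : PrincipalParts ℂ Γ(X, U) (⋀[Γ(X, U)]^p Ω[Γ(X, U)⁄ℂ]) (m + 1)) :
    (levelT (omega X p) (Nat.le_succ m)).app U (jetForm (m + 1) p U y) =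
      jetForm m p U (Coords.jetTrans ℂ Γ(X, U) _ m y) := by
  refine principalParts_hom_ext
    (f := appLin (levelT (omega X p) (Nat.le_succ m)) U ∘ₗ jetForm (m + 1) p U)
    (g := jetForm m p U ∘ₗ Coords.jetTrans ℂ Γ(X, U) _ m) (fun x => ?_) y
  exact jetMap_univ (.ofHom (𝟙 (omega X p))) (LinMap.compat_ofHom _ (Nat.le_succ m)) U
    (toOmega p U x)

lemma jetConst_jetTrans {k A : Type*} [CommRing k] [CommRing A] [Algebra k A] (m : ℕ)
    (y : PrincipalParts k A (⋀[A]^0 Ω[A⁄k]) (m + 1)) :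
    Coords.jetConst k A m (Coords.jetTrans k A _ m y) = Coords.jetConst k A (m + 1) y := by
  refine principalParts_hom_ext (f := Coords.jetConst k A m ∘ₗ Coords.jetTrans k A _ m)
    (fun x => ?_) y
  have h : Coords.jetTrans k A _ m (univOp A (m + 1) x) = univOp A m x := rfl
  rw [LinearMap.comp_apply, h, Coords.jetConst, Coords.jetConst, LinearMap.comp_apply,
    LinearMap.comp_apply, ppAug_univOp, ppAug_univOp]

/-- The section `1` of `𝒪` over `U`. -/
def oneSecOn (U : X.Opens) : Γ(structureSheaf X, U) := (1 : Γ(X, U))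

lemma levelAug_oneSecOn (m : ℕ) : (levelAug X m).app U (oneSecOn U) =
    jetForm m 0 U (univOp Γ(X, U) m (Coords.oneForm₀ ℂ Γ(X, U))) := by
  have h1 : (levelAug X m).app U (oneSecOn U) =
      (jet m (omega X 0)).presheaf.map (homOfLE (le_top : U ≤ ⊤)).op
        ((jetUniv m (omega X 0)).app ⊤ (oneForm X)) := one_smul Γ(X, U) _
  have h2 := (jetUniv m (omega X 0)).naturality (homOfLE (le_top : U ≤ ⊤)) (oneForm X)
  have h3 : resMod (omega X 0) (homOfLE (le_top : U ≤ ⊤)) (oneForm X) =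
      toOmega 0 U (Coords.oneForm₀ ℂ Γ(X, U)) := by
    refine (toOmega_res 0 (homOfLE (le_top : U ≤ ⊤)) _).symm.trans (congrArg _ (Subtype.ext ?_))
    exact map_one (formRes (resFun (homOfLE (le_top : U ≤ ⊤))))
  rw [h1, jetForm_univOp, ← h3, h2]
  rfl

section Frame

variable (c : Coords ℂ Γ(X, U) n)

lemma Coords.isFrame_jetForm {c : Coords ℂ Γ(X, U) n} (hc : c.IsLocal) (m p : ℕ) :
    IsFrame fun q => jetForm m p U (c.jetFormBasis m p q) := by
  have h := Coords.isFrame_jet hc (Coords.isFrame_omega hc p) m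
  have e : (fun q => jetForm m p U (c.jetFormBasis m p q)) = fun q =>
      toJet m (omega X p) U (c.jetMono m (toOmega p U (c.formBasis p q.2)) q.1.1) :=
    funext fun q => by rw [c.jetFormBasis_apply, jetForm_jetMono]
  rw [e]
  exact h

variable {c} (hc : c.IsLocal) {N : X.Modules}

/-- The morphism over `U` given by a linear map on principal parts. -/
def jetFormHom (m p : ℕ) (f : PrincipalParts ℂ Γ(X, U) (⋀[Γ(X, U)]^p Ω[Γ(X, U)⁄ℂ]) m
    →ₗ[Γ(X, U)] Γ(N, U)) : restr (jet m (omega X p)) U ⟶ restr N U :=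
  (Coords.isFrame_jetForm hc m p).hom fun q => f (c.jetFormBasis m p q)

lemma sends_jetFormHom (m p : ℕ) (f : PrincipalParts ℂ Γ(X, U) (⋀[Γ(X, U)]^p Ω[Γ(X, U)⁄ℂ]) m
    →ₗ[Γ(X, U)] Γ(N, U)) (y) : Sends (jetFormHom hc m p f) (jetForm m p U y) (f y) := by
  have hf := Fintype.ofFinite (Coords.JetIndex n m × Set.powersetCard (Fin n) p)
  exact sends_of_basis (c.jetFormBasis m p) (jetForm m p U) f
    (fun q => (Coords.isFrame_jetForm hc m p).sends_hom _ q) y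

include hc in
/-- Morphisms from `P^m ⊗ Ωᵖ` over `U` are determined by their effect on the principal parts of the
algebra of functions on `U`. -/
lemma jetForm_hom_ext {m p : ℕ} {g h : restr (jet m (omega X p)) U ⟶ restr N U}
    (f : PrincipalParts ℂ Γ(X, U) (⋀[Γ(X, U)]^p Ω[Γ(X, U)⁄ℂ]) m → Γ(N, U))
    (hg : ∀ y, Sends g (jetForm m p U y) (f y)) (hh : ∀ y, Sends h (jetForm m p U y) (f y)) :
    g = h :=
  (Coords.isFrame_jetForm hc m p).hom_ext (fun _ => hg _) fun _ => hh _

end Frame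

/-- Compatibility with the transition maps can be checked for consecutive orders. -/
lemma comp_levelT_of_succ {M N : X.Modules} {D : Type*} [Category D] (R : X.Modules ⥤ D) (k : ℕ)
    (h : ∀ m, R.obj (jet m M) ⟶ R.obj (jet (m + k) N))
    (H : ∀ m, R.map (levelT M (Nat.le_succ m)) ≫ h m =
      h (m + 1) ≫ R.map (levelT N (Nat.add_le_add_right (Nat.le_succ m) k))) {m n : ℕ}
    (hmn : m ≤ n) : R.map (levelT M hmn) ≫ h m =
      h n ≫ R.map (levelT N (Nat.add_le_add_right hmn k)) := by
  induction n, hmn using Nat.le_induction with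
  | base => rw [levelT_refl, levelT_refl, R.map_id, R.map_id, Category.id_comp, Category.comp_id]
  | succ n hmn ih =>
    rw [← levelT_trans M hmn (Nat.le_succ n), R.map_comp, Category.assoc, ih,
      ← Category.assoc, H, Category.assoc, ← R.map_comp, levelT_trans]

lemma levelT_comp_of_succ {M : X.Modules} {D : Type*} [Category D] (R : X.Modules ⥤ D) {P : D}
    (h : ∀ m, R.obj (jet m M) ⟶ P)
    (H : ∀ m, R.map (levelT M (Nat.le_succ m)) ≫ h m = h (m + 1)) {m n : ℕ}
    (hmn : m ≤ n) : R.map (levelT M hmn) ≫ h m = h n := by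
  induction n, hmn using Nat.le_induction with
  | base => rw [levelT_refl, R.map_id, Category.id_comp]
  | succ n hmn ih =>
    rw [← levelT_trans M hmn (Nat.le_succ n), R.map_comp, Category.assoc, ih, H]

lemma map_smul_add_of_eq {A P Q : Type*} [CommRing A] [AddCommGroup P] [AddCommGroup Q]
    [Module A P] [Module A Q] (θ : P →ₗ[A] Q) {a : A} {x y z : P} (h : a • x + y = z) :
    a • θ x + θ y = θ z := by
  rw [← h, map_add, map_smul]

lemma map_add_of_eq {A P Q : Type*} [CommRing A] [AddCommGroup P] [AddCommGroup Q]
    [Module A P] [Module A Q] (θ : P →ₗ[A] Q) {x y z : P} (h : x + y = z) :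
    θ y + θ x = θ z := by
  rw [← h, map_add, add_comm]

section Contraction

variable {c : Coords ℂ Γ(X, U) n} (hc : c.IsLocal)

/-- The contraction `h` over an open subset with coordinates. -/
def Coords.homotopyHom (m p : ℕ) :
    restr (jet m (omega X (p + 1))) U ⟶ restr (jet (m + 1) (omega X p)) U :=
  jetFormHom hc m (p + 1) (jetForm (m + 1) p U ∘ₗ c.jetHomotopy m p)

lemma Coords.sends_homotopyHom (m p : ℕ) (y) : Sends (Coords.homotopyHom hc m p)
    (jetForm m (p + 1) U y) (jetForm (m + 1) p U (c.jetHomotopy m p y)) :=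
  sends_jetFormHom hc m (p + 1) (jetForm (m + 1) p U ∘ₗ c.jetHomotopy m p) y

/-- The contraction `c` over an open subset with coordinates. -/
def Coords.constHom (m : ℕ) : restr (jet m (omega X 0)) U ⟶ restr (structureSheaf X) U :=
  jetFormHom hc m 0 (LinearMap.toSpanSingleton Γ(X, U) Γ(structureSheaf X, U) (oneSecOn U) ∘ₗ
    Coords.jetConst ℂ Γ(X, U) m)

lemma Coords.sends_constHom (m : ℕ) (y) : Sends (Coords.constHom hc m)
    (jetForm m 0 U y) (Coords.jetConst ℂ Γ(X, U) m y • oneSecOn U) :=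
  sends_jetFormHom hc m 0 (LinearMap.toSpanSingleton Γ(X, U) Γ(structureSheaf X, U) (oneSecOn U) ∘ₗ
    Coords.jetConst ℂ Γ(X, U) m) y

lemma sends_levelD (m p : ℕ) (y) : Sends ((Scheme.Modules.restrictFunctor U.ι).map (levelD X m p))
    (jetForm (m + 1) p U y) (jetForm m (p + 1) U (Coords.jetD m p y)) := by
  rw [← jetForm_jetD]
  exact sends_restr _ _

lemma sends_levelT (m p : ℕ) (y) :
    Sends ((Scheme.Modules.restrictFunctor U.ι).map (levelT (omega X p) (Nat.le_succ m)))
    (jetForm (m + 1) p U y) (jetForm m p U (Coords.jetTrans ℂ Γ(X, U) _ m y)) := by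
  rw [← jetForm_jetTrans]
  exact sends_restr _ _

lemma sends_levelAug (m : ℕ) :
    Sends ((Scheme.Modules.restrictFunctor U.ι).map (levelAug X m)) (oneSecOn U)
      (jetForm m 0 U (univOp Γ(X, U) m (Coords.oneForm₀ ℂ Γ(X, U)))) := by
  rw [← levelAug_oneSecOn]
  exact sends_restr _ _

/-- The contraction over an open subset with coordinates. -/
def Coords.contraction : LocalContraction U where
  h := Coords.homotopyHom hc
  c := Coords.constHom hc
  aug_c m := (isFrame_structureSheaf U).hom_ext (t := fun _ => oneSecOn U)
    (fun _ => by
      have h := (sends_levelAug m).comp (Coords.sends_constHom hc m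
        (univOp Γ(X, U) m (Coords.oneForm₀ ℂ Γ(X, U))))
      rw [Coords.jetConst_univOp, one_smul] at h
      exact h)
    fun _ => sends_id _
  c_aug m := jetForm_hom_ext hc (jetForm (m + 1) 0 U) (fun y => by
      have h1 := (Coords.sends_constHom hc (m + 1) y).comp
        ((sends_levelAug (m + 1)).smul (Coords.jetConst ℂ Γ(X, U) (m + 1) y))
      have h2 := (sends_levelD m 0 y).comp (Coords.sends_homotopyHom hc m 0 (Coords.jetD m 0 y))
      exact (h1.add h2).congr (map_smul_add_of_eq (jetForm (m + 1) 0 U) (c.jetConst_add m y)))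
    fun y => sends_id _
  h_d m p := jetForm_hom_ext hc (jetForm (m + 1) (p + 1) U) (fun y => by
      have h1 := (Coords.sends_homotopyHom hc (m + 1) p y).comp (sends_levelD (m + 1) p _)
      have h2 := (sends_levelD m (p + 1) y).comp
        (Coords.sends_homotopyHom hc m (p + 1) (Coords.jetD m (p + 1) y))
      exact (h1.add h2).congr
        (map_add_of_eq (jetForm (m + 1) (p + 1) U) (c.jetHomotopy_add m p y)))
    fun y => sends_id _
  t_h hmn p := comp_levelT_of_succ (Scheme.Modules.restrictFunctor U.ι) 1
    (fun m => Coords.homotopyHom hc m p)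
    (fun m => jetForm_hom_ext hc _
      (fun y => (sends_levelT m (p + 1) y).comp (Coords.sends_homotopyHom hc m p _))
      fun y => by
        exact ((Coords.sends_homotopyHom hc (m + 1) p y).comp (sends_levelT (m + 1) p _)).congr
          (congrArg (jetForm (m + 1) p U) (c.jetHomotopy_jetTrans m p y).symm)) hmn
  t_c hmn := levelT_comp_of_succ (Scheme.Modules.restrictFunctor U.ι) (Coords.constHom hc)
    (fun m => jetForm_hom_ext hc _ (fun y => (sends_levelT m 0 y).comp (Coords.sends_constHom hc m _))
      fun y => by
        exact (Coords.sends_constHom hc (m + 1) y).congr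
          (congrArg (fun a : Γ(X, U) => a • oneSecOn U) (jetConst_jetTrans m y).symm)) hmn

end Contraction

end LocalContraction

end
end CrysPoincare

namespace CrysPoincare

noncomputable section

/-! ### Local coordinates on smooth schemes -/

section Coordinates

/-- A standard smooth presentation gives coordinates: those variables which are not eliminated by the
equations. -/
lemma exists_coords (k A : Type*) [CommRing k] [CommRing A] [Algebra k A] (n : ℕ)
    [Algebra.IsStandardSmoothOfRelativeDimension n k A] : Nonempty (Coords k A n) := by
  obtain ⟨ι, σ, _, _, P, e⟩ :=
    Algebra.IsStandardSmoothOfRelativeDimension.out (R := k) (S := A) (n := n)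
  let e₀ : Fin n ≃ ((Set.range P.map)ᶜ : Set _) :=
    (Finite.equivFinOfCardEq (by rw [Nat.card_coe_set_eq, Set.ncard_compl,
        Set.ncard_range_of_injective P.map_inj, ← e, Algebra.Presentation.dimension])).symm
  exact ⟨⟨fun i => P.val (e₀ i), P.basisKaehler.reindex e₀.symm, fun i => by simp⟩⟩

/-- Coordinates on `A` are coordinates on every formally étale `A`-algebra. -/
def Coords.formallyEtale {k A : Type*} [CommRing k] [CommRing A] [Algebra k A] {n : ℕ}
    (c : Coords k A n) (B : Type*) [CommRing B] [Algebra k B] [Algebra A B] [IsScalarTower k A B]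
    [Algebra.FormallyEtale A B] : Coords k B n where
  x i := algebraMap A B (c.x i)
  basis := (KaehlerDifferential.isBaseChange_of_formallyEtale k A B).basis c.basis
  basis_eq i := by rw [IsBaseChange.basis_apply, c.basis_eq, KaehlerDifferential.map_D]

variable {X : Scheme.{0}} [X.Over (Spec (CommRingCat.of ℂ))] {U : X.Opens} {n : ℕ}

/-- Coordinates on an affine open restrict to its principal opens. -/
lemma Coords.isLocal_of_isAffineOpen (hU : IsAffineOpen U) (c : Coords ℂ Γ(X, U) n) :
    c.IsLocal := fun V i x hx => by
  obtain ⟨f, hf, hxf⟩ := hU.exists_basicOpen_le ⟨x, hx⟩ (leOfHom i hx)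
  let j : X.basicOpen f ⟶ U := homOfLE (X.basicOpen_le f)
  let _ : Algebra Γ(X, U) Γ(X, X.basicOpen f) := (resFun j).toAlgebra
  have : IsScalarTower ℂ Γ(X, U) Γ(X, X.basicOpen f) :=
    IsScalarTower.of_algebraMap_eq fun a => ((resFun j).commutes a).symm
  have : IsLocalization.Away f Γ(X, X.basicOpen f) := hU.isLocalization_basicOpen f
  have : Algebra.FormallyEtale Γ(X, U) Γ(X, X.basicOpen f) :=
    Algebra.FormallyEtale.of_isLocalization (Submonoid.powers f)
  exact ⟨X.basicOpen f, homOfLE hf, hxf, c.formallyEtale _, fun a => rfl⟩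

lemma spec_opens_eq_top {W : (Spec (CommRingCat.of ℂ)).Opens} {x : Spec (CommRingCat.of ℂ)}
    (hx : x ∈ W) : W = ⊤ := by
  have : Subsingleton (Spec (CommRingCat.of ℂ)) :=
    inferInstanceAs (Subsingleton (PrimeSpectrum ℂ))
  refine top_le_iff.mp fun y _ => ?_
  rwa [Subsingleton.elim y x]

/-- The spectrum of `ℂ` is a point, so a standard smooth chart of the structure morphism makes the
ring of functions of its source a standard smooth `ℂ`-algebra. -/
lemma exists_coords_of_appLE {V : X.Opens} {x : X} (hx : x ∈ V)
    {W : (Spec (CommRingCat.of ℂ)).Opens} (e : V ≤ (X ↘ Spec (CommRingCat.of ℂ)) ⁻¹ᵁ W) {n : ℕ}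
    (h : ((X ↘ Spec (CommRingCat.of ℂ)).appLE W V e).hom.IsStandardSmoothOfRelativeDimension n) :
    Nonempty (Coords ℂ Γ(X, V) n) := by
  obtain rfl := spec_opens_eq_top (e hx)
  have h1 : (structureHom V).IsStandardSmoothOfRelativeDimension n :=
    RingHom.isStandardSmoothOfRelativeDimension_respectsIso.2 _
      (Scheme.ΓSpecIso (CommRingCat.of ℂ)).symm.commRingCatIsoToRingEquiv h
  have : Algebra.IsStandardSmoothOfRelativeDimension n ℂ Γ(X, V) := h1
  exact exists_coords ℂ Γ(X, V) n

/-- A smooth scheme has local coordinates around every point. -/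
lemma exists_coords_of_smooth [Smooth (X ↘ Spec (CommRingCat.of ℂ))] (x : X) :
    ∃ (U : X.Opens) (n : ℕ) (c : Coords ℂ Γ(X, U) n), x ∈ U ∧ c.IsLocal := by
  obtain ⟨W, hW, V, hV, hx, e, hf⟩ := Smooth.exists_isStandardSmooth (X ↘ Spec (CommRingCat.of ℂ)) x
  obtain ⟨_, _, _, _, ⟨P⟩⟩ := hf
  let := ((X ↘ Spec (CommRingCat.of ℂ)).appLE W V e).hom.toAlgebra
  obtain ⟨c⟩ := exists_coords_of_appLE hx e (n := P.dimension) ⟨_, _, _, ‹_›, P, rfl⟩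
  exact ⟨V, _, c, hx, c.isLocal_of_isAffineOpen hV⟩

/-- The number of local coordinates on a smooth quasi-compact scheme is bounded. -/
lemma exists_coords_le [Smooth (X ↘ Spec (CommRingCat.of ℂ))]
    [QuasiCompact (X ↘ Spec (CommRingCat.of ℂ))] : ∃ N, ∀ x : X,
      ∃ (U : X.Opens) (n : ℕ) (c : Coords ℂ Γ(X, U) n), x ∈ U ∧ c.IsLocal ∧ n ≤ N := by
  have : CompactSpace X := QuasiCompact.compactSpace_of_compactSpace (X ↘ Spec (CommRingCat.of ℂ))
  choose U n c hx hc using exists_coords_of_smooth (X := X)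
  obtain ⟨t, ht⟩ := isCompact_univ.elim_finite_subcover (fun x => (U x : Set X))
    (fun x => (U x).isOpen) fun x _ => Set.mem_iUnion.mpr ⟨x, hx x⟩
  refine ⟨t.sup n, fun x => ?_⟩
  obtain ⟨y, hy⟩ := Set.mem_iUnion.mp (ht (Set.mem_univ x))
  obtain ⟨hyt, hxy⟩ := Set.mem_iUnion.mp hy
  exact ⟨U y, n y, c y, hxy, hc y, Finset.le_sup hyt⟩

/-- Around every point there are at most `d` coordinates if the dimension is at most `d`. -/
lemma exists_coords_of_dimLE {d : ℕ} (hd : DimLE X d) (x : X) :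
    ∃ (U : X.Opens) (n : ℕ) (c : Coords ℂ Γ(X, U) n), x ∈ U ∧ c.IsLocal ∧ n ≤ d := by
  obtain ⟨U, hx, n, hn, h⟩ := hd x
  obtain ⟨W, hW, V, hV, hxV, e, hf⟩ :=
    h.exists_isStandardSmoothOfRelativeDimension ⟨x, hx⟩
  have hx' : x ∈ U.ι ''ᵁ V := ⟨⟨x, hx⟩, hxV, rfl⟩
  have e' : U.ι ''ᵁ V ≤ (X ↘ Spec (CommRingCat.of ℂ)) ⁻¹ᵁ W := by
    rintro _ ⟨y, hy, rfl⟩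
    exact e hy
  have hcomp : (X ↘ Spec (CommRingCat.of ℂ)).appLE W (U.ι ''ᵁ V) e' =
      (U.ι ≫ X ↘ Spec (CommRingCat.of ℂ)).appLE W V e ≫ (U.ι.appIso V).inv := by
    rw [Iso.eq_comp_inv, Scheme.Hom.appIso_hom', Scheme.Hom.appLE_comp_appLE]
  obtain ⟨c⟩ := exists_coords_of_appLE hx' e' (n := n) (by
    rw [hcomp]
    exact RingHom.isStandardSmoothOfRelativeDimension_respectsIso.1 _
      (U.ι.appIso V).symm.commRingCatIsoToRingEquiv hf)
  exact ⟨_, n, c, hx', c.isLocal_of_isAffineOpen (hV.image_of_isOpenImmersion U.ι), hn⟩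

end Coordinates

end
end CrysPoincare

namespace CrysPoincare

noncomputable section

/-! ### Locally split monomorphisms -/

section LocallySplit

/-- A linear retraction of a map extends to principal parts. -/
lemma ppMap_injective {k A M N : Type*} [CommRing k] [CommRing A] [Algebra k A] [AddCommGroup M]
    [Module k M] [Module A M] [IsScalarTower k A M] [AddCommGroup N] [Module k N] [Module A N]
    [IsScalarTower k A N] {m : ℕ} (D : M →ₗ[k] N)
    (h : filt k A M (m + 1) ≤ (filt k A N (m + 1)).comap (D.baseChange A)) (g : N →ₗ[A] M)
    (hg : ∀ x, g (D x) = x) : Function.Injective (ppMap D h) := by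
  have h' : filt k A N (m + 1) ≤ (filt k A M (m + 1)).comap
      ((g.restrictScalars k).baseChange A) :=
    (IsDiffOp.of_linear (D := g.restrictScalars k) fun a x => map_smul g a x).filt_le (m + 1)
  refine Function.LeftInverse.injective (g := ppMap (g.restrictScalars k) h') fun y => ?_
  induction y using principalParts_induction with
  | h a x =>
    rw [map_smul, map_smul, ppMap_univOp, ppMap_univOp]
    exact congrArg (fun z => a • univOp A m z) (hg x)
  | hadd y z hy hz => rw [map_add, map_add, hy, hz]

variable {X : Scheme.{0}} {M N : X.Modules}

/-- A morphism of modules which has a retraction in a neighbourhood of every point. -/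
def IsLocallySplit (f : M ⟶ N) : Prop :=
  ∀ x : X, ∃ U : X.Opens, x ∈ U ∧
    ∃ r : restr N U ⟶ restr M U, (Scheme.Modules.restrictFunctor U.ι).map f ≫ r = 𝟙 _

/-- The map on sections over the image of `V` given by a morphism over `U`. -/
def imageSections {U : X.Opens} (r : restr N U ⟶ restr M U) (V : U.toScheme.Opens) :
    Γ(N, U.ι ''ᵁ V) →ₗ[Γ(X, U.ι ''ᵁ V)] Γ(M, U.ι ''ᵁ V) where
  toFun s := (restrEquiv M U V).symm (r.app V (restrEquiv N U V s))
  map_add' s t := by rw [map_add, map_add, map_add]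
  map_smul' a s := by
    rw [restrEquiv_smul, Scheme.Modules.Hom.app_smul, AddEquiv.symm_apply_eq, RingHom.id_apply,
      restrEquiv_smul, AddEquiv.apply_symm_apply]

lemma imageSections_app {U : X.Opens} {f : M ⟶ N} {r : restr N U ⟶ restr M U}
    (h : (Scheme.Modules.restrictFunctor U.ι).map f ≫ r = 𝟙 _) (V : U.toScheme.Opens)
    (s : Γ(M, U.ι ''ᵁ V)) : imageSections r V (f.app _ s) = s := by
  refine (AddEquiv.symm_apply_eq _).mpr ?_
  exact congrArg (fun g => Scheme.Modules.Hom.app g V (restrEquiv M U V s)) h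

lemma IsLocallySplit.exists_retraction {f : M ⟶ N} (hf : IsLocallySplit f) {V : X.Opens} {x : X}
    (hx : x ∈ V) : ∃ (W : X.Opens) (_ : W ⟶ V), x ∈ W ∧
      ∃ g : Γ(N, W) →ₗ[Γ(X, W)] Γ(M, W), ∀ s, g (f.app W s) = s := by
  obtain ⟨U, hxU, r, hr⟩ := hf x
  refine ⟨U.ι ''ᵁ (U.ι ⁻¹ᵁ V), homOfLE ?_, ⟨⟨x, hxU⟩, hx, rfl⟩, imageSections r _,
    imageSections_app hr _⟩
  rintro _ ⟨y, hy, rfl⟩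
  exact hy

lemma mono_of_injective {f : M ⟶ N} (h : ∀ (V : X.Opens) (s : Γ(M, V)), f.app V s = 0 → s = 0) :
    Mono f where
  right_cancellation {T} g g' hgg := by
    refine Scheme.Modules.hom_ext _ _ fun V => ?_
    ext s
    have h1 : f.app V (g.app V s) = f.app V (g'.app V s) :=
      congrArg (fun k => Scheme.Modules.Hom.app k V s) hgg
    rw [← sub_eq_zero]
    refine h V _ ?_
    rw [map_sub, h1, sub_self]

lemma IsLocallySplit.mono {f : M ⟶ N} (hf : IsLocallySplit f) : Mono f :=
  mono_of_injective fun V s hs => eq_of_local fun x hx => by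
    obtain ⟨W, i, hxW, g, hg⟩ := hf.exists_retraction hx
    refine ⟨W, i, hxW, ?_⟩
    rw [← hg (M.presheaf.map i.op s), app_presheaf_map, hs, map_zero, map_zero, map_zero]

variable [X.Over (Spec (CommRingCat.of ℂ))]

lemma ppMap_jetRes {m n : ℕ} (D : LinMap M N) (h : D.Compat m n) {U V : X.Opens} (i : V ⟶ U)
    (y : PrincipalParts ℂ Γ(X, U) Γ(M, U) m) :
    ppMap (D.app V) (h V) (jetRes m M i y) = jetRes n N i (ppMap (D.app U) (h U) y) :=
  PresheafOfModules.naturality_apply (jetPresheafMap D h) i.op y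

/-- A principal part which dies under `f` after restriction along `j` dies on the smaller open subset
on which `f` has a retraction. -/
lemma jetRes_eq_zero_of_retraction {f : M ⟶ N} {m : ℕ} {W W' W₀ : X.Opens} (j : W' ⟶ W)
    (l : W₀ ⟶ W') (y : PrincipalParts ℂ Γ(X, W) Γ(M, W) m)
    (h : jetRes m N j (ppMap ((LinMap.ofHom f).app W)
      (LinMap.compat_ofHom (m := m) f le_rfl W) y) = 0)
    (g : Γ(N, W₀) →ₗ[Γ(X, W₀)] Γ(M, W₀)) (hg : ∀ s, g (f.app W₀ s) = s) :
    jetRes m M (l ≫ j) y = 0 := by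
  refine ppMap_injective ((LinMap.ofHom f).app W₀) (LinMap.compat_ofHom f le_rfl W₀) g hg ?_
  refine (ppMap_jetRes (.ofHom f) (LinMap.compat_ofHom f le_rfl) (l ≫ j) y).trans ?_
  refine (jetRes_comp m N j l _).trans ?_
  exact (congrArg (jetRes m N l) h).trans ((map_zero _).trans (map_zero _).symm)

/-- Principal parts preserve locally split monomorphisms. -/
lemma IsLocallySplit.mono_jetMap {f : M ⟶ N} (hf : IsLocallySplit f) (m : ℕ) :
    Mono (jetMap (m := m) (.ofHom f) (LinMap.compat_ofHom f le_rfl)) :=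
  mono_of_injective fun V s hs => eq_of_local fun x hx => by
    obtain ⟨W, i, hxW, y, hy⟩ := toJet_local s x hx
    have h1 : toJet m N W (ppMap ((LinMap.ofHom f).app W) (LinMap.compat_ofHom f le_rfl W) y) = 0 := by
      rw [← jetMap_toJet, hy]
      exact (app_presheaf_map _ _ _).trans ((congrArg _ hs).trans (map_zero _))
    obtain ⟨W', j, hxW', h2⟩ := toJet_eq_zero_local _ h1 x hxW
    obtain ⟨W₀, l, hxW₀, g, hg⟩ := hf.exists_retraction hxW'
    have h3 := jetRes_eq_zero_of_retraction j l y h2 g hg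
    have h4 : (jet m M).presheaf.map (l ≫ j).op ((jet m M).presheaf.map i.op s) = 0 := by
      rw [← hy]
      exact (toJet_res m M (l ≫ j) y).symm.trans ((congrArg _ h3).trans (map_zero _))
    refine ⟨W₀, (l ≫ j) ≫ i, hxW₀, ?_⟩
    rw [presheaf_map_comp] at h4
    rw [h4, map_zero]

end LocallySplit

end
end CrysPoincare

namespace CrysPoincare

noncomputable section

/-! ### The images of the differentials -/

section Images

open Opposite

section Modules

variable {X : Scheme.{0}} {A K L M T : X.Modules}

lemma eq_zero_of_local {f : M ⟶ L} (h : ∀ x : X, ∃ U : X.Opens, x ∈ U ∧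
    (Scheme.Modules.restrictFunctor U.ι).map f = 0) : f = 0 := by
  refine Scheme.Modules.hom_ext _ _ fun V => ?_
  ext s
  refine eq_of_local fun x hx => ?_
  obtain ⟨U, hxU, hU⟩ := h x
  have hle : U.ι ''ᵁ (U.ι ⁻¹ᵁ V) ≤ V := by
    rintro _ ⟨y, hy, rfl⟩
    exact hy
  refine ⟨U.ι ''ᵁ (U.ι ⁻¹ᵁ V), homOfLE hle, ⟨⟨x, hxU⟩, hx, rfl⟩, ?_⟩
  have h1 : restrEquiv L U (U.ι ⁻¹ᵁ V) (f.app _ (M.presheaf.map (homOfLE hle).op s)) = 0 :=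
    congrArg (fun g => Scheme.Modules.Hom.app g (U.ι ⁻¹ᵁ V)
      (restrEquiv M U (U.ι ⁻¹ᵁ V) (M.presheaf.map (homOfLE hle).op s))) hU
  rw [map_eq_zero_iff _ (restrEquiv L U (U.ι ⁻¹ᵁ V)).injective] at h1
  refine Eq.trans ?_ (h1.trans (map_zero (L.presheaf.map (homOfLE hle).op).hom).symm)
  exact (app_presheaf_map f _ _).symm

/-- A composable pair `A ⟶ K ⟶ L` for which the identity of `K` is locally homotopic to zero. -/
def Contracted (δ : A ⟶ K) (d : K ⟶ L) : Prop :=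
  ∀ x : X, ∃ U : X.Opens, x ∈ U ∧ ∃ (k : restr K U ⟶ restr A U) (h : restr L U ⟶ restr K U),
    k ≫ (Scheme.Modules.restrictFunctor U.ι).map δ +
      (Scheme.Modules.restrictFunctor U.ι).map d ≫ h = 𝟙 _

/-- If the identity of `K` is homotopic to zero, then `h` induces a retraction of the inclusion of the
image `coker δ ⟶ L`. -/
lemma Contracted.isLocallySplit_desc {δ : A ⟶ K} {d : K ⟶ L} (hd : Contracted δ d)
    (w : δ ≫ d = 0) : IsLocallySplit (cokernel.desc δ d w) := fun x => by
  obtain ⟨U, hxU, k, h, hk⟩ := hd x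
  refine ⟨U, hxU, h ≫ (Scheme.Modules.restrictFunctor U.ι).map (cokernel.π δ), ?_⟩
  have he : Epi ((Scheme.Modules.restrictFunctor U.ι).map (cokernel.π δ)) := inferInstance
  rw [← cancel_epi ((Scheme.Modules.restrictFunctor U.ι).map (cokernel.π δ)),
    ← Functor.map_comp_assoc, cokernel.π_desc, Category.comp_id]
  have h1 := congrArg (· ≫ (Scheme.Modules.restrictFunctor U.ι).map (cokernel.π δ)) hk
  simp only [Preadditive.add_comp, Category.assoc, ← Functor.map_comp, cokernel.condition,
    Functor.map_zero, comp_zero, zero_add, Category.id_comp] at h1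
  exact h1

/-- Morphisms to `L` which vanish in the next term factor through the image. -/
lemma Contracted.exists_lift {d : K ⟶ L} {e : L ⟶ M} (he : Contracted d e) (τ : A ⟶ L) (_ : Mono τ)
    (hτ : ∃ π, π ≫ τ = d) (y : T ⟶ L) (hy : y ≫ e = 0) : ∃ ξ, ξ ≫ τ = y := by
  have hd : d ≫ cokernel.π τ = 0 := by
    obtain ⟨π, rfl⟩ := hτ
    rw [Category.assoc, cokernel.condition, comp_zero]
  have h0 : y ≫ cokernel.π τ = 0 := eq_zero_of_local fun x => by
    obtain ⟨U, hxU, k, h, hk⟩ := he x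
    refine ⟨U, hxU, ?_⟩
    have h1 := congrArg (fun z => (Scheme.Modules.restrictFunctor U.ι).map y ≫ z ≫
      (Scheme.Modules.restrictFunctor U.ι).map (cokernel.π τ)) hk
    simp only [Preadditive.add_comp, Preadditive.comp_add, Category.assoc, Category.id_comp] at h1
    rw [← Functor.map_comp, ← Functor.map_comp, hd, ← Functor.map_comp_assoc, hy] at h1
    simpa using h1.symm
  exact ⟨Abelian.monoLift _ y h0, Abelian.monoLift_comp _ y h0⟩

end Modules

variable {X : Scheme.{0}} [X.Over (Spec (CommRingCat.of ℂ))]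

/-- The map `m ↦ m + 1` on the indices of the pro-objects `{P^m ⊗ Ωᵖ}`. -/
def shift : ℕᵒᵖ × PUnit.{1} ⥤ ℕᵒᵖ × PUnit.{1} where
  obj a := (op (a.1.unop + 1), PUnit.unit)
  map u := ((homOfLE (Nat.add_le_add_right (leOfHom u.1.unop) 1)).op, 𝟙 _)

variable (X) in
/-- The pro-object `{P^m ⊗ Ωᵖ}`. -/
abbrev proOmega (p : ℕ) : ProObj X.Modules := jetObj (ProObj.const (omega X p))

instance : Quiver.IsThin (ℕᵒᵖ × PUnit.{1}) :=
  fun _ _ => ⟨fun _ _ => Prod.ext (Subsingleton.elim _ _) (Subsingleton.elim _ _)⟩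

/-- The transition map from `m + 1` to `m`. -/
def shiftStep (a : ℕᵒᵖ × PUnit.{1}) : shift.obj a ⟶ a := ((homOfLE (Nat.le_succ _)).op, 𝟙 _)

variable (X) in
/-- The differentials of the linearized de Rham complex, as a natural transformation. -/
def levelDNat (p : ℕ) : (shift : (proOmega X (p + 1)).I ⥤ (proOmega X p).I) ⋙ (proOmega X p).F ⟶
    (proOmega X (p + 1)).F where
  app a := levelD X a.1.unop p
  naturality _ _ u := (levelD_levelT p (leOfHom u.1.unop)).symm

variable {p : ℕ} {P : ProObj X.Modules} (Φ : (proOmega X p).I ⥤ P.I)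
  (δ : Φ ⋙ P.F ⟶ (proOmega X p).F)

/-- The inclusion of the levelwise image of the differential. -/
def imageNat (w : ∀ a, δ.app (shift.obj a) ≫ levelD X a.1.unop p = 0) :
    (shift : (proOmega X (p + 1)).I ⥤ (proOmega X p).I) ⋙ (ProObj.levelCoker Φ δ).F ⟶
      (proOmega X (p + 1)).F where
  app a := cokernel.desc (δ.app (shift.obj a)) (levelD X a.1.unop p) (w a)
  naturality _ _ u := by
    apply coequalizer.hom_ext
    refine (cokernel.π_desc_assoc _ _ _ _).trans ?_
    refine (Category.assoc _ _ _).trans ?_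
    refine (congrArg _ (cokernel.π_desc _ _ _)).trans ?_
    refine Eq.trans ?_ (cokernel.π_desc_assoc _ _ _ _).symm
    exact (levelDNat X p).naturality u

variable (X) in
/-- The differential of the linearized de Rham complex, as a morphism of pro-objects. -/
def proD (p : ℕ) : proOmega X p ⟶ proOmega X (p + 1) :=
  ProObj.ofLevel (P := proOmega X p) (Q := proOmega X (p + 1)) shift (levelDNat X p)

/-- Morphisms of pro-objects to `{P^m ⊗ Ωᵖ}` which vanish under the differential factor through a
levelwise image of the preceding differential. -/
lemma exists_lift_of_contracted {B : ProObj X.Modules} [Quiver.IsThin B.I]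
    (Ψ : (proOmega X p).I ⥤ B.I) (τ : Ψ ⋙ B.F ⟶ (proOmega X p).F) (hτ : ∀ a, Mono (τ.app a))
    (hΨ : ∀ b, ∃ a, Nonempty (Ψ.obj a ⟶ b))
    (hfac : ∀ a : ℕᵒᵖ × PUnit.{1}, ∃ (A : X.Modules) (d : A ⟶ jet (a.1.unop + 1) (omega X p)),
      Contracted d (levelD X a.1.unop p) ∧ ∃ π, π ≫ τ.app (shift.obj a) = d)
    {T : ProObj X.Modules} (t : T ⟶ proOmega X p) (ht : t ≫ proD X p = 0) :
    ∃ s, s ≫ ProObj.ofLevel Ψ τ = t := by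
  refine ProObj.lift_of_level (K := proOmega X p) Ψ τ hτ hΨ t fun a => ?_
  obtain ⟨i, y, hy⟩ := T.germ_rep (ProObj.Hom.at t (shift.obj a))
  have h0 : T.germ i (y ≫ levelD X a.1.unop p) = 0 := by
    refine (T.push_germ _ _ _).symm.trans ((congrArg (T.push _) hy).trans ?_)
    exact (ProObj.comp_ofLevel_at (Q := proOmega X p) (R := proOmega X (p + 1)) t shift
      (levelDNat X p) a).symm.trans (show ProObj.Hom.at (t ≫ proD X p) a = 0 by rw [ht]; rfl)
  obtain ⟨i', u, hu⟩ := T.germ_eq_zero h0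
  obtain ⟨A, d, hd, hπ⟩ := hfac a
  have hm := hτ (shift.obj a)
  -- The contraction of level `a` lives on level `shift a`; the transition map brings the lift back.
  obtain ⟨ξ, hξ⟩ := hd.exists_lift (τ.app (shift.obj a)) hm hπ (T.F.map u ≫ y)
    ((Category.assoc _ _ _).trans hu)
  refine ⟨T.germ i' (ξ ≫ B.F.map (Ψ.map (shiftStep a))), ?_⟩
  have hn := τ.naturality (shiftStep a)
  refine (T.push_germ _ _ _).trans ?_
  refine (congrArg (T.germ i') ((Category.assoc _ _ _).trans (congrArg (ξ ≫ ·) hn))).trans ?_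
  refine (congrArg (T.germ i') (((Category.assoc _ _ _).symm).trans
    (congrArg (· ≫ (proOmega X p).F.map (shiftStep a)) hξ))).trans ?_
  refine (congrArg (T.germ i') (Category.assoc _ _ _)).trans ?_
  refine (T.germ_map u _).trans ((T.push_germ _ _ _).symm.trans ?_)
  rw [hy]
  exact ProObj.push_at t (shiftStep a)

variable {Φ δ}

/-- The inclusion of the levelwise image of the differential, as a morphism of pro-objects. -/
def imageIncl (w : ∀ a, δ.app (shift.obj a) ≫ levelD X a.1.unop p = 0) :
    ProObj.levelCoker Φ δ ⟶ proOmega X (p + 1) :=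
  ProObj.ofLevel (P := ProObj.levelCoker Φ δ) (Q := proOmega X (p + 1)) shift (imageNat Φ δ w)

lemma levelCokerπ_imageIncl (w : ∀ a, δ.app (shift.obj a) ≫ levelD X a.1.unop p = 0) :
    ProObj.levelCokerπ Φ δ ≫ imageIncl w = proD X p := by
  ext a
  refine (ProObj.comp_at_germ (ProObj.ofLevel_at (P := ProObj.levelCoker Φ δ) shift
    (imageNat Φ δ w) a) (ProObj.levelCokerπ_at Φ δ (shift.obj a))).trans ?_
  exact congrArg ((proOmega X p).germ (shift.obj a)) (cokernel.π_desc _ _ _)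

section Mono

variable (w : ∀ a, δ.app (shift.obj a) ≫ levelD X a.1.unop p = 0)
  (hc : ∀ a, Contracted (δ.app (shift.obj a)) (levelD X a.1.unop p))

include hc

lemma mono_imageNat (a) : Mono ((imageNat Φ δ w).app a) :=
  ((hc a).isLocallySplit_desc (w a)).mono

lemma mono_imageIncl : Mono (imageIncl w) :=
  ProObj.mono_of_level _ fun i => ⟨shift.obj i, shiftStep i, i,
    (imageNat Φ δ w).app i, mono_imageNat w hc i, rfl⟩

lemma mono_jetPro_imageIncl : Mono ((jetPro X).map (imageIncl w)) :=
  ProObj.mono_of_level _ fun i => ⟨(i.1, shift.obj i.2), (𝟙 _, shiftStep i.2), i, _,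
    ((hc i.2).isLocallySplit_desc (w i.2)).mono_jetMap i.1.unop,
    jetGerm_germ (ProObj.levelCoker Φ δ) i.1 (shift.obj i.2) ((imageNat Φ δ w).app i.2)⟩

lemma exists_lift_imageIncl
    (hc' : ∀ m : ℕ, Contracted (levelD X (m + 1) p) (levelD X m (p + 1)))
    {T : ProObj X.Modules} (t : T ⟶ proOmega X (p + 1)) (ht : t ≫ proD X (p + 1) = 0) :
    ∃ s, s ≫ imageIncl w = t :=
  have : Quiver.IsThin (ProObj.levelCoker Φ δ).I :=
    inferInstanceAs (Quiver.IsThin (ℕᵒᵖ × PUnit.{1}))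
  exists_lift_of_contracted (B := ProObj.levelCoker Φ δ) shift (imageNat Φ δ w)
    (mono_imageNat w hc) (fun b => ⟨b, ⟨shiftStep b⟩⟩)
    (fun a => ⟨_, _, hc' a.1.unop, cokernel.π _, cokernel.π_desc _ _ _⟩) t ht

end Mono

section Augmentation

variable (X) in
/-- The augmentations, as a natural transformation. -/
def levelAugNat : (CategoryTheory.Functor.const (proOmega X 0).I).obj PUnit.unit ⋙
    (ProObj.const (structureSheaf X)).F ⟶ (proOmega X 0).F where
  app a := levelAug X a.1.unop
  naturality _ _ u := (Category.id_comp _).trans (levelAug_levelT (leOfHom u.1.unop)).symm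

variable (hs : ∀ m, IsLocallySplit (levelAug X m))

include hs

lemma mono_secToJet : Mono (secToJet (oneForm X)) :=
  ProObj.mono_of_level _ fun _ => ⟨PUnit.unit, 𝟙 _, (op 0, PUnit.unit), levelAug X 0,
    (hs 0).mono, rfl⟩

lemma mono_jetPro_secToJet : Mono ((jetPro X).map (secToJet (oneForm X))) :=
  ProObj.mono_of_level _ fun i => ⟨i, 𝟙 _, (i.1, (op 0, PUnit.unit)), _,
    (hs 0).mono_jetMap i.1.unop,
    jetGerm_germ (ProObj.const (structureSheaf X)) i.1 PUnit.unit (levelAug X 0)⟩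

lemma exists_lift_secToJet (hc : ∀ m, Contracted (levelAug X (m + 1)) (levelD X m 0))
    {T : ProObj X.Modules} (t : T ⟶ proOmega X 0) (ht : t ≫ proD X 0 = 0) :
    ∃ s, s ≫ secToJet (oneForm X) = t :=
  have : Quiver.IsThin (ProObj.const (structureSheaf X)).I :=
    inferInstanceAs (Quiver.IsThin PUnit.{1})
  exists_lift_of_contracted (B := ProObj.const (structureSheaf X))
    ((CategoryTheory.Functor.const _).obj PUnit.unit) (levelAugNat X) (fun a => (hs a.1.unop).mono)
    (fun _ => ⟨(op 0, PUnit.unit), ⟨𝟙 _⟩⟩)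
    (fun a => ⟨_, _, hc a.1.unop, 𝟙 _, Category.id_comp _⟩) t ht

end Augmentation

end Images

end
end CrysPoincare

namespace CrysPoincare

noncomputable section

/-! ### Exactness of the augmented linearized de Rham complex -/

section Exactness

open Opposite

variable {X : Scheme.{0}} [X.Over (Spec (CommRingCat.of ℂ))]

lemma LocalContraction.contracted (H : ∀ x : X, ∃ U : X.Opens, x ∈ U ∧ Nonempty (LocalContraction U))
    (m p : ℕ) : Contracted (levelD X (m + 1) p) (levelD X m (p + 1)) := fun x => by
  obtain ⟨U, hxU, ⟨C⟩⟩ := H x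
  exact ⟨U, hxU, C.h (m + 1) p, C.h m (p + 1), C.h_d m p⟩

lemma LocalContraction.contracted_aug
    (H : ∀ x : X, ∃ U : X.Opens, x ∈ U ∧ Nonempty (LocalContraction U)) (m : ℕ) :
    Contracted (levelAug X (m + 1)) (levelD X m 0) := fun x => by
  obtain ⟨U, hxU, ⟨C⟩⟩ := H x
  exact ⟨U, hxU, C.c (m + 1), C.h m 0, C.c_aug m⟩

lemma LocalContraction.isLocallySplit_aug
    (H : ∀ x : X, ∃ U : X.Opens, x ∈ U ∧ Nonempty (LocalContraction U)) (m : ℕ) :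
    IsLocallySplit (levelAug X m) := fun x => by
  obtain ⟨U, hxU, ⟨C⟩⟩ := H x
  exact ⟨U, hxU, C.c m, C.aug_c m⟩

/-- A factorization of `g` through an epimorphism `e`, which is a cokernel of `f` at the level of
pro-objects, and a monomorphism `i`. -/
structure StratPro.IsImage {K L M B : StratPro X} (f : K ⟶ L) (g : L ⟶ M) (e : L ⟶ B) (i : B ⟶ M) :
    Prop where
  fac : e ≫ i = g
  epi : Epi (Hom.hom e)
  mono : Mono (Hom.hom i)
  mono_jet : Mono ((jetPro X).map (Hom.hom i))
  coker : ∀ {T : ProObj X.Modules} (t : L.obj ⟶ T), Hom.hom f ≫ t = 0 → ∃ s, Hom.hom e ≫ s = t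

/-- Consecutive images give a factorization in the sense of `StratPro.Factored`, provided that the
first one is a kernel of the second morphism. -/
lemma StratPro.IsImage.factored {K L M N B B' : StratPro X} {k : K ⟶ L} {f : L ⟶ M} {g : M ⟶ N}
    {e : L ⟶ B} {i : B ⟶ M} {p : M ⟶ B'} {j : B' ⟶ N} (h : IsImage k f e i)
    (h' : IsImage f g p j)
    (ker : ∀ {T : ProObj X.Modules} (t : T ⟶ M.obj), t ≫ Hom.hom g = 0 → ∃ s, s ≫ Hom.hom i = t) :
    Factored f g e i p j :=
  ⟨h.fac, h'.fac, h.epi, h'.epi, h.mono, h'.mono, h.mono_jet, ker, h'.coker⟩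

/-- A cokernel of `f` at the level of pro-objects inherits a stratification, and the induced
morphism is compatible with it. -/
lemma StratPro.exists_isImage {P G M : StratPro X} (f : P ⟶ G) (g : G ⟶ M) {B : ProObj X.Modules}
    (hB : IsCoh B) (π : G.obj ⟶ B) (hπ : Epi π) (hfπ : Hom.hom f ≫ π = 0)
    (hcok : ∀ {T : ProObj X.Modules} (t : G.obj ⟶ T), Hom.hom f ≫ t = 0 → ∃ s, π ≫ s = t)
    (ι : B ⟶ M.obj) (hι : π ≫ ι = Hom.hom g) (hm : Mono ι) (hj : Mono ((jetPro X).map ι)) :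
    ∃ (B' : StratPro X) (e : G ⟶ B') (i : B' ⟶ M), IsImage f g e i ∧
      ∀ {T : ProObj X.Modules} (t : T ⟶ M.obj), (∃ s, s ≫ ι = t) → ∃ s, s ≫ Hom.hom i = t := by
  have hfs : P.strat ≫ (jetPro X).map (Hom.hom f) = Hom.hom f ≫ G.strat := (Hom.toFun f).2
  obtain ⟨s, hs⟩ := hcok (G.strat ≫ (jetPro X).map π) (by
    rw [← Category.assoc, ← hfs, Category.assoc, ← Functor.map_comp, hfπ, Functor.map_zero,
      comp_zero])
  let B' : StratPro X := quot G hB π s hs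
  let e : G ⟶ B' := mkHom π hs.symm
  have he : Epi (Hom.hom e) := hπ
  obtain ⟨i, hi⟩ := exists_desc e g ι hι
  have hi' : Hom.hom i = ι := hπ.left_cancellation (Hom.hom i) ι
    ((congrArg Hom.hom hi).trans hι.symm)
  refine ⟨B', e, i, ⟨hi, he, ?_, ?_, hcok⟩, fun t ht => ?_⟩
  · rw [hi']; exact hm
  · rw [hi']; exact hj
  · rw [hi']; exact ht

/-- The image of the differential of the linearized de Rham complex, as a stratified pro-module:
the levelwise cokernel of the preceding morphism. -/
lemma exists_isImage_linDeriv (h : CohTerms X) {p : ℕ} {P : StratPro X} (f : P ⟶ linOmega h p)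
    (Φ : (proOmega X p).I ⥤ P.obj.I) (δ : Φ ⋙ P.obj.F ⟶ (proOmega X p).F)
    (hf : StratPro.Hom.hom f = ProObj.ofLevel (Q := proOmega X p) Φ δ)
    (hcoh : IsCoh (ProObj.levelCoker Φ δ))
    (hΦ : ∀ (j : (proOmega X p).I) (i : P.obj.I) (u : i ⟶ Φ.obj j),
      ∃ (j' : (proOmega X p).I) (v : j' ⟶ j) (w : Φ.obj j' ⟶ i),
        P.obj.F.map (w ≫ u) = P.obj.F.map (Φ.map v))
    (w : ∀ a, δ.app (shift.obj a) ≫ levelD X a.1.unop p = 0)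
    (hc : ∀ a, Contracted (δ.app (shift.obj a)) (levelD X a.1.unop p))
    (hc' : ∀ m : ℕ, Contracted (levelD X (m + 1) p) (levelD X m (p + 1))) :
    ∃ (B : StratPro X) (e : linOmega h p ⟶ B) (i : B ⟶ linOmega h (p + 1)),
      StratPro.IsImage f (linDeriv h p) e i ∧
        ∀ {T : ProObj X.Modules} (t : T ⟶ (linOmega h (p + 1)).obj),
          t ≫ StratPro.Hom.hom (linDeriv h (p + 1)) = 0 → ∃ s, s ≫ StratPro.Hom.hom i = t := by
  obtain ⟨B, e, i, hi, hi'⟩ := StratPro.exists_isImage f (linDeriv h p) hcoh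
    (ProObj.levelCokerπ Φ δ) (ProObj.epi_of_precomp _ (ProObj.precomp_levelCokerπ_injective Φ δ))
    (by rw [hf]; exact ProObj.ofLevel_levelCokerπ Φ δ)
    (fun t ht => ProObj.levelCoker_desc Φ δ hΦ t (hf ▸ ht)) (imageIncl w)
    (levelCokerπ_imageIncl w) (mono_imageIncl w hc) (mono_jetPro_imageIncl w hc)
  exact ⟨B, e, i, hi, fun t ht => hi' t (exists_lift_imageIncl w hc hc' t ht)⟩

section Charts

/-- Every point has a neighbourhood with local coordinates, whose number has the property `Q`. -/
def HasCharts (X : Scheme.{0}) [X.Over (Spec (CommRingCat.of ℂ))] (Q : ℕ → Prop) : Prop :=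
  ∀ x : X, ∃ (U : X.Opens) (n : ℕ) (c : Coords ℂ Γ(X, U) n), x ∈ U ∧ c.IsLocal ∧ Q n

variable {Q : ℕ → Prop} (H : HasCharts X Q)

include H

lemma HasCharts.contraction (x : X) : ∃ U : X.Opens, x ∈ U ∧ Nonempty (LocalContraction U) := by
  obtain ⟨U, n, c, hxU, hc, -⟩ := H x
  exact ⟨U, hxU, ⟨Coords.contraction hc⟩⟩

lemma HasCharts.cohTerms : CohTerms X :=
  ⟨fun _ => isFinitePresentation_of_frames _ fun x =>
      ⟨⊤, trivial, Unit, inferInstance, _, isFrame_structureSheaf ⊤⟩,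
    fun p a => isFinitePresentation_of_frames _ fun x => by
      obtain ⟨U, n, c, hxU, hc, -⟩ := H x
      exact ⟨U, hxU, _, inferInstance, _,
        Coords.isFrame_jet hc (Coords.isFrame_omega hc p) a.1.unop⟩⟩

lemma HasCharts.isLocallyFree (m p : ℕ) :
    SheafOfModules.IsLocallyFree (R := X.ringCatSheaf) (jet m (omega X p)) :=
  isLocallyFree_of_frames _ fun x => by
    obtain ⟨U, n, c, hxU, hc, -⟩ := H x
    exact ⟨U, hxU, _, _, Coords.isFrame_jet hc (Coords.isFrame_omega hc p) m⟩

lemma HasCharts.isCoh_levelAug : IsCoh (ProObj.levelCoker (P := ProObj.const (structureSheaf X))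
    (K := proOmega X 0) _ (levelAugNat X)) := fun a =>
  isFinitePresentation_cokernel _ fun x => by
    obtain ⟨U, n, c, hxU, hc, -⟩ := H x
    exact ⟨U, hxU, Unit, _, inferInstance, inferInstance, _, _, isFrame_structureSheaf U,
      Coords.isFrame_jet hc (Coords.isFrame_omega hc 0) a.1.unop⟩

lemma HasCharts.isCoh_levelD (p : ℕ) : IsCoh (ProObj.levelCoker (P := proOmega X p)
    (K := proOmega X (p + 1)) shift (levelDNat X p)) := fun a =>
  isFinitePresentation_cokernel _ fun x => by
    obtain ⟨U, n, c, hxU, hc, -⟩ := H x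
    exact ⟨U, hxU, _, _, inferInstance, inferInstance, _, _,
      Coords.isFrame_jet hc (Coords.isFrame_omega hc p) (a.1.unop + 1),
      Coords.isFrame_jet hc (Coords.isFrame_omega hc (p + 1)) a.1.unop⟩

/-- There are no forms of degree larger than the number of coordinates. -/
lemma HasCharts.isZero_linOmega (h : CohTerms X) {p : ℕ} (hp : ∀ n, Q n → n < p) :
    IsZero (linOmega h p) := by
  have h0 : ∀ m, 𝟙 (jet m (omega X p)) = 0 := fun m => eq_zero_of_local fun x => by
    obtain ⟨U, n, c, hxU, hc, hn⟩ := H x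
    have : IsEmpty (Set.powersetCard (Fin n) p) := ⟨fun s => by
      have h1 := s.2
      have h2 := Finset.card_le_univ s.1
      have h3 : s.1.card = p := h1
      rw [Fintype.card_fin] at h2
      have := hp n hn
      omega⟩
    exact ⟨U, hxU, (Coords.isFrame_jet hc (Coords.isFrame_omega hc p) m).hom_ext (t := fun _ => 0)
      (fun q => isEmptyElim q.2) fun q => isEmptyElim q.2⟩
  rw [IsZero.iff_id_eq_zero]
  refine StratPro.hom_ext (ProObj.hom_ext fun a => ?_)
  exact (congrArg ((proOmega X p).germ a) (h0 a.1.unop)).trans (map_zero _)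

lemma HasCharts.exists_isImage_aug (h : CohTerms X) :
    ∃ (B : StratPro X) (e : linOmega h 0 ⟶ B) (i : B ⟶ linOmega h 1),
      StratPro.IsImage (augMap h) (linDeriv h 0) e i ∧
        ∀ {T : ProObj X.Modules} (t : T ⟶ (linOmega h 1).obj),
          t ≫ StratPro.Hom.hom (linDeriv h 1) = 0 → ∃ s, s ≫ StratPro.Hom.hom i = t :=
  exists_isImage_linDeriv h (augMap h) _ (levelAugNat X) rfl H.isCoh_levelAug
    (fun j _ _ => ⟨j, 𝟙 _, 𝟙 _, rfl⟩) (fun a => levelAug_levelD a.1.unop)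
    (fun a => LocalContraction.contracted_aug H.contraction a.1.unop)
    (fun m => LocalContraction.contracted H.contraction m 0)

lemma HasCharts.exists_isImage_linDeriv (h : CohTerms X) (p : ℕ) :
    ∃ (B : StratPro X) (e : linOmega h (p + 1) ⟶ B) (i : B ⟶ linOmega h (p + 2)),
      StratPro.IsImage (linDeriv h p) (linDeriv h (p + 1)) e i ∧
        ∀ {T : ProObj X.Modules} (t : T ⟶ (linOmega h (p + 2)).obj),
          t ≫ StratPro.Hom.hom (linDeriv h (p + 2)) = 0 → ∃ s, s ≫ StratPro.Hom.hom i = t :=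
  CrysPoincare.exists_isImage_linDeriv h (linDeriv h p) shift (levelDNat X p) rfl
    (H.isCoh_levelD p)
    (fun j i u => ⟨i, u ≫ shiftStep j, shiftStep i,
      congrArg (proOmega X p).F.map (Subsingleton.elim (α := (shift.obj i ⟶ shift.obj j)) _ _)⟩)
    (fun a => levelD_levelD a.1.unop p)
    (fun a => LocalContraction.contracted H.contraction a.1.unop p)
    (fun m => LocalContraction.contracted H.contraction m (p + 1))

end Charts

end Exactness

end
end CrysPoincare

namespace CrysPoincare

noncomputable section

section ExactAt

variable {X : Scheme.{0}} [X.Over (Spec (CommRingCat.of ℂ))]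

namespace StratPro

/-- Exactness of a stratified complex, and of the underlying complex of pro-modules. -/
lemma Factored.exactAt (K : CochainComplex (StratPro X) ℕ) (l m n : ℕ)
    (hl : (ComplexShape.up ℕ).prev m = l) (hn : (ComplexShape.up ℕ).next m = n) {B B' : StratPro X}
    {f : K.X l ⟶ K.X m} {g : K.X m ⟶ K.X n} {e : K.X l ⟶ B} {i : B ⟶ K.X m} {p : K.X m ⟶ B'}
    {j : B' ⟶ K.X n} (h : Factored f g e i p j) (hf : K.d l m = f) (hg : K.d m n = g)
    {Z : StratPro X} (hZ : IsZero Z) :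
    K.ExactAt m ∧ (((toProCoh X).mapHomologicalComplex _).obj K).ExactAt m := by
  subst hf hg
  exact ⟨(HomologicalComplex.exactAt_iff' _ _ _ _ hl hn).mpr (h.exact (K.d_comp_d l m n) hZ),
    (HomologicalComplex.exactAt_iff' _ _ _ _ hl hn).mpr
      (h.exact_toProCoh (K.d_comp_d l m n) hZ)⟩

/-- A monomorphism, preceded by zero, is a factored complex: this is exactness at the left end. -/
lemma factored_of_mono {K L M Z : StratPro X} (hZ : IsZero Z) {f : K ⟶ L} (hf : f = 0)
    (g : L ⟶ M) (hg : Mono (Hom.hom g)) : Factored f g (0 : K ⟶ Z) (0 : Z ⟶ L) (𝟙 L) g := by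
  have hZ' : IsZero Z.obj := (forgetStrat X).map_isZero hZ
  have hZ'' : IsZero ((jetPro X).obj Z.obj) := (jetPro X).map_isZero hZ'
  refine ⟨by rw [hf, comp_zero], Category.id_comp g, ⟨fun _ _ _ => hZ'.eq_of_src _ _⟩,
    inferInstanceAs (Epi (𝟙 L.obj)), ⟨fun _ _ _ => hZ'.eq_of_tgt _ _⟩, hg,
    ⟨fun _ _ _ => hZ''.eq_of_tgt _ _⟩, fun t ht => ⟨0, ?_⟩, fun t _ => ⟨t, Category.id_comp t⟩⟩
  rw [zero_comp, ← cancel_mono (Hom.hom g), ht, zero_comp]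

end StratPro

variable {Q : ℕ → Prop} (H : HasCharts X Q) (h : CohTerms X)

lemma augDeRham_d_zero : (augDeRham h).d 0 1 = augMap h := rfl

lemma augDeRham_d_succ (p : ℕ) : (augDeRham h).d (p + 1) (p + 1 + 1) = linDeriv h p :=
  CochainComplex.of_d (linOmega h) (linDeriv h) p

include H

lemma HasCharts.factored_aug : ∀ {B : StratPro X} {e : linOmega h 0 ⟶ B} {i : B ⟶ linOmega h 1},
    StratPro.IsImage (augMap h) (linDeriv h 0) e i →
    StratPro.Factored (augMap h) (linDeriv h 0) (𝟙 _) (augMap h) e i := fun hI =>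
  ⟨Category.id_comp _, hI.fac, inferInstanceAs (Epi (𝟙 (stratO h.1).obj)), hI.epi,
    mono_secToJet (LocalContraction.isLocallySplit_aug H.contraction), hI.mono,
    mono_jetPro_secToJet (LocalContraction.isLocallySplit_aug H.contraction),
    fun t ht => exists_lift_secToJet (LocalContraction.isLocallySplit_aug H.contraction)
      (LocalContraction.contracted_aug H.contraction) t ht, hI.coker⟩

/-- The augmented linearized de Rham complex is exact. -/
lemma HasCharts.exactAt {N : ℕ} (hN : ∀ n, Q n → n < N) (i : ℕ) : (augDeRham h).ExactAt i ∧
    (((StratPro.toProCoh X).mapHomologicalComplex _).obj (augDeRham h)).ExactAt i := by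
  have hZ : IsZero (linOmega h N) := H.isZero_linOmega h hN
  obtain ⟨B₀, e₀, i₀, h₀, k₀⟩ := H.exists_isImage_aug h
  choose B e j hB k using H.exists_isImage_linDeriv h
  have hm := mono_secToJet (LocalContraction.isLocallySplit_aug H.contraction)
  match i with
  | 0 =>
    exact StratPro.Factored.exactAt (augDeRham h) 0 0 1 (by simp) (by simp)
      (StratPro.factored_of_mono hZ (f := (0 : stratO h.1 ⟶ stratO h.1)) rfl (augMap h) hm)
      ((augDeRham h).shape 0 0 (by simp)) (augDeRham_d_zero h) hZ
  | 1 =>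
    exact StratPro.Factored.exactAt (augDeRham h) 0 1 2 (by simp) (by simp)
      (H.factored_aug h h₀) (augDeRham_d_zero h) (augDeRham_d_succ h 0) hZ
  | 2 =>
    exact StratPro.Factored.exactAt (augDeRham h) 1 2 3 (by simp) (by simp)
      (h₀.factored (hB 0) k₀) (augDeRham_d_succ h 0) (augDeRham_d_succ h 1) hZ
  | p + 3 =>
    exact StratPro.Factored.exactAt (augDeRham h) (p + 2) (p + 3) (p + 4) (by simp) (by simp)
      ((hB p).factored (hB (p + 1)) (k p)) (augDeRham_d_succ h (p + 1))
      (augDeRham_d_succ h (p + 2)) hZ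

end ExactAt

end
end CrysPoincare

namespace CrysPoincare

noncomputable section

/-! ### The local homotopy -/

section LocalHomotopy

open Opposite

/-- A germ of a morphism from `P` to `G(c)` is a morphism from `P` to the image under `G` of the
constant pro-object `c`. -/
def ProObj.toMapConst {C D : Type*} [Category C] [Category D] [Preadditive C] [Preadditive D]
    {P : ProObj D} (G : C ⥤ D) [G.Additive] (c : C) (x : P.Germ (G.obj c)) :
    P ⟶ (ProObj.mapFunctor G).obj (ProObj.const c) :=
  ProObj.ofGerms (Q := (ProObj.mapFunctor G).obj (ProObj.const c)) (fun _ => x) fun _ _ _ =>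
    (congrArg (fun f => P.push f x) (G.map_id c)).trans (by
      obtain ⟨i, f, rfl⟩ := P.germ_rep x
      exact (P.push_germ _ i f).trans (congrArg (P.germ i) (Category.comp_id f)))

/-- A contraction of a cochain complex from its components. -/
lemma exists_homotopy_of_contraction {V : Type*} [Category V] [Preadditive V]
    (C : CochainComplex V ℕ) (d : ∀ j, C.X j ⟶ C.X (j + 1)) (hd : ∀ j, C.d j (j + 1) = d j)
    (s : ∀ j, C.X (j + 1) ⟶ C.X j) (h₀ : d 0 ≫ s 0 = 𝟙 _)
    (hs : ∀ j, s j ≫ d j + d (j + 1) ≫ s (j + 1) = 𝟙 _) :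
    Nonempty (Homotopy (𝟙 C) 0) := by
  obtain rfl : (fun j => C.d j (j + 1)) = d := funext hd
  let t : ∀ i j, (ComplexShape.up ℕ).Rel j i → (C.X i ⟶ C.X j) := fun i j hij =>
    (show j + 1 = i from hij) ▸ s j
  refine ⟨(Homotopy.ofEq ?_).trans (Homotopy.nullHomotopy' t)⟩
  ext i
  match i with
  | 0 =>
    rw [Homotopy.nullHomotopicMap'_f_of_not_rel_right (k₁ := 0) (k₀ := 1)
      (show 0 + 1 = 1 from rfl) (by simp)]
    exact h₀.symm
  | j + 1 =>
    rw [Homotopy.nullHomotopicMap'_f (k₂ := j) (k₁ := j + 1) (k₀ := j + 2)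
      (show j + 1 = j + 1 from rfl) (show j + 1 + 1 = j + 2 from rfl)]
    exact (hs j).symm.trans (add_comm _ _)

variable {X : Scheme.{0}} {U : X.Opens}

lemma restrictPro_map_at {P Q : ProObj X.Modules} (f : P ⟶ Q) {j : Q.I} {i : P.I}
    {y : P.F.obj i ⟶ Q.F.obj j} (h : ProObj.Hom.at f j = P.germ i y) :
    ProObj.Hom.at ((restrictPro U).map f) j =
      ((restrictPro U).obj P).germ i ((Scheme.Modules.restrictFunctor U.ι).map y) := by
  refine (congrArg (ProObj.germTrans (P := P) (P' := (restrictPro U).obj P) (𝟭 _)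
    (Scheme.Modules.restrictFunctor U.ι) (𝟙 _) _) h).trans ?_
  refine (ProObj.germTrans_germ _ _ _ i y).trans ?_
  exact congrArg (((restrictPro U).obj P).germ i) (Category.id_comp _)

variable [X.Over (Spec (CommRingCat.of ℂ))]

variable (U) in
/-- The restriction of the pro-object `{P^m ⊗ Ωᵖ}` to `U`. -/
abbrev proOmegaOn (p : ℕ) : ProObj U.toScheme.Modules := (restrictPro U).obj (proOmega X p)

namespace LocalContraction

variable (C : LocalContraction U)

lemma levelT_h {m n : ℕ} (hmn : m ≤ n) (p : ℕ) :
    (Scheme.Modules.restrictFunctor U.ι).map (levelT (omega X (p + 1)) hmn) ≫ C.h m p ≫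
        (Scheme.Modules.restrictFunctor U.ι).map (levelT (omega X p) (Nat.le_succ m)) =
      (C.h n p ≫ (Scheme.Modules.restrictFunctor U.ι).map (levelT (omega X p) (Nat.le_succ n))) ≫
        (Scheme.Modules.restrictFunctor U.ι).map (levelT (omega X p) hmn) := by
  rw [← Category.assoc, C.t_h hmn p, Category.assoc, Category.assoc, ← Functor.map_comp,
    ← Functor.map_comp, levelT_trans, levelT_trans]

/-- The contraction `{P^m ⊗ Ω⁰} ⟶ 𝒪` over `U`. -/
def proC : proOmegaOn U 0 ⟶ (restrictPro U).obj (ProObj.const (structureSheaf X)) :=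
  ProObj.toMapConst (P := proOmegaOn U 0) (Scheme.Modules.restrictFunctor U.ι) (structureSheaf X)
    ((proOmegaOn U 0).germ (op 0, PUnit.unit) (C.c 0))

/-- The contraction `{P^m ⊗ Ωᵖ⁺¹} ⟶ {P^m ⊗ Ωᵖ}` over `U`. -/
def proH (p : ℕ) : proOmegaOn U (p + 1) ⟶ proOmegaOn (X := X) U p :=
  ProObj.ofLevel (P := proOmegaOn U (p + 1)) (Q := proOmegaOn U p) (𝟭 (ℕᵒᵖ × PUnit.{1}))
    { app a := C.h a.1.unop p ≫
        (Scheme.Modules.restrictFunctor U.ι).map (levelT (omega X p) (Nat.le_succ a.1.unop))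
      naturality _ _ u := C.levelT_h (leOfHom u.1.unop) p }

variable (U) in
/-- The differential over `U`. -/
abbrev proDOn (p : ℕ) : proOmegaOn (X := X) U p ⟶ proOmegaOn U (p + 1) :=
  (restrictPro U).map (proD X p)

variable (U) in
/-- The augmentation over `U`. -/
abbrev proAugOn : (restrictPro U).obj (ProObj.const (structureSheaf X)) ⟶ proOmegaOn U 0 :=
  (restrictPro U).map (secToJet (oneForm X))

lemma proDOn_at (p : ℕ) (a : ℕᵒᵖ × PUnit.{1}) : ProObj.Hom.at (proDOn (X := X) U p) a =
    (proOmegaOn U p).germ (shift.obj a)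
      ((Scheme.Modules.restrictFunctor U.ι).map (levelD X a.1.unop p)) :=
  restrictPro_map_at (proD X p) rfl

lemma proAugOn_at (a : ℕᵒᵖ × PUnit.{1}) : ProObj.Hom.at (proAugOn (X := X) U) a =
    ((restrictPro U).obj (ProObj.const (structureSheaf X))).germ PUnit.unit
      ((Scheme.Modules.restrictFunctor U.ι).map (levelAug X a.1.unop)) :=
  restrictPro_map_at (secToJet (oneForm X)) rfl

lemma germ_shift (p m : ℕ) {N : U.toScheme.Modules} (f : restr (jet m (omega X p)) U ⟶ N) :
    (proOmegaOn U p).germ (op (m + 1), PUnit.unit)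
      ((Scheme.Modules.restrictFunctor U.ι).map (levelT (omega X p) (Nat.le_succ m)) ≫ f) =
    (proOmegaOn U p).germ (op m, PUnit.unit) f :=
  (proOmegaOn U p).germ_map (shiftStep (op m, PUnit.unit)) f

lemma proH_at (p : ℕ) (a : ℕᵒᵖ × PUnit.{1}) : ProObj.Hom.at (C.proH p) a =
    (proOmegaOn U (p + 1)).germ a (C.h a.1.unop p ≫
      (Scheme.Modules.restrictFunctor U.ι).map (levelT (omega X p) (Nat.le_succ a.1.unop))) :=
  ProObj.ofLevel_at (P := proOmegaOn U (p + 1)) (Q := proOmegaOn U p) (𝟭 (ℕᵒᵖ × PUnit.{1})) _ a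

lemma proC_at : ProObj.Hom.at C.proC PUnit.unit =
    (proOmegaOn U 0).germ (op 0, PUnit.unit) (C.c 0) := rfl

lemma proAugOn_proC : proAugOn U ≫ C.proC = 𝟙 _ := by
  ext a
  refine (ProObj.comp_at_germ (Q := proOmegaOn U 0) C.proC_at
    (proAugOn_at (op 0, PUnit.unit))).trans ?_
  exact congrArg (((restrictPro U).obj (ProObj.const (structureSheaf X))).germ PUnit.unit)
    (C.aug_c 0)

lemma levelT_c_aug (m : ℕ) :
    (Scheme.Modules.restrictFunctor U.ι).map (levelT (omega X 0) (Nat.zero_le (m + 1))) ≫ C.c 0 ≫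
        (Scheme.Modules.restrictFunctor U.ι).map (levelAug X m) =
      (C.c (m + 1) ≫ (Scheme.Modules.restrictFunctor U.ι).map (levelAug X (m + 1))) ≫
        (Scheme.Modules.restrictFunctor U.ι).map (levelT (omega X 0) (Nat.le_succ m)) := by
  rw [← Category.assoc, C.t_c, Category.assoc, ← Functor.map_comp, levelAug_levelT]

lemma proC_proAugOn_at (m : ℕ) : ProObj.Hom.at (C.proC ≫ proAugOn U) (op m, PUnit.unit) =
    (proOmegaOn U 0).germ (op (m + 1), PUnit.unit)
      ((C.c (m + 1) ≫ (Scheme.Modules.restrictFunctor U.ι).map (levelAug X (m + 1))) ≫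
        (Scheme.Modules.restrictFunctor U.ι).map (levelT (omega X 0) (Nat.le_succ m))) := by
  refine (ProObj.comp_at_germ (P := proOmegaOn U 0) (R := proOmegaOn U 0)
    (proAugOn_at (op m, PUnit.unit)) C.proC_at).trans ?_
  refine ((proOmegaOn U 0).germ_map (i := (op (m + 1), PUnit.unit)) (j := (op 0, PUnit.unit))
    ((homOfLE (Nat.zero_le (m + 1))).op, 𝟙 _) _).symm.trans ?_
  exact congrArg ((proOmegaOn U 0).germ (op (m + 1), PUnit.unit)) (C.levelT_c_aug m)

lemma proDOn_proH_at (p m : ℕ) :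
    ProObj.Hom.at (proDOn U p ≫ C.proH p) (op m, PUnit.unit) =
    (proOmegaOn U p).germ (op (m + 1), PUnit.unit)
      (((Scheme.Modules.restrictFunctor U.ι).map (levelD X m p) ≫ C.h m p) ≫
        (Scheme.Modules.restrictFunctor U.ι).map (levelT (omega X p) (Nat.le_succ m))) :=
  (ProObj.comp_at_germ (P := proOmegaOn U p) (R := proOmegaOn U p)
    (C.proH_at p (op m, PUnit.unit)) (proDOn_at p (op m, PUnit.unit))).trans
    (congrArg ((proOmegaOn U p).germ (op (m + 1), PUnit.unit)) (Category.assoc _ _ _).symm)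

lemma levelT_comp_levelD (m p : ℕ) :
    (C.h (m + 1) p ≫ (Scheme.Modules.restrictFunctor U.ι).map
        (levelT (omega X p) (Nat.le_succ (m + 1)))) ≫
        (Scheme.Modules.restrictFunctor U.ι).map (levelD X m p) =
      (C.h (m + 1) p ≫ (Scheme.Modules.restrictFunctor U.ι).map (levelD X (m + 1) p)) ≫
        (Scheme.Modules.restrictFunctor U.ι).map (levelT (omega X (p + 1)) (Nat.le_succ m)) := by
  rw [Category.assoc, Category.assoc, ← Functor.map_comp, ← Functor.map_comp, levelD_levelT]

lemma proH_proDOn_at (p m : ℕ) :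
    ProObj.Hom.at (C.proH p ≫ proDOn U p) (op m, PUnit.unit) =
    (proOmegaOn U (p + 1)).germ (op (m + 1), PUnit.unit)
      ((C.h (m + 1) p ≫ (Scheme.Modules.restrictFunctor U.ι).map (levelD X (m + 1) p)) ≫
        (Scheme.Modules.restrictFunctor U.ι).map (levelT (omega X (p + 1)) (Nat.le_succ m))) :=
  (ProObj.comp_at_germ (P := proOmegaOn U (p + 1)) (R := proOmegaOn U (p + 1))
    (proDOn_at p (op m, PUnit.unit)) (C.proH_at p (op (m + 1), PUnit.unit))).trans
    (congrArg ((proOmegaOn U (p + 1)).germ (op (m + 1), PUnit.unit)) (C.levelT_comp_levelD m p))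

/-- Two endomorphisms of `{P^m ⊗ Ωᵖ}` sum to the identity if they do so on levels, up to a
transition map. -/
lemma add_eq_id {p : ℕ} {f g : proOmegaOn (X := X) U p ⟶ proOmegaOn U p}
    (x y : ∀ m, restr (jet (m + 1) (omega X p)) U ⟶ restr (jet (m + 1) (omega X p)) U)
    (hf : ∀ m, ProObj.Hom.at f (op m, PUnit.unit) =
      (proOmegaOn U p).germ (op (m + 1), PUnit.unit)
        (x m ≫ (Scheme.Modules.restrictFunctor U.ι).map (levelT (omega X p) (Nat.le_succ m))))
    (hg : ∀ m, ProObj.Hom.at g (op m, PUnit.unit) =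
      (proOmegaOn U p).germ (op (m + 1), PUnit.unit)
        (y m ≫ (Scheme.Modules.restrictFunctor U.ι).map (levelT (omega X p) (Nat.le_succ m))))
    (h : ∀ m, x m + y m = 𝟙 _) : f + g = 𝟙 _ := by
  ext ⟨m, _⟩
  obtain ⟨m, rfl⟩ : ∃ n, m = op n := ⟨m.unop, rfl⟩
  refine (ProObj.add_at f g _).trans ?_
  refine (congrArg₂ (· + ·) (hf m) (hg m)).trans ?_
  refine (((proOmegaOn U p).germ (op (m + 1), PUnit.unit)).map_add _ _).symm.trans ?_
  refine Eq.trans (congrArg ((proOmegaOn U p).germ (op (m + 1), PUnit.unit)) ?_)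
    (germ_shift p m (𝟙 (restr (jet m (omega X p)) U)))
  exact (Preadditive.add_comp _ _ _ _ _ _).symm.trans
    ((congrArg (· ≫ _) (h m)).trans ((Category.id_comp _).trans (Category.comp_id _).symm))

lemma proC_proAugOn_add : C.proC ≫ proAugOn U + proDOn U 0 ≫ C.proH 0 = 𝟙 _ :=
  add_eq_id _ _ C.proC_proAugOn_at (C.proDOn_proH_at 0) C.c_aug

lemma proH_proDOn_add (p : ℕ) :
    C.proH p ≫ proDOn U p + proDOn U (p + 1) ≫ C.proH (p + 1) = 𝟙 _ :=
  add_eq_id _ _ (C.proH_proDOn_at p) (C.proDOn_proH_at (p + 1)) fun m => C.h_d m p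

variable (U) in
/-- The augmented linearized de Rham complex over `U`, without the coactions. -/
abbrev augDeRhamOn (h : CohTerms X) : CochainComplex (ProObj U.toScheme.Modules) ℕ :=
  ((StratPro.forgetStrat X ⋙ restrictPro U).mapHomologicalComplex _).obj (augDeRham h)

variable (U) in
/-- The differentials of the augmented linearized de Rham complex over `U`. -/
def augDOn (h : CohTerms X) : ∀ j, (augDeRhamOn U h).X j ⟶ (augDeRhamOn U h).X (j + 1)
  | 0 => proAugOn U
  | p + 1 => proDOn U p

/-- The contraction of the augmented linearized de Rham complex over `U`. -/
def augContraction (h : CohTerms X) :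
    ∀ j, (augDeRhamOn U h).X (j + 1) ⟶ (augDeRhamOn U h).X j
  | 0 => C.proC
  | p + 1 => C.proH p

lemma augDeRhamOn_d (h : CohTerms X) : ∀ j, (augDeRhamOn U h).d j (j + 1) = augDOn U h j
  | 0 => congrArg (fun f => (restrictPro U).map (StratPro.Hom.hom f)) (augDeRham_d_zero h)
  | p + 1 => congrArg (fun f => (restrictPro U).map (StratPro.Hom.hom f)) (augDeRham_d_succ h p)

lemma augContraction_spec (h : CohTerms X) : ∀ j, C.augContraction h j ≫ augDOn U h j +
    augDOn U h (j + 1) ≫ C.augContraction h (j + 1) = 𝟙 _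
  | 0 => C.proC_proAugOn_add
  | p + 1 => C.proH_proDOn_add p

lemma exists_homotopy (C : LocalContraction U) (h : CohTerms X) : Nonempty (Homotopy (𝟙 (augDeRhamOn U h)) 0) :=
  exists_homotopy_of_contraction _ (augDOn U h) (augDeRhamOn_d h) (C.augContraction h)
    C.proAugOn_proC (C.augContraction_spec h)

end LocalContraction

end LocalHomotopy

end
end CrysPoincare

theorem lemma4p3 (X : Scheme.{0}) [X.Over (Spec (CommRingCat.of ℂ))]
    [Smooth (X ↘ Spec (CommRingCat.of ℂ))] [IsSeparated (X ↘ Spec (CommRingCat.of ℂ))]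
    [QuasiCompact (X ↘ Spec (CommRingCat.of ℂ))] :
    ∃ h : CohTerms X,
      (∀ i, (augDeRham h).ExactAt i) ∧
      (∀ i, (((StratPro.toProCoh X).mapHomologicalComplex _).obj (augDeRham h)).ExactAt i) ∧
      (∀ m p, SheafOfModules.IsLocallyFree (R := X.ringCatSheaf) (jet m (omega X p))) ∧
      (∀ x : X, ∃ U : X.Opens, x ∈ U ∧ Nonempty (Homotopy
        (𝟙 (((StratPro.forgetStrat X ⋙ restrictPro U).mapHomologicalComplex _).obj (augDeRham h)))
        0)) ∧
      (∃ N, ∀ p, N < p → IsZero ((linDeRham h).X p)) ∧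
      (∀ d, DimLE X d → ∀ p, d < p → IsZero ((linDeRham h).X p)) := by
  obtain ⟨N, hN⟩ := exists_coords_le (X := X)
  have H : HasCharts X (· ≤ N) := hN
  have hex := H.exactAt H.cohTerms (N := N + 1) fun n hn => Nat.lt_succ_of_le hn
  refine ⟨H.cohTerms, fun i => (hex i).1, fun i => (hex i).2, H.isLocallyFree, fun x => ?_,
    ⟨N, fun p hp => H.isZero_linOmega H.cohTerms fun n hn => lt_of_le_of_lt hn hp⟩, fun d hd p hp => ?_⟩
  · obtain ⟨U, hx, ⟨C⟩⟩ := H.contraction x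
    exact ⟨U, hx, C.exists_homotopy H.cohTerms⟩
  · have Hd : HasCharts X (· ≤ d) := exists_coords_of_dimLE hd
    exact Hd.isZero_linOmega H.cohTerms fun n hn => lt_of_le_of_lt hn hp
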